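/- **Setting.** An order book has state $b=(q^1,q^2,p)$, $q^1,q^2\in\mathbb N^*$ (best bid and ask quantities), $p\in\mathbb R$ (mid price); $b^{sym}=(q^2,q^1,-p)$. It is a pure jump Markov process: limit orders of size $n\in\mathbb N$ arrive on side $i\in\{1,2\}$ (1 = bid, 2 = ask) at rate $\lambda^{i,+}(b,n)\ge 0$, and quantities $n$ are consumed on side $i$ at rate $\lambda^{i,-}(b,n)\ge0$, where $\lambda^{1,-}=\lambda^{1,-}_c+\lambda^{1,-}_m$ (cancellations and market orders). If $n<q^i$ then $q^i$ becomes $q^i-n$; if $n\ge q^i$ the side is depleted and the whole book is redrawn from a probability law $d^i_b$ on $(\mathbb N^*)^2\times\mathbb R$. Assume: $\lambda^{1,\pm}(b,n)=\lambda^{2,\pm}(b^{sym},n)$ and $d^1_b(b')=d^2_{b^{sym}}(b'^{sym})$; $\sup_b\sum_n(\lambda^{1,+}+\lambda^{1,-})(b,n)<\infty$; for some $Q^{max}$, $\lambda^{1,+}(b,n)=0$ if $q^1+n>Q^{max}$ and $\lambda^{1,-}(b,n)=0$ if $q^1>Q^{max}$; regenerated prices lie in $\tau_0\mathbb Z$ for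 some $\tau_0>0$, and regenerated prices and quantities are bounded uniformly in $b$. An agent has to buy an order of size $q_0$. The joint state is $u=(q^{bef},q^a,q^{aft},q^2,i,p,p^{exec})\in\mathbb N^5\times\mathbb R^2$: $q^a$ is the size of the agent's limit order at the bid, $q^{bef}$ and $q^{aft}$ the quantities before and after it in the queue, $i$ the remaining inventory, $p^{exec}$ the acquisition price; $q^1=q^{bef}+q^a+q^{aft}>0$, $q^2>0$ and $q^a\in\{0,i\}$. Between decisions, $U_t$ is the pure jump Markov process with generator $(Q\varphi)(u)=\int(\varphi(u')-\varphi(u))\,Q(u,du')$, whose jumps occur at the rates above, taken at $(q^1,q^2,p)$: * limit orders at the bid increase $q^{aft}$, those at the ask increase $q^2$; * cancellations consume $q^{aft}$, then $q^{bef}$, never $q^a$; a cancellation of size at least $q^{bef}+q^{aft}$ depletes the bid if $q^a=0$, and leaves only the agent's order if $q^a>0$; * market orders at the bid consume $q^{bef}$, then $q^a$, then $q^{aft}$; if $k$ units of the agent's order are filled, $q^a$ and $i$ decrease by $k$ and $p^{exec}$ increases by $k(p-\psi/2)$, $\psi$ being the constant spread; * consumption at the ask decreases $q^2$; * when side $j$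 is depleted, $(q'^1,q'^2,p')$ is drawn from $d^j$; $q'^1$ becomes the quantity of the other participants at the bid, split into $(q^{bef},q^{aft})=(k,q'^1-k)$ with $k$ drawn from a given placement law on $\{0,\dots,q'^1\}$ (which may depend on the state before the depletion, the side and the regenerated book); $q^a$ is unchanged if the ask was depleted, and $q^a=0$ afterwards if the bid was depleted. At the decision dates $k\Delta<T$ ($k\in\mathbb N$, $\Delta>0$, $T\ge0$), as long as $i>0$, the agent chooses one of * $l$, giving $u^l$: if $q^a=0$ the whole inventory $i$ is inserted at the end of the bid queue; otherwise $u^l=u$; * $c$, giving the (possibly random) state $u^c$: the limit order, if any, is withdrawn, the bid being regenerated if it is thereby empty; * $m$, giving the (possibly random) state $u^m$: the inventory is bought at the ask, $p^{exec}$ increases by $i\,[p+\frac\psi2+\alpha(i-q^2)_+]$ ($\alpha$ a constant), $q^2$ decreases by $i$, the limit order is withdrawn, $i$ and $q^a$ become $0$; if $i\ge q^2$ the ask is regenerated, and otherwise, if no order is left at the bid, the bid is regenerated. If $i>0$ at time $T$, decision $m$ is imposed. Controls $\mu$ may depend on all past events. For a state $y$ with zero inventory let $\mathbb E_y[\Delta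 P_\infty]=\lim_{s\to\infty}\mathbb E_y[P_s-p^{exec}]$, where $P$ is the mid price of the order book without agent started from $y$. Let $f$ be Lipschitz, $c\ge0$, $g(u)=f(\mathbb E[\mathbb E_{u^m}[\Delta P_\infty]])$. With $T^{t,\mu}_{Exec}=\inf\{s\ge t: I^\mu_s=0\}\wedge T$, define $$V(t,u)=\sup_\mu\mathbb E\big[f(\mathbb E[\Delta P^\mu_\infty\mid\mathcal F_{T^{t,\mu}_{Exec}}])-c\,q_0\,(T^{t,\mu}_{Exec}-t)\,\big|\,U^\mu_t=u\big],\qquad 0\le t\le T,$$ where $U^\mu_t=u$ is the state before the decision at $t$ (if $t$ is a decision date), and the information at an execution by the agent's own market order is the state in which this order is sent (so that the first term is $g$ of that state). **Theorem.** All the quantities above are well defined: the limits $\mathbb E_y[\Delta P_\infty]$ exist, the gains are integrable, the suprema are finite, and $V(t,\cdot)$ is integrable with respect to $Q(u,\cdot)$ and to the law of $u^c$. For every state $u$: 1. (Decision dates.) If $i>0$ and $t=k\Delta<T$, then $$V(k\Delta,u)=\max\big(V^l((k\Delta)_+,u),\,V^c((k\Delta)_+,u),\,g(u)\big),$$ where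 $V^l(s,u)=V(s,u^l)$, $V^c(s,u)=\mathbb E[V(s,u^c)]$, and the right limits at $k\Delta$ exist. 2. (Between decision dates.) If $i>0$, $0<t<T$ and $t\notin\Delta\mathbb N$, then $V(\cdot,u)$ is differentiable at $t$ and $$\partial_tV(t,u)+(QV(t,\cdot))(u)=c\,q_0 .$$ Moreover $V(\cdot,u)$ is left-continuous on $(0,T]$. 3. (Execution.) If $i=0$, then $V(t,u)=g(u)$ for all $0\le t<T$. 4. (Terminal condition.) $V(T,u)=g(u)$. -/

import Mathlib

open MeasureTheory ProbabilityTheory Filter Topology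
open scoped ENNReal NNReal

namespace OptimalExecution

/-! ## Pure jump Markov processes

A pure jump process on `S` is given by its jump rates: `ν x` is the measure whose mass on `A` is the
rate of the jumps from `x` into `A`.  The process stays at `x` during an exponential time of
parameter `ν x S`, and then jumps according to the normalised measure. -/

section Jump

variable {S : Type} [MeasurableSpace S]

/-- The generator `(Q φ)(x) = ∫ (φ(y) - φ(x)) ν(x, dy)`. -/
noncomputable def generator (ν : S → Measure S) (φ : S → ℝ) (x : S) : ℝ :=
  ∫ y, (φ y - φ x) ∂(ν x)

open Classical in
/-- The law of the state after a jump from `x`.  When the total rate at `x` is `0` the process never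
leaves `x`, which is represented by fictitious jumps from `x` to `x` at rate `1`.
(The same convention covers an infinite total rate, which is excluded in the model below.) -/
noncomputable def jumpLaw (ν : S → Measure S) (x : S) : Measure S :=
  if ν x Set.univ = 0 ∨ ν x Set.univ = ∞ then Measure.dirac x
  else (ν x Set.univ)⁻¹ • ν x

open Classical in
/-- The parameter of the exponential holding time at `x`. -/
noncomputable def exitRate (ν : S → Measure S) (x : S) : ℝ :=
  if ν x Set.univ = 0 ∨ ν x Set.univ = ∞ then 1 else (ν x Set.univ).toReal

theorem exitRate_pos (ν : S → Measure S) (x : S) : 0 < exitRate ν x := by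
  unfold exitRate
  split_ifs with h
  · exact one_pos
  · push Not at h
    exact ENNReal.toReal_pos h.1 h.2

instance (ν : S → Measure S) (x : S) : IsProbabilityMeasure (jumpLaw ν x) := by
  unfold jumpLaw
  split_ifs with h
  · infer_instance
  · push Not at h
    refine ⟨?_⟩
    rw [Measure.smul_apply, smul_eq_mul]
    exact ENNReal.inv_mul_cancel h.1 h.2

instance (ν : S → Measure S) (x : S) : IsProbabilityMeasure (expMeasure (exitRate ν x)) :=
  isProbabilityMeasure_expMeasure (exitRate_pos ν x)

/-- The law of the pair (time, state) after the next jump, when the process is at `h.2` at the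
time `h.1`. -/
noncomputable def nextJumpLaw (ν : S → Measure S) (h : ℝ × S) : Measure (ℝ × S) :=
  ((expMeasure (exitRate ν h.2)).prod (jumpLaw ν h.2)).map fun w => (h.1 + w.1, w.2)

theorem measurable_nextJumpLaw [DiscreteMeasurableSpace S] (ν : S → Measure S) :
    Measurable (nextJumpLaw ν) := by
  let N : Kernel S (ℝ × S) :=
    ⟨fun x => (expMeasure (exitRate ν x)).prod (jumpLaw ν x), Measurable.of_discrete⟩
  have : IsMarkovKernel N := ⟨fun x => by
    change IsProbabilityMeasure ((expMeasure (exitRate ν x)).prod (jumpLaw ν x))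
    infer_instance⟩
  have hF : Measurable fun q : (ℝ × S) × (ℝ × S) => (q.1.1 + q.2.1, q.2.2) := by fun_prop
  refine Measure.measurable_of_measurable_coe _ fun A hA => ?_
  have h1 := Kernel.measurable_kernel_prodMk_left (κ := N.comap Prod.snd measurable_snd) (hF hA)
  convert h1 using 1
  funext h
  rw [nextJumpLaw, Measure.map_apply (by fun_prop) hA]
  rfl

/-- The step of the chain of the successive (time, state) pairs of the jump process. -/
noncomputable def jumpKernel [DiscreteMeasurableSpace S] (ν : S → Measure S) (n : ℕ) :
    Kernel (Π _ : Finset.Iic n, ℝ × S) (ℝ × S) where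
  toFun h := nextJumpLaw ν (h ⟨n, by simp⟩)
  measurable' := (measurable_nextJumpLaw ν).comp (measurable_pi_apply _)

instance [DiscreteMeasurableSpace S] (ν : S → Measure S) (n : ℕ) :
    IsMarkovKernel (jumpKernel ν n) := by
  refine ⟨fun h => ?_⟩
  change IsProbabilityMeasure (nextJumpLaw ν _)
  exact Measure.isProbabilityMeasure_map (by fun_prop)

/-- The law of the jump process started from `x` at time `0`: a path is the sequence of the
successive jump times together with the states that are entered at these times. -/
noncomputable def jumpProcessLaw [DiscreteMeasurableSpace S] (ν : S → Measure S) (x : S) :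
    Measure (ℕ → ℝ × S) :=
  Kernel.traj (X := fun _ => ℝ × S) (jumpKernel ν) 0 fun _ => (0, x)

/-- The state at time `s` of the (right-continuous, piecewise constant) path `ω`. -/
noncomputable def stateAt (ω : ℕ → ℝ × S) (s : ℝ) : S :=
  (ω (sInf {n | s < (ω (n + 1)).1})).2

end Jump

/-! ## The order book and the agent -/

inductive Side
  | bid
  | ask

/-- State `(q¹, q², p)` of the order book: best bid and best ask quantities and mid price. -/
structure Book where
  bidQty : ℕ
  askQty : ℕ
  price : ℝ

/-- State `(q^bef, q^a, q^aft, q², i, p, p^exec)` of the order book together with the agent. -/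
structure State where
  bef : ℕ
  own : ℕ
  aft : ℕ
  askQty : ℕ
  inventory : ℕ
  price : ℝ
  pExec : ℝ

/-- The decisions of the agent: `l` (limit order), `c` (cancel), `m` (market order). -/
inductive Action
  | l
  | c
  | m

/-- What an event leaves behind: the decision that was taken (`none` for an event of the market)
and the new state. -/
structure Mark where
  act : Option Action
  state : State

/-! All the laws on states below are purely atomic, so the discrete `σ`-algebra is used. -/

instance : MeasurableSpace Book := ⊤
instance : MeasurableSpace State := ⊤
instance : MeasurableSpace Action := ⊤
instance : MeasurableSpace Mark := ⊤
instance : DiscreteMeasurableSpace Book := ⟨fun _ => trivial⟩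
instance : DiscreteMeasurableSpace State := ⟨fun _ => trivial⟩
instance : DiscreteMeasurableSpace Action := ⟨fun _ => trivial⟩
instance : DiscreteMeasurableSpace Mark := ⟨fun _ => trivial⟩

instance : Finite Action :=
  Finite.of_surjective (fun k : Fin 3 => ![Action.l, Action.c, Action.m] k) fun a => by
    cases a
    · exact ⟨0, rfl⟩
    · exact ⟨1, rfl⟩
    · exact ⟨2, rfl⟩

/-- An event of the controlled process: its time and its mark. -/
abbrev Event := ℝ × Mark

/-- Both limits are non-empty. -/
def Book.Positive (b : Book) : Prop := 0 < b.bidQty ∧ 0 < b.askQty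

/-- The symmetric state `(q², q¹, -p)`. -/
def Book.sym (b : Book) : Book := ⟨b.askQty, b.bidQty, -b.price⟩

/-- The order book `(q^bef + q^a + q^aft, q², p)` seen in the state `x`. -/
def State.book (x : State) : Book := ⟨x.bef + x.own + x.aft, x.askQty, x.price⟩

/-- Both limits are non-empty, and the agent's limit order, if there is one, has the size of the
whole inventory. -/
def State.Valid (x : State) : Prop := x.book.Positive ∧ (x.own = 0 ∨ x.own = x.inventory)

/-- The data of the order book model and of the execution problem. -/
structure Model where
  /-- `λ^{1,+}` (bid) and `λ^{2,+}` (ask): arrival rates of limit orders of a given size. -/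
  insertRate : Side → Book → ℕ → ℝ≥0
  /-- `λ^{1,-}_c`: rates of the cancellations at the best bid. -/
  cancelRate : Book → ℕ → ℝ≥0
  /-- `λ^{1,-}_m`: rates of the market orders that hit the best bid. -/
  marketRate : Book → ℕ → ℝ≥0
  /-- `λ^{2,-}`: consumption rates at the best ask. -/
  askRate : Book → ℕ → ℝ≥0
  /-- `d^i_u`: law of the regenerated book after the depletion of one side, from the state `u` just
  before the depletion. -/
  regen : Side → Book → PMF Book
  /-- `ι^i_u`: law of the quantity placed before the agent's order after a regeneration, given the
  state just before the depletion and the regenerated book. -/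
  placement : Side → State → Book → PMF ℕ
  /-- `ψ` -/
  spread : ℝ
  /-- `α`, the temporary impact coefficient of a market order -/
  impactCoef : ℝ
  /-- `c`, the homogenisation constant of the waiting cost -/
  waitCost : ℝ
  /-- the size `q^a` of the order to execute, which enters the waiting cost -/
  orderSize : ℕ
  /-- `f` -/
  reward : ℝ → ℝ
  /-- `Δ`, the time between two decisions -/
  period : ℝ
  /-- `T` -/
  horizon : ℝ

namespace Model

variable (M : Model)

/-- `λ^{1,-} = λ^{1,-}_c + λ^{1,-}_m` (bid) and `λ^{2,-}` (ask), without an order of the agent. -/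
def consumeRate : Side → Book → ℕ → ℝ≥0
  | .bid => fun u n => M.cancelRate u n + M.marketRate u n
  | .ask => M.askRate

/-! ### The order book without the agent -/

open Classical in
/-- The book after the consumption of the quantity `n` on one side. -/
noncomputable def bookConsume (side : Side) (u : Book) (n : ℕ) : Measure Book :=
  match side with
  | .bid => if n < u.bidQty then Measure.dirac ⟨u.bidQty - n, u.askQty, u.price⟩
      else (M.regen .bid u).toMeasure
  | .ask => if n < u.askQty then Measure.dirac ⟨u.bidQty, u.askQty - n, u.price⟩
      else (M.regen .ask u).toMeasure

/-- Jump rates of the order book `(Q¹, Q², P)`. -/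
noncomputable def bookRates (u : Book) : Measure Book :=
  Measure.sum (fun n => M.insertRate .bid u n •
      Measure.dirac (⟨u.bidQty + n, u.askQty, u.price⟩ : Book)) +
  Measure.sum (fun n => M.insertRate .ask u n •
      Measure.dirac (⟨u.bidQty, u.askQty + n, u.price⟩ : Book)) +
  Measure.sum (fun n => M.consumeRate .bid u n • M.bookConsume .bid u n) +
  Measure.sum (fun n => M.consumeRate .ask u n • M.bookConsume .ask u n)

/-- `𝔼_u[P_s]` for the order book without the agent. -/
noncomputable def meanPrice (u : Book) (s : ℝ) : ℝ :=
  ∫ ω, (stateAt ω s).price ∂(jumpProcessLaw M.bookRates u)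

/-- The long term mid price `lim_{s → ∞} 𝔼_u[P_s]`. -/
noncomputable def longTermPrice (u : Book) : ℝ := limUnder atTop (M.meanPrice u)

/-- `𝔼_y[ΔP_∞] = lim_{s → ∞} 𝔼_y[P_s - P^exec]` for a state `y` in which the execution is over. -/
noncomputable def priceImpact (y : State) : ℝ := M.longTermPrice y.book - y.pExec

/-! ### The order book with the agent, between two decisions -/

/-- The state after a depletion of one side in the state `x`: the other participants' best bid
quantity, the best ask quantity and the price are regenerated, the position of the agent's order is
drawn from the placement law; the agent's own components are prescribed. -/
noncomputable def regenerate (side : Side) (x : State) (own inventory : ℕ) (pExec : ℝ) :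
    Measure State :=
  ((M.regen side x.book).bind fun b =>
    (M.placement side x b).map fun k =>
      (⟨k, own, b.bidQty - k, b.askQty, inventory, b.price, pExec⟩ : State)).toMeasure

open Classical in
/-- A cancellation of size `n` at the best bid: it consumes `q^aft` first, then `q^bef`, and never
the agent's order. -/
noncomputable def cancelMove (x : State) (n : ℕ) : Measure State :=
  if n < x.bef + x.aft then
    if n ≤ x.aft then Measure.dirac { x with aft := x.aft - n }
    else Measure.dirac { x with bef := x.bef + x.aft - n, aft := 0 }
  else if x.own = 0 then M.regenerate .bid x 0 x.inventory x.pExec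
  else Measure.dirac { x with bef := 0, aft := 0 }

open Classical in
/-- A market order of size `n` that hits the best bid: it consumes `q^bef` first, then the agent's
order (bought by the agent at the price `p - ψ/2`), then `q^aft`. -/
noncomputable def marketMove (x : State) (n : ℕ) : Measure State :=
  if n < x.bef + x.own + x.aft then
    let filled := min (n - x.bef) x.own
    Measure.dirac
      { bef := x.bef - n
        own := x.own - filled
        aft := x.aft - (n - (x.bef + x.own))
        askQty := x.askQty
        inventory := if x.own = 0 then x.inventory else x.own - filled
        price := x.price
        pExec := x.pExec + filled * (x.price - M.spread / 2) }
  else M.regenerate .bid x 0 (if x.own = 0 then x.inventory else 0)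
    (x.pExec + x.own * (x.price - M.spread / 2))

open Classical in
/-- A consumption of the quantity `n` at the best ask. -/
noncomputable def askMove (x : State) (n : ℕ) : Measure State :=
  if n < x.askQty then Measure.dirac { x with askQty := x.askQty - n }
  else M.regenerate .ask x x.own x.inventory x.pExec

/-- Jump rates of the process `U^μ` between two decisions. -/
noncomputable def rates (x : State) : Measure State :=
  Measure.sum (fun n => M.insertRate .bid x.book n •
      Measure.dirac ({ x with aft := x.aft + n } : State)) +
  Measure.sum (fun n => M.insertRate .ask x.book n •
      Measure.dirac ({ x with askQty := x.askQty + n } : State)) +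
  Measure.sum (fun n => M.cancelRate x.book n • M.cancelMove x n) +
  Measure.sum (fun n => M.marketRate x.book n • M.marketMove x n) +
  Measure.sum (fun n => M.askRate x.book n • M.askMove x n)

/-! ### The decisions -/

open Classical in
/-- `u^l`: the whole inventory is inserted at the end of the bid queue, if not already inserted. -/
noncomputable def limitState (x : State) : State :=
  if x.own = 0 then { x with bef := x.bef + x.aft, own := x.inventory, aft := 0 } else x

open Classical in
/-- Law of `u^c`: the agent's order, if any, is withdrawn; the bid is regenerated when nothing else
was there. -/
noncomputable def cancelLaw (x : State) : Measure State :=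
  if x.own = 0 then Measure.dirac x
  else if x.bef + x.aft = 0 then M.regenerate .bid x 0 x.inventory x.pExec
  else Measure.dirac { x with own := 0 }

open Classical in
/-- Law of `u^m`: the inventory is bought at the best ask, with a linear temporary impact, and the
agent's limit order, if any, is withdrawn; a side that is emptied in this way is regenerated. -/
noncomputable def marketLaw (x : State) : Measure State :=
  let cost := x.pExec + x.inventory *
    (x.price + M.spread / 2 + M.impactCoef * max ((x.inventory : ℝ) - x.askQty) 0)
  if x.askQty ≤ x.inventory then M.regenerate .ask x 0 0 cost
  else if x.bef + x.aft = 0 then M.regenerate .bid x 0 0 cost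
  else Measure.dirac
    { x with own := 0, askQty := x.askQty - x.inventory, inventory := 0, pExec := cost }

open Classical in
/-- The state after a decision.  There is nothing to decide once the order is executed. -/
noncomputable def decisionLaw (x : State) (a : Action) : Measure State :=
  if x.inventory = 0 then Measure.dirac x
  else match a with
    | .l => Measure.dirac (limitState x)
    | .c => M.cancelLaw x
    | .m => M.marketLaw x

/-- `g(u) = f(𝔼[𝔼_{u^m}[ΔP_∞]])`: the gain of immediate execution by a market order. -/
noncomputable def marketGain (x : State) : ℝ :=
  M.reward (∫ y, M.priceImpact y ∂(M.marketLaw x))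

/-! ### The controlled process -/

open Classical in
/-- The next decision date after the time `s`, or `T` if this comes first.  Decisions are taken at
the multiples of `Δ`; a decision date that coincides with the initial time (that is, with the event
number `0`) is a date at which the agent decides. -/
noncomputable def nextDate (n : ℕ) (s : ℝ) : ℝ :=
  min (((if n = 0 then ⌈s / M.period⌉ else ⌊s / M.period⌋ + 1 : ℤ) : ℝ) * M.period) M.horizon

open Classical in
/-- The law of the event number `n + 1`, when the event number `n` is `h` and the agent's decision
would be `a`: the market jumps if the exponential clock rings before the next date `D`; otherwise
the agent decides at `D`.  The decision at `T` has to be a market order. -/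
noncomputable def eventLaw (n : ℕ) (h : Event) (a : Action) : Measure Event :=
  let x := h.2.state
  let D := M.nextDate n h.1
  let b := if D = M.horizon then Action.m else a
  ((expMeasure (exitRate M.rates x)).prod ((jumpLaw M.rates x).prod (M.decisionLaw x b))).map
    fun w => if h.1 + w.1 < D then (h.1 + w.1, ⟨none, w.2.1⟩) else (D, ⟨some b, w.2.2⟩)

instance (side : Side) (x : State) (a i : ℕ) (e : ℝ) :
    IsProbabilityMeasure (M.regenerate side x a i e) := by
  unfold regenerate
  infer_instance

instance (x : State) (a : Action) : IsProbabilityMeasure (M.decisionLaw x a) := by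
  unfold decisionLaw
  split_ifs
  · infer_instance
  · cases a
    · dsimp only
      infer_instance
    · dsimp only [cancelLaw]
      split_ifs <;> infer_instance
    · dsimp only [marketLaw]
      split_ifs <;> infer_instance

theorem measurable_nextDate (n : ℕ) : Measurable (M.nextDate n) := by
  unfold nextDate
  split_ifs
  · exact (((Measurable.of_discrete (f := fun k : ℤ => (k : ℝ))).comp
      (Int.measurable_ceil.comp (measurable_id.div_const _))).mul_const _).min measurable_const
  · exact (((Measurable.of_discrete (f := fun k : ℤ => ((k + 1 : ℤ) : ℝ))).comp
      (Int.measurable_floor.comp (measurable_id.div_const _))).mul_const _).min measurable_const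

theorem measurable_eventLaw (n : ℕ) :
    Measurable fun q : Event × Action => M.eventLaw n q.1 q.2 := by
  classical
  refine measurable_from_prod_countable_left fun a => ?_
  let N : Action → Kernel State (ℝ × State × State) := fun b =>
    ⟨fun x => (expMeasure (exitRate M.rates x)).prod
      ((jumpLaw M.rates x).prod (M.decisionLaw x b)), Measurable.of_discrete⟩
  have : ∀ b, IsMarkovKernel (N b) := fun b => ⟨fun x => by
    change IsProbabilityMeasure ((expMeasure (exitRate M.rates x)).prod
      ((jumpLaw M.rates x).prod (M.decisionLaw x b)))
    infer_instance⟩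
  have hst : Measurable fun h : Event => h.2.state :=
    (Measurable.of_discrete (f := Mark.state)).comp measurable_snd
  have hD : Measurable fun h : Event => M.nextDate n h.1 :=
    (M.measurable_nextDate n).comp measurable_fst
  have hF : ∀ b : Action, Measurable fun q : Event × (ℝ × State × State) =>
      if q.1.1 + q.2.1 < M.nextDate n q.1.1 then
        ((q.1.1 + q.2.1, ⟨none, q.2.2.1⟩) : Event)
      else (M.nextDate n q.1.1, ⟨some b, q.2.2.2⟩) := by
    intro b
    refine Measurable.ite ?_ ?_ ?_
    · exact measurableSet_lt (by fun_prop) (hD.comp measurable_fst)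
    · refine Measurable.prodMk (by fun_prop) ?_
      exact (Measurable.of_discrete (f := fun y : State => Mark.mk none y)).comp (by fun_prop)
    · refine Measurable.prodMk (hD.comp measurable_fst) ?_
      exact (Measurable.of_discrete (f := fun y : State => Mark.mk (some b) y)).comp
        (by fun_prop)
  have hG : ∀ b : Action, Measurable fun h : Event =>
      (N b h.2.state).map fun w =>
        if h.1 + w.1 < M.nextDate n h.1 then ((h.1 + w.1, ⟨none, w.2.1⟩) : Event)
        else (M.nextDate n h.1, ⟨some b, w.2.2⟩) := by
    intro b
    refine Measure.measurable_of_measurable_coe _ fun A hA => ?_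
    have h1 := Kernel.measurable_kernel_prodMk_left
      (κ := (N b).comap (fun h : Event => h.2.state) hst) (hF b hA)
    convert h1 using 1
    funext h
    exact Measure.map_apply ((hF b).comp (measurable_prodMk_left (x := h))) hA
  have hset : MeasurableSet {h : Event | M.nextDate n h.1 = M.horizon} :=
    measurableSet_eq_fun hD measurable_const
  have h2 := @Measurable.ite _ _ _ _ _ _ _ (fun _ => Classical.propDecidable _) hset
    (hG Action.m) (hG a)
  convert h2 using 1
  funext h
  by_cases h0 : M.nextDate n h.1 = M.horizon
  · simp only [h0, if_true, eventLaw]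
    rfl
  · simp only [h0, if_false, eventLaw]
    rfl

/-- A control of the agent: at each decision date, a decision that depends on the past events (the
events of the market up to the date, with their times, and the past decisions). -/
structure Policy where
  act : ∀ n : ℕ, (Π _ : Finset.Iic n, Event) → Action
  measurable_act : ∀ n, Measurable (act n)

noncomputable def eventKernel (μ : Policy) (n : ℕ) :
    Kernel (Π _ : Finset.Iic n, Event) Event where
  toFun h := M.eventLaw n (h ⟨n, by simp⟩) (μ.act n h)
  measurable' := (M.measurable_eventLaw n).comp
    ((measurable_pi_apply (⟨n, by simp⟩ : Finset.Iic n)).prodMk (μ.measurable_act n))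

instance (μ : Policy) (n : ℕ) : IsMarkovKernel (M.eventKernel μ n) := by
  classical
  refine ⟨fun h => ?_⟩
  change IsProbabilityMeasure (M.eventLaw n _ _)
  refine Measure.isProbabilityMeasure_map (Measurable.aemeasurable ?_)
  refine Measurable.ite ?_ ?_ ?_
  · exact measurableSet_lt (by fun_prop) measurable_const
  · refine Measurable.prodMk (by fun_prop) ?_
    exact (Measurable.of_discrete (f := fun y : State => Mark.mk none y)).comp (by fun_prop)
  · refine Measurable.prodMk measurable_const ?_
    exact (Measurable.of_discrete (f := fun y : State => Mark.mk (some _) y)).comp (by fun_prop)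

/-- The law of the controlled process `U^μ` with `U^μ_t = u` (before the decision at `t`, if `t` is
a decision date), given as the sequence of its events. -/
noncomputable def controlledLaw (μ : Policy) (t : ℝ) (u : State) : Measure (ℕ → Event) :=
  Kernel.traj (X := fun _ => Event) (M.eventKernel μ) 0 fun _ => (t, ⟨none, u⟩)

/-- The number of the event that completes the execution. -/
noncomputable def execIndex (ω : ℕ → Event) : ℕ := sInf {n | (ω n).2.state.inventory = 0}

/-- The execution time `inf {s ≥ t, I_s = 0} ∧ T`. -/
noncomputable def execTime (ω : ℕ → Event) : ℝ := min (ω (execIndex ω)).1 M.horizon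

open Classical in
/-- `f(𝔼[ΔP_∞ | ℱ_{T_exec}]) - c q^a (T_exec - t)`.  If the execution is completed by the agent's
own market order, the information at the execution is the state in which this order is sent. -/
noncomputable def payoff (t : ℝ) (ω : ℕ → Event) : ℝ :=
  (if (ω (execIndex ω)).2.act = some Action.m then
      M.reward (∫ y, M.priceImpact y ∂(M.marketLaw (ω (execIndex ω - 1)).2.state))
    else M.reward (M.priceImpact (ω (execIndex ω)).2.state)) -
  M.waitCost * M.orderSize * (M.execTime ω - t)

/-- The value function `V(t, u)`. -/
noncomputable def value (t : ℝ) (u : State) : ℝ :=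
  ⨆ μ : Policy, ∫ ω, M.payoff t ω ∂(M.controlledLaw μ t u)

/-! ### The standing assumptions -/

/-- The assumptions on the model. -/
structure Assumptions : Prop where
  /-- The regeneration laws are carried by non-empty books. -/
  regen_positive : ∀ i u, u.Positive → ∀ b ∈ (M.regen i u).support, b.Positive
  /-- The quantity placed before the agent's order is at most the regenerated bid quantity. -/
  placement_le : ∀ i (x : State), x.Valid → ∀ b ∈ (M.regen i x.book).support,
    ∀ k ∈ (M.placement i x b).support, k ≤ b.bidQty
  /-- Bid-ask symmetry. -/
  sym_insert : ∀ u : Book, u.Positive → ∀ n,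
    M.insertRate .bid u n = M.insertRate .ask u.sym n
  sym_consume : ∀ u : Book, u.Positive → ∀ n,
    M.consumeRate .bid u n = M.consumeRate .ask u.sym n
  sym_regen : ∀ u : Book, u.Positive → ∀ b, M.regen .bid u b = M.regen .ask u.sym b.sym
  /-- Bound on the incoming flow. -/
  flow_bound : ∃ H : ℝ≥0, ∀ u : Book, u.Positive →
    ∑' n, ((M.insertRate .bid u n + M.consumeRate .bid u n : ℝ≥0) : ℝ≥0∞) ≤ H
  /-- Insertion bound. -/
  insertion_bound : ∃ Qmax : ℕ, ∀ u : Book, u.Positive → ∀ n,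
    (Qmax < u.bidQty + n → M.insertRate .bid u n = 0) ∧
    (Qmax < u.bidQty → M.consumeRate .bid u n = 0)
  /-- Regeneration bound: regenerated prices are on the tick grid, regenerated prices and
  quantities are bounded. -/
  regeneration_bound : ∃ tick : ℝ, 0 < tick ∧ ∃ Pmax : ℝ, ∃ Qmax : ℕ,
    ∀ i, ∀ u : Book, u.Positive → ∀ b ∈ (M.regen i u).support,
      (∃ z : ℤ, b.price = z * tick) ∧ |b.price| ≤ Pmax ∧ b.bidQty ≤ Qmax ∧ b.askQty ≤ Qmax
  reward_lipschitz : ∃ K : ℝ≥0, LipschitzWith K M.reward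
  waitCost_nonneg : 0 ≤ M.waitCost
  period_pos : 0 < M.period
  horizon_nonneg : 0 ≤ M.horizon

end Model

end OptimalExecution

/-! The argument is dynamic programming with verification, made elementary by finiteness. Insertions
never push a side of the book above a fixed bound, regenerated books range over a finite set, and a
payment of the agent takes finitely many values and uses up at least one unit of inventory. Hence
the market and the agent together reach only finitely many states from a given valid state
(`Assumptions.exists_controlClosed`). On such a set the generator is a matrix and backward equations
are linear differential equations.

Long term price. Uniformisation writes the generator as `Λ (P - 1)` with a contraction `P`. For
every contraction of a finite-dimensional space `exp (-a) exp (a P)` converges as `a → ∞`, without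
any irreducibility: it fixes the kernel of `P - 1` and tends to `0` on the range, at speed `1 / √a`
(`exists_tendsto_exp_smul`). That the mean price solves the backward equation follows from a
one-jump identity and a stopping argument on the chain of (time, state) pairs
(`FiniteClosed.integral_stateAt`).

Value function. A candidate is built backward from the horizon: it solves the backward equation with
source `-cost` between two dates, and at a date it is the maximum over the three decisions
(`ControlClosed.exists_valueFamily`). Conditionally on the past, whatever the decision, one event
changes the mean of the candidate, net of waiting costs, by exactly `-exp (-λ d) (B - v)`, where `λ`
is the exit rate, `d` the time to the next date, `B` the value at that date and `v` the value of the
decision (`ValueFamily.integral_step`). This is never positive, and it vanishes for a maximising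
decision.

The comparison principle `StoppedChain.integral_hitReward_le` turns such one-step inequalities into
inequalities for the mean payoff. Applied to the candidate it bounds every control from above;
applied to its opposite, along the maximising control, it gives equality. It requires that execution
occurs after finitely many events, which `ControlClosed.ae_executed` obtains from geometric decay.
Once the value is identified (`ValueFamily.value_eq`), the assertions are read off from the
construction of the candidate. -/

namespace OptimalExecution

/-! ## Stopped chains with history-dependent transitions -/

section Chain

variable {E : Type} [MeasurableSpace E]

/-- The law of the chain with transition kernels `κ` started from `e₀`. -/
noncomputable def chainLaw (κ : (n : ℕ) → Kernel (Π _ : Finset.Iic n, E) E)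
    [∀ n, IsMarkovKernel (κ n)] (e₀ : E) : Measure (ℕ → E) :=
  Kernel.traj (X := fun _ => E) κ 0 fun _ => e₀

variable (κ : (n : ℕ) → Kernel (Π _ : Finset.Iic n, E) E) [∀ n, IsMarkovKernel (κ n)] (e₀ : E)

instance : IsProbabilityMeasure (chainLaw κ e₀) := by
  unfold chainLaw
  infer_instance

/-- The first `n + 1` elements of a sequence. -/
def prefixOf (n : ℕ) (ω : ℕ → E) : Π _ : Finset.Iic n, E := fun i => ω i

theorem measurable_prefixOf (n : ℕ) : Measurable (prefixOf (E := E) n) :=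
  measurable_pi_lambda _ fun i => measurable_pi_apply (i : ℕ)

/-- One transition conditionally on the past: this is the only property of the chain used below, for
integrals and for almost sure statements. The whole past is kept, since a control may depend on all
of it. -/
theorem map_prefixOf_succ_chainLaw (n : ℕ) :
    (chainLaw κ e₀).map (fun ω => (prefixOf n ω, ω (n + 1))) =
      ((chainLaw κ e₀).map (prefixOf n)) ⊗ₘ κ n := by
  have h := Kernel.partialTraj_compProd_eq_map_traj (X := fun _ => E) (κ := κ) (Nat.zero_le n)
    (x₀ := fun _ => e₀)
  rw [← Kernel.traj_map_frestrictLe, Kernel.map_apply _ (by fun_prop)] at h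
  exact h.symm

theorem ae_zero_chainLaw [MeasurableSingletonClass E] : ∀ᵐ ω ∂chainLaw κ e₀, ω 0 = e₀ := by
  have h : (chainLaw κ e₀).map (prefixOf 0) = Measure.dirac fun _ => e₀ := by
    have h1 := Kernel.traj_map_frestrictLe_apply (X := fun _ => E) (κ := κ) 0 0 (fun _ => e₀)
    rw [Kernel.partialTraj_self, Kernel.id_apply] at h1
    exact h1
  have h2 : ∀ᵐ x ∂(chainLaw κ e₀).map (prefixOf 0), x ⟨0, by simp⟩ = e₀ := by
    rw [h, ae_dirac_iff]
    exact measurableSet_preimage (f := fun x : (Π _ : Finset.Iic 0, E) => x ⟨0, by simp⟩)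
      (measurable_pi_apply _) (measurableSet_singleton e₀)
  exact ae_of_ae_map (measurable_prefixOf 0).aemeasurable h2

theorem integral_prefixOf_succ (n : ℕ) {φ : (Π _ : Finset.Iic n, E) × E → ℝ} (hφ : Measurable φ)
    (hi : Integrable (fun ω => φ (prefixOf n ω, ω (n + 1))) (chainLaw κ e₀)) :
    ∫ ω, φ (prefixOf n ω, ω (n + 1)) ∂chainLaw κ e₀ =
      ∫ ω, ∫ e, φ (prefixOf n ω, e) ∂κ n (prefixOf n ω) ∂chainLaw κ e₀ := by
  have hm : Measurable fun ω : ℕ → E => (prefixOf n ω, ω (n + 1)) :=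
    (measurable_prefixOf n).prodMk (measurable_pi_apply _)
  have hi' : Integrable φ (((chainLaw κ e₀).map (prefixOf n)) ⊗ₘ κ n) := by
    rw [← map_prefixOf_succ_chainLaw]
    exact (integrable_map_measure hφ.aestronglyMeasurable hm.aemeasurable).2 hi
  have h1 : ∫ ω, φ (prefixOf n ω, ω (n + 1)) ∂chainLaw κ e₀ =
      ∫ q, φ q ∂(((chainLaw κ e₀).map (prefixOf n)) ⊗ₘ κ n) := by
    rw [← map_prefixOf_succ_chainLaw, integral_map hm.aemeasurable hφ.aestronglyMeasurable]
  rw [h1, Measure.integral_compProd hi', integral_map (measurable_prefixOf n).aemeasurable]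
  exact hi'.integral_compProd.aestronglyMeasurable

theorem ae_prefixOf_succ (n : ℕ) {A : Set ((Π _ : Finset.Iic n, E) × E)} (hA : MeasurableSet A)
    (h : ∀ᵐ ω ∂chainLaw κ e₀, ∀ᵐ e ∂κ n (prefixOf n ω), (prefixOf n ω, e) ∈ A) :
    ∀ᵐ ω ∂chainLaw κ e₀, (prefixOf n ω, ω (n + 1)) ∈ A := by
  have hm : Measurable fun ω : ℕ → E => (prefixOf n ω, ω (n + 1)) :=
    (measurable_prefixOf n).prodMk (measurable_pi_apply _)
  refine ae_of_ae_map (p := fun q => q ∈ A) hm.aemeasurable ?_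
  rw [map_prefixOf_succ_chainLaw]
  refine Measure.ae_compProd_of_ae_ae hA ?_
  refine (ae_map_iff (measurable_prefixOf n).aemeasurable ?_).2 h
  simp only [ae_iff]
  exact Kernel.measurable_kernel_prodMk_left hA.compl (measurableSet_singleton 0)

/-- The first index at which the sequence enters `p`. -/
noncomputable def hitIndex (p : Set E) (ω : ℕ → E) : ℕ := sInf {k | ω k ∈ p}

theorem measurable_hitIndex {p : Set E} (hp : MeasurableSet p) : Measurable (hitIndex p) := by
  refine measurable_to_countable' fun n => ?_
  -- A sequence that never enters `p` has index `sInf ∅ = 0`, whence the second alternative.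
  have h : hitIndex p ⁻¹' {n} = {ω | (ω n ∈ p ∧ ∀ k < n, ω k ∉ p) ∨ (n = 0 ∧ ∀ k, ω k ∉ p)} := by
    ext ω
    simp only [Set.mem_preimage, Set.mem_singleton_iff, Set.mem_ofPred_eq, hitIndex]
    constructor
    · rintro rfl
      by_cases hne : {k | ω k ∈ p}.Nonempty
      · exact Or.inl ⟨Nat.sInf_mem hne, fun k hk => Nat.notMem_of_lt_sInf hk⟩
      · rw [Set.not_nonempty_iff_eq_empty] at hne
        refine Or.inr ⟨by rw [hne]; simp, fun k hk => ?_⟩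
        have : k ∈ {k | ω k ∈ p} := hk
        rw [hne] at this
        exact this
    · rintro (⟨h1, h2⟩ | ⟨rfl, h⟩)
      · refine le_antisymm (Nat.sInf_le h1) (le_csInf ⟨n, h1⟩ fun k hk => ?_)
        by_contra hlt
        exact h2 k (not_le.1 hlt) hk
      · have : {k | ω k ∈ p} = ∅ := Set.eq_empty_of_forall_notMem h
        rw [this]
        simp
  rw [h]
  have hk : ∀ k, MeasurableSet {ω : ℕ → E | ω k ∉ p} := fun k =>
    measurableSet_preimage (f := fun ω : ℕ → E => ω k) (measurable_pi_apply k) hp.compl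
  refine MeasurableSet.union ?_ ?_
  · refine (measurableSet_preimage (f := fun ω : ℕ → E => ω n) (measurable_pi_apply n) hp).inter ?_
    have : {ω : ℕ → E | ∀ k < n, ω k ∉ p} = ⋂ k, ⋂ (_ : k < n), {ω | ω k ∉ p} := by
      ext; simp
    exact (congrArg MeasurableSet this).mpr
      (MeasurableSet.iInter fun k => MeasurableSet.iInter fun _ => hk k)
  · refine (MeasurableSet.const _).inter ?_
    have : {ω : ℕ → E | ∀ k, ω k ∉ p} = ⋂ k, {ω | ω k ∉ p} := by
      ext; simp
    exact (congrArg MeasurableSet this).mpr (MeasurableSet.iInter fun k => hk k)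

theorem hitIndex_eq {F : Type} {p : Set F} {ω : ℕ → F} {n : ℕ} (h1 : ω n ∈ p)
    (h2 : ∀ k < n, ω k ∉ p) :
    hitIndex p ω = n := by
  refine le_antisymm (Nat.sInf_le h1) (le_csInf ⟨n, h1⟩ fun k hk => ?_)
  by_contra hlt
  exact h2 k (not_le.1 hlt) hk

/-- The reward `G (x, y)` collected when the chain enters `p` by a transition from `x` to `y`. -/
noncomputable def hitReward (p : Set E) (G : E × E → ℝ) (ω : ℕ → E) : ℝ :=
  G (ω (hitIndex p ω - 1), ω (hitIndex p ω))

theorem measurable_hitReward {p : Set E} (hp : MeasurableSet p) {G : E × E → ℝ}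
    (hG : Measurable G) : Measurable (hitReward p G) := by
  have h : Measurable fun q : ℕ × (ℕ → E) => G (q.2 (q.1 - 1), q.2 q.1) := by
    refine measurable_from_prod_countable_right fun n => hG.comp ?_
    exact (measurable_pi_apply (X := fun _ : ℕ => E) (n - 1)).prodMk
      (measurable_pi_apply (X := fun _ : ℕ => E) n)
  exact h.comp ((measurable_hitIndex hp).prodMk measurable_id)

open Classical in
/-- The reward if the chain has entered `p` by the time `n`, and the value `w n` of the present
state otherwise. -/
noncomputable def stoppedValue (p : Set E) (G : E × E → ℝ) (w : ℕ → E → ℝ) (n : ℕ)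
    (ω : ℕ → E) : ℝ :=
  if ∃ k ≤ n, ω k ∈ p then hitReward p G ω else w n (ω n)

open Classical in
/-- The value after a transition from `x` to `y` at the time `n`. -/
noncomputable def stepValue (p : Set E) (G : E × E → ℝ) (w : ℕ → E → ℝ) (n : ℕ) (x y : E) : ℝ :=
  if y ∈ p then G (x, y) else w (n + 1) y

-- Nothing changes after the entry into `p`; before it, the increment involves only the present
-- state and the next one, so its conditional mean is controlled by a one-step hypothesis.
open Classical in
theorem stoppedValue_succ {E : Type} (p : Set E) (G : E × E → ℝ) (w : ℕ → E → ℝ) (n : ℕ)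
    (ω : ℕ → E) :
    stoppedValue p G w (n + 1) ω = stoppedValue p G w n ω +
      if ∃ k ≤ n, ω k ∈ p then 0 else stepValue p G w n (ω n) (ω (n + 1)) - w n (ω n) := by
  unfold stoppedValue stepValue
  by_cases h : ∃ k ≤ n, ω k ∈ p
  · have h' : ∃ k ≤ n + 1, ω k ∈ p := by
      obtain ⟨k, hk, hp⟩ := h
      exact ⟨k, by omega, hp⟩
    simp only [h, h', if_true, add_zero]
  · by_cases h2 : ω (n + 1) ∈ p
    · have h' : ∃ k ≤ n + 1, ω k ∈ p := ⟨n + 1, le_rfl, h2⟩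
      have h3 : hitIndex p ω = n + 1 := by
        refine hitIndex_eq h2 fun k hk hp => h ⟨k, by omega, hp⟩
      simp only [h, h', h2, if_true, if_false, hitReward, h3, Nat.add_sub_cancel]
      ring
    · have h' : ¬ ∃ k ≤ n + 1, ω k ∈ p := by
        rintro ⟨k, hk, hp⟩
        rcases Nat.lt_or_ge n k with h4 | h4
        · exact h2 ((show k = n + 1 by omega) ▸ hp)
        · exact h ⟨k, h4, hp⟩
      simp only [h, h', h2, if_false]
      ring

theorem measurableSet_exists_mem {p : Set E} (hp : MeasurableSet p) (n : ℕ) :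
    MeasurableSet {h : Π _ : Finset.Iic n, E | ∃ i, h i ∈ p} := by
  have : {h : Π _ : Finset.Iic n, E | ∃ i, h i ∈ p} = ⋃ i, {h | h i ∈ p} := by
    ext; simp
  rw [this]
  exact MeasurableSet.iUnion fun i =>
    measurableSet_preimage (measurable_pi_apply (X := fun _ => E) i) hp

theorem exists_prefixOf_mem {E : Type} {p : Set E} {n : ℕ} {ω : ℕ → E} :
    (∃ i, prefixOf n ω i ∈ p) ↔ ∃ k ≤ n, ω k ∈ p := by
  constructor
  · rintro ⟨i, hi⟩
    exact ⟨i, Finset.mem_Iic.1 i.2, hi⟩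
  · rintro ⟨k, hk, hp⟩
    exact ⟨⟨k, Finset.mem_Iic.2 hk⟩, hp⟩

theorem measurable_stepValue {p : Set E} (hp : MeasurableSet p) {G : E × E → ℝ}
    (hG : Measurable G) {w : ℕ → E → ℝ} (hw : ∀ n, Measurable (w n)) (n : ℕ) :
    Measurable fun q : E × E => stepValue p G w n q.1 q.2 :=
  Measurable.ite (measurable_snd hp) hG ((hw _).comp measurable_snd)

/-- The last element of a prefix. -/
def lastOf (n : ℕ) (h : Π _ : Finset.Iic n, E) : E := h ⟨n, by simp⟩

/-- The assumptions of the comparison principle for stopped chains. -/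
structure StoppedChain (p : Set E) (S : ℕ → Set E) : Prop where
  measurable_stopping : MeasurableSet p
  measurable_good : ∀ n, MeasurableSet (S n)
  start_mem : e₀ ∈ S 0
  start_notMem : e₀ ∉ p
  step_mem : ∀ n (h : Π _ : Finset.Iic n, E), lastOf n h ∈ S n → lastOf n h ∉ p →
    ∀ᵐ e ∂κ n h, e ∈ S (n + 1)

variable {κ e₀}

/-- Induction on `n`. As `step_mem` says nothing after the entry into `p`, the property carried over
one transition is the disjunction `A`: already stopped, or still good. -/
theorem StoppedChain.ae_good [MeasurableSingletonClass E] {p : Set E} {S : ℕ → Set E}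
    (H : StoppedChain κ e₀ p S) :
    ∀ᵐ ω ∂chainLaw κ e₀, ω 0 = e₀ ∧ ∀ n, (∀ k < n, ω k ∉ p) → ω n ∈ S n := by
  refine (ae_zero_chainLaw κ e₀).and (ae_all_iff.2 fun n => ?_)
  induction n with
  | zero =>
    filter_upwards [ae_zero_chainLaw κ e₀] with ω hω _
    rw [hω]
    exact H.start_mem
  | succ n ih =>
    let A : Set ((Π _ : Finset.Iic n, E) × E) :=
      {q | (∃ i, q.1 i ∈ p) ∨ q.2 ∈ S (n + 1)}
    have hA : MeasurableSet A :=
      (measurable_fst (measurableSet_exists_mem H.measurable_stopping n)).union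
        (measurable_snd (H.measurable_good (n + 1)))
    have h1 : ∀ᵐ ω ∂chainLaw κ e₀, (prefixOf n ω, ω (n + 1)) ∈ A := by
      refine ae_prefixOf_succ κ e₀ n hA ?_
      filter_upwards [ih] with ω hω
      by_cases h : ∃ k ≤ n, ω k ∈ p
      · exact Eventually.of_forall fun e => Or.inl (exists_prefixOf_mem.2 h)
      · push Not at h
        have h2 := H.step_mem n (prefixOf n ω) (hω fun k hk => h k hk.le) (h n le_rfl)
        filter_upwards [h2] with e he
        exact Or.inr he
    filter_upwards [h1] with ω hω hk
    refine hω.resolve_left fun h => ?_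
    obtain ⟨k, hk', hp⟩ := exists_prefixOf_mem.1 h
    exact hk k (by omega) hp

/-- Along a chain for which one step does not increase the value, the mean of the stopped value is
at most the initial value. -/
theorem StoppedChain.integral_stoppedValue_le [MeasurableSingletonClass E] {p : Set E}
    {S : ℕ → Set E} (H : StoppedChain κ e₀ p S) {G : E × E → ℝ} (hG : Measurable G)
    {w : ℕ → E → ℝ} (hw : ∀ n, Measurable (w n)) {C : ℕ → ℝ}
    (hwC : ∀ n, ∀ e ∈ S n, |w n e| ≤ C n)
    (hGC : ∀ n, ∀ x ∈ S n, ∀ y ∈ S (n + 1), x ∉ p → y ∈ p → |G (x, y)| ≤ C (n + 1))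
    (hstep : ∀ n (h : Π _ : Finset.Iic n, E), lastOf n h ∈ S n → lastOf n h ∉ p →
      ∫ e, stepValue p G w n (lastOf n h) e ∂κ n h ≤ w n (lastOf n h)) (n : ℕ) :
    Integrable (stoppedValue p G w n) (chainLaw κ e₀) ∧
      ∫ ω, stoppedValue p G w n ω ∂chainLaw κ e₀ ≤ w 0 e₀ := by
  classical
  induction n with
  | zero =>
    have h0 : stoppedValue p G w 0 =ᵐ[chainLaw κ e₀] fun _ => w 0 e₀ := by
      filter_upwards [ae_zero_chainLaw κ e₀] with ω hω
      have : ¬ ∃ k ≤ 0, ω k ∈ p := by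
        rintro ⟨k, hk, hp⟩
        rw [Nat.le_zero.1 hk, hω] at hp
        exact H.start_notMem hp
      rw [stoppedValue, if_neg this, hω]
    refine ⟨(integrable_congr h0).2 (integrable_const _), ?_⟩
    rw [integral_congr_ae h0]
    simp
  | succ n ih =>
    let φ : (Π _ : Finset.Iic n, E) × E → ℝ := fun q =>
      if ∃ i, q.1 i ∈ p then 0 else stepValue p G w n (lastOf n q.1) q.2 - w n (lastOf n q.1)
    have hlast : Measurable (lastOf (E := E) n) := measurable_pi_apply _
    have hφ : Measurable φ := by
      refine Measurable.ite (measurable_fst (measurableSet_exists_mem H.measurable_stopping n))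
        measurable_const (Measurable.sub ?_ ((hw n).comp (hlast.comp measurable_fst)))
      exact (measurable_stepValue H.measurable_stopping hG hw n).comp
        ((hlast.comp measurable_fst).prodMk measurable_snd)
    have hZ : ∀ ω, stoppedValue p G w (n + 1) ω =
        stoppedValue p G w n ω + φ (prefixOf n ω, ω (n + 1)) := by
      intro ω
      rw [stoppedValue_succ]
      simp only [φ, exists_prefixOf_mem]
      rfl
    have hb : ∀ᵐ ω ∂chainLaw κ e₀, ‖φ (prefixOf n ω, ω (n + 1))‖ ≤ |C (n + 1)| + |C n| := by
      filter_upwards [H.ae_good] with ω hω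
      simp only [φ, exists_prefixOf_mem]
      by_cases h : ∃ k ≤ n, ω k ∈ p
      · rw [if_pos h, norm_zero]
        positivity
      · rw [if_neg h]
        push Not at h
        have hn : ω n ∈ S n := hω.2 n fun k hk => h k hk.le
        have hn1 : ω (n + 1) ∈ S (n + 1) := hω.2 (n + 1) fun k hk => h k (by omega)
        refine (norm_sub_le _ _).trans (add_le_add ?_ ((hwC n _ hn).trans (le_abs_self _)))
        rw [stepValue]
        split_ifs with h2
        · exact (hGC n _ hn _ hn1 (h n le_rfl) h2).trans (le_abs_self _)
        · exact (hwC _ _ hn1).trans (le_abs_self _)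
    have hm : Measurable fun ω : ℕ → E => (prefixOf n ω, ω (n + 1)) :=
      (measurable_prefixOf n).prodMk (measurable_pi_apply _)
    have hi : Integrable (fun ω => φ (prefixOf n ω, ω (n + 1))) (chainLaw κ e₀) :=
      Integrable.of_bound (hφ.comp hm).aestronglyMeasurable _ hb
    have hfun : stoppedValue p G w (n + 1) =
        fun ω => stoppedValue p G w n ω + φ (prefixOf n ω, ω (n + 1)) := funext hZ
    rw [hfun]
    refine ⟨ih.1.add hi, ?_⟩
    rw [integral_add ih.1 hi, integral_prefixOf_succ κ e₀ n hφ hi]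
    -- The supermartingale property: given the past, the increment has nonpositive mean by `hstep`.
    have hneg : ∫ ω, ∫ e, φ (prefixOf n ω, e) ∂κ n (prefixOf n ω) ∂chainLaw κ e₀ ≤ 0 := by
      refine integral_nonpos_of_ae ?_
      filter_upwards [H.ae_good] with ω hω
      simp only [φ, exists_prefixOf_mem]
      by_cases h : ∃ k ≤ n, ω k ∈ p
      · simp [h]
      · simp only [h, if_false]
        push Not at h
        have hn : ω n ∈ S n := hω.2 n fun k hk => h k hk.le
        have h1 : Integrable (fun e => stepValue p G w n (lastOf n (prefixOf n ω)) e)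
            (κ n (prefixOf n ω)) := by
          refine Integrable.of_bound (C := |C (n + 1)|) ?_ ?_
          · exact ((measurable_stepValue H.measurable_stopping hG hw n).comp
              measurable_prodMk_left).aestronglyMeasurable
          · filter_upwards [H.step_mem n (prefixOf n ω) hn (h n le_rfl)] with e he
            rw [stepValue]
            split_ifs with h2
            · exact (hGC n _ hn _ he (h n le_rfl) h2).trans (le_abs_self _)
            · exact (hwC _ _ he).trans (le_abs_self _)
        rw [integral_sub h1 (integrable_const _)]
        have h2 := hstep n (prefixOf n ω) hn (h n le_rfl)
        simp only [integral_const, probReal_univ, one_smul]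
        exact sub_nonpos.2 h2
    linarith [ih.2]

/-- If a nonnegative function contracts in mean along the chain before it is stopped, and is
bounded below there, the chain is stopped almost surely. -/
theorem StoppedChain.ae_exists_mem [MeasurableSingletonClass E] {p : Set E}
    {S : ℕ → Set E} (H : StoppedChain κ e₀ p S) {ψ : ℕ → E → ℝ} (hψ : ∀ n, Measurable (ψ n))
    (hψ0 : ∀ n e, 0 ≤ ψ n e) {C δ θ : ℝ} (hδ : 0 < δ) (hθ0 : 0 < θ) (hθ1 : θ < 1)
    (hψC : ∀ n, ∀ e ∈ S n, ψ n e ≤ C) (hψδ : ∀ n, ∀ e ∈ S n, e ∉ p → δ ≤ ψ n e)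
    (hstep : ∀ n (h : Π _ : Finset.Iic n, E), lastOf n h ∈ S n → lastOf n h ∉ p →
      ∫ e, stepValue p (fun _ => 0) ψ n (lastOf n h) e ∂κ n h ≤ θ * ψ n (lastOf n h)) :
    ∀ᵐ ω ∂chainLaw κ e₀, ∃ k, ω k ∈ p := by
  classical
  have hC : ∀ n, ∀ e ∈ S n, |(θ⁻¹) ^ n * ψ n e| ≤ (θ⁻¹) ^ n * C := by
    intro n e he
    have hpos : 0 ≤ (θ⁻¹) ^ n := by positivity
    rw [abs_of_nonneg (mul_nonneg hpos (hψ0 n e))]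
    exact mul_le_mul_of_nonneg_left (hψC n e he) hpos
  have hC0 : 0 ≤ C := (hψ0 0 e₀).trans (hψC 0 e₀ H.start_mem)
  -- `θ⁻¹ ^ n * ψ n` does not increase in mean before the entry into `p`, and the reward is `0`. Its
  -- bound grows with `n`, which is why the comparison at a fixed index allows bounds `C n`.
  have key := H.integral_stoppedValue_le (G := fun _ => 0) measurable_const
    (w := fun n e => (θ⁻¹) ^ n * ψ n e) (fun n => (hψ n).const_mul _)
    (C := fun n => (θ⁻¹) ^ n * C) hC
    (fun n _ _ _ _ _ _ => by rw [abs_zero]; positivity) (fun n h h1 h2 => by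
      have h3 : ∀ e, stepValue p (fun _ => 0) (fun n e => (θ⁻¹) ^ n * ψ n e) n (lastOf n h) e =
          (θ⁻¹) ^ (n + 1) * stepValue p (fun _ => 0) ψ n (lastOf n h) e := by
        intro e
        simp only [stepValue]
        split_ifs <;> simp
      simp only [h3]
      rw [integral_const_mul]
      refine (mul_le_mul_of_nonneg_left (hstep n h h1 h2) (by positivity)).trans_eq ?_
      rw [pow_succ]
      field_simp)
  have hset : ∀ n, MeasurableSet {ω : ℕ → E | ∃ k ≤ n, ω k ∈ p} := by
    intro n
    have h := (measurable_prefixOf n) (measurableSet_exists_mem H.measurable_stopping n)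
    convert h using 1
    ext ω
    exact exists_prefixOf_mem.symm
  -- Markov's inequality: while the chain is not stopped, the stopped value is at least `θ⁻¹ ^ n *
  -- δ`.
  have hmeas : ∀ n, (chainLaw κ e₀).real {ω | ∃ k ≤ n, ω k ∈ p}ᶜ ≤ θ ^ n * (ψ 0 e₀ / δ) := by
    intro n
    obtain ⟨hi, hle⟩ := key n
    have h1 : ∫ ω, ({ω | ∃ k ≤ n, ω k ∈ p}ᶜ : Set (ℕ → E)).indicator
        (fun _ => (θ⁻¹) ^ n * δ) ω ∂chainLaw κ e₀ ≤ ψ 0 e₀ := by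
      refine (integral_mono_ae ?_ hi ?_).trans (hle.trans_eq (by simp))
      · exact (integrable_const _).indicator (hset n).compl
      · filter_upwards [H.ae_good] with ω hω
        rw [stoppedValue]
        by_cases h : ∃ k ≤ n, ω k ∈ p
        · rw [if_pos h, Set.indicator_of_notMem (by simpa using h)]
          exact le_rfl
        · rw [if_neg h, Set.indicator_of_mem (by simpa using h)]
          push Not at h
          exact mul_le_mul_of_nonneg_left (hψδ n _ (hω.2 n fun k hk => h k hk.le) (h n le_rfl))
            (by positivity)
    rw [integral_indicator (hset n).compl, setIntegral_const, smul_eq_mul] at h1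
    have h2 : (chainLaw κ e₀).real {ω | ∃ k ≤ n, ω k ∈ p}ᶜ * δ ≤ θ ^ n * ψ 0 e₀ := by
      have h3 := mul_le_mul_of_nonneg_left h1 (pow_nonneg hθ0.le n)
      refine le_trans (le_of_eq ?_) h3
      rw [inv_pow]
      field_simp
    rw [← mul_div_assoc, le_div_iff₀ hδ]
    exact h2
  have hzero : (chainLaw κ e₀).real {ω | ∃ k, ω k ∈ p}ᶜ ≤ 0 := by
    have hlim : Tendsto (fun n : ℕ => θ ^ n * (ψ 0 e₀ / δ)) atTop (𝓝 (0 * (ψ 0 e₀ / δ))) :=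
      (tendsto_pow_atTop_nhds_zero_of_lt_one hθ0.le hθ1).mul_const _
    rw [zero_mul] at hlim
    refine ge_of_tendsto' hlim fun n => (measureReal_mono ?_).trans (hmeas n)
    intro ω hω
    simp only [Set.mem_compl_iff, Set.mem_ofPred_eq, not_exists, not_and] at hω ⊢
    exact fun k _ => hω k
  rw [ae_iff]
  have h0 : (chainLaw κ e₀).real {ω | ∃ k, ω k ∈ p}ᶜ = 0 := le_antisymm hzero measureReal_nonneg
  rwa [measureReal_eq_zero_iff] at h0

/-- The comparison principle: if one step does not increase the value in mean, the mean reward is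
at most the initial value. -/
theorem StoppedChain.integral_hitReward_le [MeasurableSingletonClass E] {p : Set E}
    {S : ℕ → Set E} (H : StoppedChain κ e₀ p S) (hreach : ∀ᵐ ω ∂chainLaw κ e₀, ∃ k, ω k ∈ p)
    {G : E × E → ℝ} (hG : Measurable G)
    {w : ℕ → E → ℝ} (hw : ∀ n, Measurable (w n)) {C : ℝ}
    (hwC : ∀ n, ∀ e ∈ S n, |w n e| ≤ C)
    (hGC : ∀ n, ∀ x ∈ S n, ∀ y ∈ S (n + 1), x ∉ p → y ∈ p → |G (x, y)| ≤ C)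
    (hstep : ∀ n (h : Π _ : Finset.Iic n, E), lastOf n h ∈ S n → lastOf n h ∉ p →
      ∫ e, stepValue p G w n (lastOf n h) e ∂κ n h ≤ w n (lastOf n h)) :
    Integrable (hitReward p G) (chainLaw κ e₀) ∧
      ∫ ω, hitReward p G ω ∂chainLaw κ e₀ ≤ w 0 e₀ := by
  classical
  have key := H.integral_stoppedValue_le hG hw (C := fun _ => C) hwC hGC hstep
  have hrew : ∀ᵐ ω ∂chainLaw κ e₀, ‖hitReward p G ω‖ ≤ C := by
    filter_upwards [H.ae_good, hreach] with ω hω hk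
    have h1 : ω (hitIndex p ω) ∈ p := Nat.sInf_mem (s := {k | ω k ∈ p}) hk
    have h2 : ∀ k < hitIndex p ω, ω k ∉ p := fun k hk => Nat.notMem_of_lt_sInf hk
    obtain ⟨m, hm⟩ : ∃ m, hitIndex p ω = m + 1 := by
      refine Nat.exists_eq_succ_of_ne_zero fun h0 => ?_
      rw [h0, hω.1] at h1
      exact H.start_notMem h1
    rw [hm] at h1 h2
    rw [hitReward, hm, Nat.add_sub_cancel]
    exact hGC m _ (hω.2 m fun k hk => h2 k (by omega)) _ (hω.2 (m + 1) h2)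
      (h2 m (by omega)) h1
  have hint : Integrable (hitReward p G) (chainLaw κ e₀) :=
    Integrable.of_bound (measurable_hitReward H.measurable_stopping hG).aestronglyMeasurable C hrew
  refine ⟨hint, ?_⟩
  -- On almost every path the stopped value is eventually equal to the reward, and the bound `C` is
  -- uniform in `n`.
  refine le_of_tendsto' (tendsto_integral_of_dominated_convergence (fun _ => C)
    (F := fun n => stoppedValue p G w n) ?_ (integrable_const _) ?_ ?_) fun n => (key n).2
  · exact fun n => (key n).1.aestronglyMeasurable
  · intro n
    filter_upwards [H.ae_good, hrew] with ω hω h1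
    rw [stoppedValue]
    split_ifs with h
    · exact h1
    · push Not at h
      exact hwC n _ (hω.2 n fun k hk => h k hk.le)
  · filter_upwards [hreach] with ω ⟨k, hk⟩
    refine tendsto_const_nhds.congr' ?_
    filter_upwards [eventually_ge_atTop k] with n hn
    rw [stoppedValue, if_pos ⟨k, hn, hk⟩]

end Chain

/-! ## Linear differential equations and the semigroup of a finite jump process -/

section LinearODE

variable {V : Type*} [NormedAddCommGroup V] [NormedSpace ℝ V] [CompleteSpace V]

/-- The equation becomes linear on `V × ℝ` with a last coordinate that remains equal to `1`; there
the solution is an operator exponential. -/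
theorem exists_hasDerivAt_affine (A : V →L[ℝ] V) (b v : V) :
    ∃ Y : ℝ → V, Y 0 = v ∧ ∀ s, HasDerivAt Y (A (Y s) + b) s := by
  let B : (V × ℝ) →L[ℝ] (V × ℝ) :=
    (A.comp (ContinuousLinearMap.fst ℝ V ℝ) +
      (ContinuousLinearMap.snd ℝ V ℝ).smulRight b).prod 0
  let Z : ℝ → V × ℝ := fun s => NormedSpace.exp (s • B) (v, 1)
  have hZ : ∀ s, HasDerivAt Z (B (Z s)) s := by
    intro s
    have h := (hasDerivAt_exp_smul_const' B s).clm_apply (hasDerivAt_const s ((v, 1) : V × ℝ))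
    simpa using h
  have h0 : Z 0 = (v, 1) := by simp [Z]
  have h2 : ∀ s, (Z s).2 = 1 := by
    have hd : ∀ s, HasDerivAt (fun s => (Z s).2) 0 s := fun s => (hZ s).snd
    intro s
    have := is_const_of_deriv_eq_zero (fun s => (hd s).differentiableAt)
      (fun s => (hd s).deriv) s 0
    rw [this, h0]
  refine ⟨fun s => (Z s).1, congrArg Prod.fst h0, fun s => ?_⟩
  have h : HasDerivAt (fun s => (Z s).1) (B (Z s)).1 s := (hZ s).fst
  have h3 : (B (Z s)).1 = A (Z s).1 + b := by
    simp [B, h2 s]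
  exact h3 ▸ h

end LinearODE

/-! ### Poisson moments and the decay estimate for power-bounded elements -/

section Poisson

theorem hasSum_pow_div_factorial (a : ℝ) :
    HasSum (fun n : ℕ => a ^ n / n.factorial) (Real.exp a) := by
  rw [Real.exp_eq_exp_ℝ]
  exact NormedSpace.expSeries_div_hasSum_exp a

theorem hasSum_mul_pow_div_factorial (a : ℝ) :
    HasSum (fun n : ℕ => n * (a ^ n / n.factorial)) (a * Real.exp a) := by
  have h := (hasSum_nat_add_iff (f := fun n : ℕ => n * (a ^ n / n.factorial)) 1
    (g := a * Real.exp a)).1 ?_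
  · simpa using h
  · convert! (hasSum_pow_div_factorial a).mul_left a using 2 with n
    rw [Nat.factorial_succ]
    push_cast
    field_simp
    ring

theorem hasSum_sq_mul_pow_div_factorial (a : ℝ) :
    HasSum (fun n : ℕ => (n : ℝ) ^ 2 * (a ^ n / n.factorial)) ((a ^ 2 + a) * Real.exp a) := by
  have h := (hasSum_nat_add_iff (f := fun n : ℕ => (n : ℝ) ^ 2 * (a ^ n / n.factorial)) 1
    (g := (a ^ 2 + a) * Real.exp a)).1 ?_
  · simpa using h
  · convert! ((hasSum_mul_pow_div_factorial a).add (hasSum_pow_div_factorial a)).mul_left a using 1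
    · funext n
      rw [Nat.factorial_succ]
      push_cast
      field_simp
      ring
    · ring

/-- The mean of `|N / a - 1|` for a Poisson variable `N` of parameter `a`, up to the
normalisation. -/
theorem hasSum_bound_abs_sub {a : ℝ} (ha : 0 < a) :
    HasSum (fun n : ℕ => a ^ n / n.factorial *
      ((√a)⁻¹ / 2 + √a / 2 * ((n : ℝ) / a - 1) ^ 2)) (Real.exp a / √a) := by
  have h := (((hasSum_sq_mul_pow_div_factorial a).mul_left (√a / 2 / a ^ 2)).add
    ((hasSum_mul_pow_div_factorial a).mul_left (-(√a / a)))).add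
    ((hasSum_pow_div_factorial a).mul_left ((√a)⁻¹ / 2 + √a / 2))
  have hs : √a ≠ 0 := (Real.sqrt_pos.2 ha).ne'
  have hsq : √a ^ 2 = a := Real.sq_sqrt ha.le
  convert! h using 1
  · funext n
    field_simp
    ring
  · have : a = √a * √a := by rw [← sq, hsq]
    field_simp
    rw [hsq]
    ring

variable {𝔸 : Type*} [NormedRing 𝔸] [NormedAlgebra ℝ 𝔸] [CompleteSpace 𝔸]

/-- The product is the series of `(n / a - 1) (a ^ n / n!) P ^ n`, so up to the factor `exp a` its
norm is at most the mean deviation of `N / a` from `1` for a Poisson variable `N` of parameter `a`,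
which is at most `1 / √a`. -/
theorem norm_exp_smul_mul_sub_one_le {P : 𝔸} (hP : ∀ n, ‖P ^ n‖ ≤ 1) {a : ℝ} (ha : 0 < a) :
    ‖NormedSpace.exp (a • P) * (P - 1)‖ ≤ Real.exp a / √a := by
  have h1 : HasSum (fun n : ℕ => (a ^ n / n.factorial) • P ^ n) (NormedSpace.exp (a • P)) := by
    convert! NormedSpace.exp_series_hasSum_exp' (𝕂 := ℝ) (a • P) using 2 with n
    rw [smul_pow, smul_smul]
    congr 1
    ring
  -- The series of the exponential multiplied by `P`, with the index shifted by one; the added term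
  -- `n = 0` vanishes.
  have h2 : HasSum (fun n : ℕ => ((n : ℝ) / a * (a ^ n / n.factorial)) • P ^ n)
      (NormedSpace.exp (a • P) * P) := by
    have h := (hasSum_nat_add_iff
      (f := fun n : ℕ => ((n : ℝ) / a * (a ^ n / n.factorial)) • P ^ n) 1
      (g := NormedSpace.exp (a • P) * P)).1 ?_
    · simpa using h
    · convert! h1.mul_right P using 2 with n
      rw [smul_mul_assoc, ← pow_succ, Nat.factorial_succ]
      congr 1
      push_cast
      field_simp
      ring
  have h3 : HasSum (fun n : ℕ => (((n : ℝ) / a - 1) * (a ^ n / n.factorial)) • P ^ n)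
      (NormedSpace.exp (a • P) * (P - 1)) := by
    rw [mul_sub, mul_one]
    convert! h2.sub h1 using 2 with n
    rw [← sub_smul]
    congr 1
    ring
  refine h3.norm_le_of_bounded (hasSum_bound_abs_sub ha) fun n => ?_
  have hq : 0 ≤ a ^ n / n.factorial := by positivity
  have hs : 0 < √a := Real.sqrt_pos.2 ha
  -- Arithmetic-geometric mean inequality, with the weight suited to a standard deviation `1 / √a`.
  have hx : ∀ x : ℝ, |x| ≤ (√a)⁻¹ / 2 + √a / 2 * x ^ 2 := by
    intro x
    have h4 : 0 ≤ √a / 2 * (|x| - (√a)⁻¹) ^ 2 := by positivity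
    have h5 : √a / 2 * (|x| - (√a)⁻¹) ^ 2 = (√a)⁻¹ / 2 + √a / 2 * x ^ 2 - |x| := by
      rw [sub_sq, sq_abs]
      field_simp
      ring
    linarith
  calc ‖(((n : ℝ) / a - 1) * (a ^ n / n.factorial)) • P ^ n‖
      ≤ |((n : ℝ) / a - 1) * (a ^ n / n.factorial)| * 1 := by
        rw [norm_smul, Real.norm_eq_abs]
        exact mul_le_mul_of_nonneg_left (hP n) (abs_nonneg _)
    _ = a ^ n / n.factorial * |(n : ℝ) / a - 1| := by
        rw [mul_one, abs_mul, abs_of_nonneg hq, mul_comm]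
    _ ≤ _ := mul_le_mul_of_nonneg_left (hx _) hq

end Poisson

/-! ### Convergence of the semigroup of a contraction -/

section Contraction

variable {V : Type*} [NormedAddCommGroup V] [NormedSpace ℝ V] [FiniteDimensional ℝ V]

/-- The continuous-time semigroup of a contraction of a finite-dimensional space converges. -/
theorem exists_tendsto_exp_smul {P : V →L[ℝ] V} (hP : ‖P‖ ≤ 1) (v : V) :
    ∃ l, Tendsto (fun a : ℝ => Real.exp (-a) • NormedSpace.exp (a • P) v) atTop (𝓝 l) := by
  have : CompleteSpace V := FiniteDimensional.complete ℝ V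
  have hPn : ∀ n, ‖P ^ n‖ ≤ 1 := by
    intro n
    induction n with
    | zero => exact ContinuousLinearMap.norm_id_le
    | succ n ih =>
      rw [pow_succ]
      exact (norm_mul_le _ _).trans (mul_le_one₀ ih (norm_nonneg _) hP)
  have hker : ∀ w, P w = w → ∀ a : ℝ, Real.exp (-a) • NormedSpace.exp (a • P) w = w := by
    intro w hw a
    have h1 := (ContinuousLinearMap.apply ℝ V w).hasSum
      (NormedSpace.exp_series_hasSum_exp' (𝕂 := ℝ) (a • P))
    have hpow : ∀ n : ℕ, (P ^ n) w = w := by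
      intro n
      induction n with
      | zero => rfl
      | succ n ih =>
        rw [pow_succ, mul_apply_eq_comp, hw, ih]
    have h2 : HasSum (fun n : ℕ => (a ^ n / n.factorial) • w) (NormedSpace.exp (a • P) w) := by
      convert! h1 using 2 with n
      simp only [smul_pow, ContinuousLinearMap.apply_apply,
        smul_apply, hpow, smul_smul]
      congr 1
      ring
    rw [h2.unique ((hasSum_pow_div_factorial a).smul_const w), smul_smul, ← Real.exp_add]
    simp
  have hran : ∀ u, Tendsto (fun a : ℝ => Real.exp (-a) • NormedSpace.exp (a • P) ((P - 1) u))
      atTop (𝓝 0) := by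
    intro u
    have hlim : Tendsto (fun a : ℝ => (√a)⁻¹ * ‖u‖) atTop (𝓝 0) := by
      have := (tendsto_inv_atTop_zero.comp Real.tendsto_sqrt_atTop).mul_const ‖u‖
      simpa using this
    refine squeeze_zero_norm' ?_ hlim
    filter_upwards [eventually_gt_atTop 0] with a ha
    rw [norm_smul, Real.norm_eq_abs, abs_of_pos (Real.exp_pos _)]
    have h1 := (NormedSpace.exp (a • P) * (P - 1)).le_opNorm u
    rw [mul_apply_eq_comp] at h1
    have h2 := norm_exp_smul_mul_sub_one_le hPn ha
    calc Real.exp (-a) * ‖NormedSpace.exp (a • P) ((P - 1) u)‖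
        ≤ Real.exp (-a) * (Real.exp a / √a * ‖u‖) := by
          gcongr
          exact h1.trans (by gcongr)
      _ = (√a)⁻¹ * ‖u‖ := by
          rw [Real.exp_neg]
          field_simp
  -- On the intersection the semigroup is constant and also tends to `0`. By rank-nullity the kernel
  -- and the range then span the space.
  have hdisj : Disjoint (P - 1).toLinearMap.ker (P - 1).toLinearMap.range := by
    rw [Submodule.disjoint_def]
    rintro w hw ⟨u, rfl⟩
    have hw' : P ((P - 1) u) = (P - 1) u := by
      have : (P - 1) ((P - 1) u) = 0 := hw
      rw [sub_apply, sub_eq_zero] at this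
      exact this
    have h1 := hran u
    simp only [hker _ hw'] at h1
    exact tendsto_nhds_unique tendsto_const_nhds h1
  have htop : (P - 1).toLinearMap.ker ⊔ (P - 1).toLinearMap.range = ⊤ := by
    refine Submodule.eq_top_of_disjoint _ _ ?_ hdisj
    rw [add_comm]
    exact (LinearMap.finrank_range_add_finrank_ker (P - 1).toLinearMap).ge
  obtain ⟨w, hw, r, ⟨u, rfl⟩, hv⟩ := Submodule.mem_sup.1 (htop ▸ Submodule.mem_top (x := v))
  have hw' : P w = w := by
    have : (P - 1) w = 0 := hw
    rw [sub_apply, sub_eq_zero] at this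
    exact this
  refine ⟨w + 0, ?_⟩
  rw [← hv]
  simp only [map_add, smul_add, hker w hw']
  exact tendsto_const_nhds.add (hran u)

end Contraction

/-! ### Backward equations of jump processes on a finite set -/

section FiniteJump

variable {S : Type} [MeasurableSpace S]

/-- A finite set of states that the jump process does not leave. -/
structure FiniteClosed (ν : S → Measure S) (F : Set S) : Prop where
  finite : F.Finite
  rate_ne_top : ∀ x ∈ F, ν x Set.univ ≠ ∞
  ae_mem : ∀ x ∈ F, ∀ᵐ y ∂ν x, y ∈ F

theorem integrable_of_ae_mem_finite [DiscreteMeasurableSpace S] {m : Measure S}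
    [IsFiniteMeasure m] {F : Set S} (hF : F.Finite) (h : ∀ᵐ y ∂m, y ∈ F) (φ : S → ℝ) :
    Integrable φ m := by
  obtain ⟨C, hC⟩ := (hF.image fun y => ‖φ y‖).bddAbove
  refine Integrable.of_bound Measurable.of_discrete.aestronglyMeasurable C ?_
  filter_upwards [h] with y hy
  exact hC ⟨y, hy, rfl⟩

open Classical in
/-- Extension by `0` of a function on `F`. -/
noncomputable def extendZero (F : Set S) (v : F → ℝ) (x : S) : ℝ :=
  if h : x ∈ F then v ⟨x, h⟩ else 0

theorem extendZero_of_mem {S : Type} {F : Set S} (v : F → ℝ) {x : S} (h : x ∈ F) :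
    extendZero F v x = v ⟨x, h⟩ := by
  rw [extendZero, dif_pos h]

theorem extendZero_of_notMem {S : Type} {F : Set S} (v : F → ℝ) {x : S} (h : x ∉ F) :
    extendZero F v x = 0 := by
  rw [extendZero, dif_neg h]

variable {ν : S → Measure S} {F : Set S}

theorem FiniteClosed.isFiniteMeasure (H : FiniteClosed ν F) {x : S} (hx : x ∈ F) :
    IsFiniteMeasure (ν x) := ⟨(H.rate_ne_top x hx).lt_top⟩

variable [DiscreteMeasurableSpace S]

theorem FiniteClosed.integrable (H : FiniteClosed ν F) {x : S} (hx : x ∈ F) (φ : S → ℝ) :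
    Integrable φ (ν x) :=
  have := H.isFiniteMeasure hx
  integrable_of_ae_mem_finite H.finite (H.ae_mem x hx) φ

theorem FiniteClosed.generator_eq (H : FiniteClosed ν F) {x : S} (hx : x ∈ F) (φ : S → ℝ) :
    generator ν φ x = ∫ y, φ y ∂ν x - (ν x).real Set.univ * φ x := by
  have := H.isFiniteMeasure hx
  rw [generator, integral_sub (H.integrable hx φ) (integrable_const _), integral_const,
    smul_eq_mul]

/-- The generator as an operator on the functions on `F`. -/
noncomputable def FiniteClosed.op (H : FiniteClosed ν F) : (F → ℝ) →ₗ[ℝ] (F → ℝ) where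
  toFun v x := generator ν (extendZero F v) x
  map_add' v w := by
    funext x
    have h : extendZero F (v + w) = fun y => extendZero F v y + extendZero F w y := by
      funext y
      unfold extendZero
      split_ifs <;> simp
    rw [Pi.add_apply, H.generator_eq x.2, H.generator_eq x.2, H.generator_eq x.2, h,
      integral_add (H.integrable x.2 _) (H.integrable x.2 _)]
    ring
  map_smul' c v := by
    funext x
    have h : extendZero F (c • v) = fun y => c * extendZero F v y := by
      funext y
      unfold extendZero
      split_ifs <;> simp
    rw [Pi.smul_apply, H.generator_eq x.2, H.generator_eq x.2, h, integral_const_mul]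
    simp only [RingHom.id_apply, smul_eq_mul]
    ring

/-- The inhomogeneous backward equation of a jump process on a finite set. -/
theorem FiniteClosed.exists_backward (H : FiniteClosed ν F) (b φ : S → ℝ) :
    ∃ Y : ℝ → S → ℝ, (∀ x ∈ F, Y 0 x = φ x) ∧ (∀ s, ∀ x ∉ F, Y s x = 0) ∧
      ∀ s, ∀ x ∈ F, HasDerivAt (fun r => Y r x) (generator ν (Y s) x + b x) s := by
  have := H.finite.fintype
  obtain ⟨Z, hZ0, hZ⟩ := exists_hasDerivAt_affine (LinearMap.toContinuousLinearMap H.op)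
    (fun x => b x) (fun x => φ x)
  refine ⟨fun s => extendZero F (Z s), fun x hx => ?_, fun s x hx => extendZero_of_notMem _ hx,
    fun s x hx => ?_⟩
  · exact (extendZero_of_mem _ hx).trans (by rw [hZ0])
  · simp only [extendZero_of_mem _ hx]
    exact hasDerivAt_pi.1 (hZ s) ⟨x, hx⟩

/-- The homogeneous backward equation of a jump process on a finite set has a solution which
converges at infinity. -/
theorem FiniteClosed.exists_backward_tendsto (H : FiniteClosed ν F) (φ : S → ℝ) :
    ∃ Y : ℝ → S → ℝ, (∀ x ∈ F, Y 0 x = φ x) ∧ (∀ s, ∀ x ∉ F, Y s x = 0) ∧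
      (∀ s, ∀ x ∈ F, HasDerivAt (fun r => Y r x) (generator ν (Y s) x) s) ∧
      ∀ x ∈ F, ∃ l, Tendsto (fun s => Y s x) atTop (𝓝 l) := by
  have := H.finite.fintype
  obtain ⟨R, hR⟩ := (H.finite.image fun y => (ν y).real Set.univ).bddAbove
  -- Uniformisation: `Λ` dominates every exit rate on `F`, so that `P` below acts as a transition
  -- matrix and the semigroup is `exp (-Λ s) exp (Λ s P)`. The maximum with `1` keeps `Λ` positive.
  let Λ := max R 1
  have hΛ : 0 < Λ := lt_max_of_lt_right one_pos
  have hrate : ∀ x ∈ F, (ν x).real Set.univ ≤ Λ := fun x hx =>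
    (hR ⟨x, hx, rfl⟩).trans (le_max_left _ _)
  let P : (F → ℝ) →L[ℝ] (F → ℝ) := 1 + Λ⁻¹ • LinearMap.toContinuousLinearMap H.op
  have hPx : ∀ (v : F → ℝ) (x : F), P v x = v x + Λ⁻¹ * generator ν (extendZero F v) x :=
    fun v x => rfl
  have hP : ‖P‖ ≤ 1 := by
    refine ContinuousLinearMap.opNorm_le_bound _ zero_le_one fun v => ?_
    rw [one_mul, pi_norm_le_iff_of_nonneg (norm_nonneg _)]
    intro x
    have := H.isFiniteMeasure x.2
    rw [hPx, H.generator_eq x.2, extendZero_of_mem _ x.2]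
    have h1 : ‖∫ y, extendZero F v y ∂ν x‖ ≤ ‖v‖ * (ν x).real Set.univ := by
      refine norm_integral_le_of_norm_le_const (Eventually.of_forall fun y => ?_)
      unfold extendZero
      split_ifs with h
      · exact norm_le_pi_norm v _
      · simp
    have h2 : ‖v x‖ ≤ ‖v‖ := norm_le_pi_norm v x
    have h3 := hrate x x.2
    have h0 : 0 ≤ (ν x).real Set.univ := measureReal_nonneg
    rw [Real.norm_eq_abs] at h1 h2 ⊢
    -- Both weights, on `v x` and on the jumps, are nonnegative and their total is `Λ`, so the
    -- supremum norm does not grow.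
    have h4 : v x + Λ⁻¹ * (∫ y, extendZero F v y ∂ν x - (ν x).real Set.univ * v x) =
        Λ⁻¹ * ((Λ - (ν x).real Set.univ) * v x + ∫ y, extendZero F v y ∂ν x) := by
      field_simp
      ring
    rw [h4, abs_mul, abs_of_pos (inv_pos.2 hΛ), inv_mul_le_iff₀ hΛ]
    calc |(Λ - (ν x).real Set.univ) * v x + ∫ y, extendZero F v y ∂ν x|
        ≤ |(Λ - (ν x).real Set.univ) * v x| + |∫ y, extendZero F v y ∂ν x| := abs_add_le _ _
      _ ≤ (Λ - (ν x).real Set.univ) * ‖v‖ + ‖v‖ * (ν x).real Set.univ := by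
          rw [abs_mul, abs_of_nonneg (sub_nonneg.2 h3)]
          exact add_le_add (mul_le_mul_of_nonneg_left h2 (sub_nonneg.2 h3)) h1
      _ = Λ * ‖v‖ := by ring
  let Z : ℝ → F → ℝ := fun s => Real.exp (-(Λ * s)) • NormedSpace.exp ((Λ * s) • P) fun x => φ x
  have hZ : ∀ s, HasDerivAt Z (H.op (Z s)) s := by
    intro s
    have h1 : HasDerivAt (fun s : ℝ => Λ * s) Λ s := by
      simpa using (hasDerivAt_id s).const_mul Λ
    have h2 := ((hasDerivAt_exp_smul_const' P (Λ * s)).scomp s h1).clm_apply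
      (hasDerivAt_const s fun x : F => φ x)
    have h3 := h1.neg.exp
    have h4 := h3.smul h2
    refine h4.congr_deriv ?_
    have hop : ∀ v, H.op v = Λ • (P v - v) := by
      intro v
      have : P v = v + Λ⁻¹ • H.op v := rfl
      rw [this, add_sub_cancel_left, smul_smul, mul_inv_cancel₀ hΛ.ne', one_smul]
    rw [hop]
    funext x
    simp only [Z, map_smul]
    simp
    ring
  refine ⟨fun s => extendZero F (Z s), fun x hx => ?_, fun s x hx => extendZero_of_notMem _ hx,
    fun s x hx => ?_, fun x hx => ?_⟩
  · refine (extendZero_of_mem _ hx).trans ?_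
    simp [Z]
  · simp only [extendZero_of_mem _ hx]
    exact hasDerivAt_pi.1 (hZ s) ⟨x, hx⟩
  · obtain ⟨l, hl⟩ := exists_tendsto_exp_smul hP fun x : F => φ x
    refine ⟨l ⟨x, hx⟩, ?_⟩
    simp only [extendZero_of_mem _ hx]
    exact (tendsto_pi_nhds.1 hl ⟨x, hx⟩).comp (tendsto_id.const_mul_atTop hΛ)

end FiniteJump

/-! ## The exponential clock -/

section Clock

theorem measurable_exponentialPDF (l : ℝ) : Measurable (exponentialPDF l) :=
  (measurable_exponentialPDFReal l).ennreal_ofReal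

theorem integral_expMeasure {l : ℝ} (hl : 0 < l) (f : ℝ → ℝ) :
    ∫ r, f r ∂expMeasure l = ∫ r in Set.Ioi 0, l * Real.exp (-(l * r)) * f r := by
  have h1 : expMeasure l = volume.withDensity (exponentialPDF l) := rfl
  rw [h1, integral_withDensity_eq_integral_toReal_smul
    (measurable_exponentialPDF l)
    (Eventually.of_forall fun _ => ENNReal.ofReal_lt_top), ← integral_indicator measurableSet_Ioi]
  refine integral_congr_ae ?_
  have h0 : ∀ᵐ r : ℝ, r ≠ 0 := by simp [ae_iff]
  filter_upwards [h0] with r hr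
  rcases lt_or_gt_of_ne hr with h | h
  · rw [exponentialPDF_of_neg h, Set.indicator_of_notMem (by simpa using h.le)]
    simp
  · rw [exponentialPDF_of_nonneg h.le, Set.indicator_of_mem (by simpa using h),
      ENNReal.toReal_ofReal (by positivity), smul_eq_mul]

theorem ae_pos_expMeasure (l : ℝ) : ∀ᵐ r ∂expMeasure l, 0 < r := by
  have h1 : expMeasure l = volume.withDensity (exponentialPDF l) := rfl
  rw [h1, ae_withDensity_iff (measurable_exponentialPDF l)]
  have h0 : ∀ᵐ r : ℝ, r ≠ 0 := by simp [ae_iff]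
  filter_upwards [h0] with r hr h
  by_contra hle
  exact h (exponentialPDF_of_neg (lt_of_le_of_ne (not_lt.1 hle) hr))

theorem ae_ne_expMeasure (l d : ℝ) : ∀ᵐ r ∂expMeasure l, r ≠ d := by
  have h1 : expMeasure l = volume.withDensity (exponentialPDF l) := rfl
  have h0 : ∀ᵐ r : ℝ, r ≠ d := by simp [ae_iff]
  rw [h1]
  exact (withDensity_absolutelyContinuous _ _).ae_le h0

/-- The mean of a gain which is `k r` if the clock rings at `r < d` and `K` if it does not ring
before `d`, in terms of a solution `y` of `y' = l (y - k)`. -/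
theorem integral_clock {l d : ℝ} (hl : 0 < l) (hd : 0 ≤ d) {k y : ℝ → ℝ} (K : ℝ)
    (hk : Continuous k) (hy : ∀ r, HasDerivAt y (l * (y r - k r)) r) :
    ∫ r, (if r < d then k r else K) ∂expMeasure l =
      y 0 - Real.exp (-(l * d)) * (y d - K) := by
  rw [integral_expMeasure hl]
  have hexp : ∀ r, HasDerivAt (fun r => Real.exp (-(l * r))) (-(l * Real.exp (-(l * r)))) r := by
    intro r
    have h := (((hasDerivAt_id r).const_mul l).neg).exp
    refine h.congr_deriv ?_
    simp
    ring
  have hexpc : Continuous fun r => Real.exp (-(l * r)) := by fun_prop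
  have h1 : ∫ r in (0 : ℝ)..d, l * Real.exp (-(l * r)) * k r =
      y 0 - Real.exp (-(l * d)) * y d := by
    -- The equation for `y` provides an explicit primitive of the exponential density times `k`.
    have hder : ∀ r ∈ Set.uIcc 0 d, HasDerivAt (fun r => -(Real.exp (-(l * r)) * y r))
        (l * Real.exp (-(l * r)) * k r) r := by
      intro r _
      refine ((hexp r).mul (hy r)).neg.congr_deriv ?_
      ring
    rw [intervalIntegral.integral_eq_sub_of_hasDerivAt hder
      ((by fun_prop : Continuous fun r => l * Real.exp (-(l * r)) * k r).intervalIntegrable _ _)]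
    simp
    ring
  have h2 : IntegrableOn (fun r => l * Real.exp (-(l * r))) (Set.Ioi d) := by
    have := (exp_neg_integrableOn_Ioi d hl).const_mul l
    simpa only [neg_mul, IntegrableOn] using this
  have h3 : ∫ r in Set.Ioi d, l * Real.exp (-(l * r)) * K = Real.exp (-(l * d)) * K := by
    have h := integral_Ioi_of_hasDerivAt_of_tendsto
      (f := fun r => -Real.exp (-(l * r))) (f' := fun r => l * Real.exp (-(l * r))) (a := d)
      (m := 0)
      hexpc.neg.continuousWithinAt (fun r _ => by
        refine (hexp r).neg.congr_deriv ?_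
        ring) h2 (by
        have h4 : Tendsto (fun r : ℝ => l * r) atTop atTop := tendsto_id.const_mul_atTop hl
        have := (Real.tendsto_exp_neg_atTop_nhds_zero.comp h4).neg
        simpa using this)
    rw [integral_mul_const, h]
    ring
  have hset : Set.Ioi (0 : ℝ) = Set.Ioc 0 d ∪ Set.Ioi d := (Set.Ioc_union_Ioi_eq_Ioi hd).symm
  have hae1 : (fun r => l * Real.exp (-(l * r)) * (if r < d then k r else K))
      =ᵐ[volume.restrict (Set.Ioc 0 d)] fun r => l * Real.exp (-(l * r)) * k r := by
    have h0 : ∀ᵐ r : ℝ, r ≠ d := by simp [ae_iff]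
    filter_upwards [ae_restrict_of_ae h0, ae_restrict_mem measurableSet_Ioc] with r hr hm
    rw [if_pos (lt_of_le_of_ne hm.2 hr)]
  have heq2 : Set.EqOn (fun r => l * Real.exp (-(l * r)) * (if r < d then k r else K))
      (fun r => l * Real.exp (-(l * r)) * K) (Set.Ioi d) := by
    intro r hr
    have : ¬ r < d := not_lt.2 (le_of_lt (Set.mem_Ioi.1 hr))
    simp only [if_neg this]
  have hi1 : IntegrableOn (fun r => l * Real.exp (-(l * r)) * (if r < d then k r else K))
      (Set.Ioc 0 d) :=
    (integrable_congr hae1).2 (((by fun_prop : Continuous fun r =>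
      l * Real.exp (-(l * r)) * k r).integrableOn_Icc (a := 0) (b := d)).mono_set
        Set.Ioc_subset_Icc_self)
  have hi2 : IntegrableOn (fun r => l * Real.exp (-(l * r)) * (if r < d then k r else K))
      (Set.Ioi d) :=
    (integrableOn_congr_fun heq2 measurableSet_Ioi).2 (h2.mul_const K)
  rw [hset, setIntegral_union Set.Ioc_disjoint_Ioi_same measurableSet_Ioi hi1 hi2,
    integral_congr_ae hae1, setIntegral_congr_fun measurableSet_Ioi heq2, h3,
    ← intervalIntegral.integral_of_le hd, h1]
  ring

/-- The discount over one tick of a clock of parameter at most `L`, killed or discounted by the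
factor `L / (1 + L)` at the time `d`. -/
theorem integral_clock_exp_le {l L d K : ℝ} (hl : 0 < l) (hL : l ≤ L) (hd : 0 ≤ d)
    (hK : K ≤ L / (1 + L) * Real.exp (-d)) :
    ∫ r, (if r < d then Real.exp (-r) else K) ∂expMeasure l ≤ L / (1 + L) := by
  -- The solution for the gain `exp (-r)`; the constant `l / (1 + l)` is the Laplace transform of
  -- the clock at `1`.
  have hy : ∀ r, HasDerivAt (fun r => l / (1 + l) * Real.exp (-r))
      (l * (l / (1 + l) * Real.exp (-r) - Real.exp (-r))) r := by
    intro r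
    have h : HasDerivAt (fun r => Real.exp (-r)) (-Real.exp (-r)) r := by
      simpa using (hasDerivAt_neg' r).exp
    refine (h.const_mul (l / (1 + l))).congr_deriv ?_
    have : 1 + l ≠ 0 := by positivity
    field_simp
    ring
  rw [integral_clock hl hd K (by fun_prop) hy]
  have hle : l / (1 + l) ≤ L / (1 + L) := by
    rw [div_le_div_iff₀ (by positivity) (by linarith)]
    nlinarith
  have h1 : Real.exp (-(l * d)) * Real.exp (-d) ≤ 1 := by
    rw [← Real.exp_add, Real.exp_le_one_iff]
    nlinarith
  have h2 : Real.exp (-(l * d)) * (K - L / (1 + L) * Real.exp (-d)) ≤ 0 :=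
    mul_nonpos_of_nonneg_of_nonpos (Real.exp_pos _).le (by linarith)
  have h3 : (L / (1 + L) - l / (1 + l)) * (Real.exp (-(l * d)) * Real.exp (-d)) ≤
      (L / (1 + L) - l / (1 + l)) * 1 := mul_le_mul_of_nonneg_left h1 (by linarith)
  simp only [neg_zero, Real.exp_zero, mul_one] at h3 ⊢
  nlinarith

end Clock

/-! ### One jump on a finite set, driven by the exponential clock -/

section FiniteClock

variable {S : Type} [MeasurableSpace S] {ν : S → Measure S} {F : Set S}

theorem FiniteClosed.ae_jumpLaw_mem (H : FiniteClosed ν F) {x : S} (hx : x ∈ F)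
    [DiscreteMeasurableSpace S] : ∀ᵐ y ∂jumpLaw ν x, y ∈ F := by
  unfold jumpLaw
  split_ifs
  · rw [ae_dirac_iff (MeasurableSet.of_discrete)]
    exact hx
  · exact Measure.ae_smul_measure (H.ae_mem x hx) _

variable [DiscreteMeasurableSpace S]

/-- The convention for states with zero rate is harmless: the fictitious jumps from `x` to `x`
contribute `0`, as the generator does. -/
theorem FiniteClosed.generator_eq_exitRate (H : FiniteClosed ν F) {x : S} (hx : x ∈ F)
    (φ : S → ℝ) :
    generator ν φ x = exitRate ν x * (∫ y, φ y ∂jumpLaw ν x - φ x) := by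
  rw [H.generator_eq hx]
  unfold exitRate jumpLaw
  have htop := H.rate_ne_top x hx
  split_ifs with h
  · have h0 : ν x = 0 := by
      rcases h with h | h
      · exact Measure.measure_univ_eq_zero.1 h
      · exact absurd h htop
    rw [h0]
    simp
  · push Not at h
    have hpos : (ν x Set.univ).toReal ≠ 0 := (ENNReal.toReal_pos h.1 htop).ne'
    rw [integral_smul_measure, ENNReal.toReal_inv, smul_eq_mul, Measure.real]
    field_simp

theorem exitRate_le_of_finite {S : Type} [MeasurableSpace S] (ν : S → Measure S) {F : Set S}
    (hF : F.Finite) :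
    ∃ L, 0 < L ∧ ∀ x ∈ F, exitRate ν x ≤ L := by
  obtain ⟨R, hR⟩ := (hF.image fun y => exitRate ν y).bddAbove
  exact ⟨max R 1, lt_max_of_lt_right one_pos,
    fun x hx => (hR ⟨x, hx, rfl⟩).trans (le_max_left _ _)⟩

/-- The integral is a finite sum, so continuity in the parameter requires no domination. -/
theorem continuous_integral_of_finite {m : Measure S} [IsFiniteMeasure m] {F : Set S}
    (hF : F.Finite) (h : ∀ᵐ y ∂m, y ∈ F) {Y : ℝ → S → ℝ}
    (hY : ∀ y ∈ F, Continuous fun s => Y s y) : Continuous fun s => ∫ y, Y s y ∂m := by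
  have h1 : m.restrict (hF.toFinset : Set S) = m :=
    Measure.restrict_eq_self_of_ae_mem (by simpa using h)
  have h2 : (fun s => ∫ y, Y s y ∂m) = fun s => ∑ y ∈ hF.toFinset, m.real {y} • Y s y := by
    funext s
    conv_lhs => rw [← h1]
    refine setIntegral_finset _ ?_
    rw [IntegrableOn, h1]
    exact integrable_of_ae_mem_finite hF h _
  rw [h2]
  refine continuous_finsetSum _ fun y hy => ?_
  simp only [smul_eq_mul]
  exact continuous_const.mul (hY y (by simpa using hy))

/-- One step of a jump process, killed at the time `d`, for a solution of the backward equation. -/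
theorem FiniteClosed.integral_clock_backward (H : FiniteClosed ν F) {x : S} (hx : x ∈ F)
    {Y : ℝ → S → ℝ} {b : ℝ} (hc : ∀ y ∈ F, Continuous fun s => Y s y)
    (hY : ∀ s, HasDerivAt (fun r => Y r x) (generator ν (Y s) x + b) s)
    {d : ℝ} (hd : 0 ≤ d) (C K : ℝ) :
    ∫ r, (if r < d then ∫ y, Y (d - r) y ∂jumpLaw ν x + (b * r + C) else K)
        ∂expMeasure (exitRate ν x) =
      Y d x + C - Real.exp (-(exitRate ν x * d)) * (Y 0 x + (b * d + C) - K) := by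
  have hk : Continuous fun r => ∫ y, Y (d - r) y ∂jumpLaw ν x + (b * r + C) := by
    have h1 := continuous_integral_of_finite H.finite (H.ae_jumpLaw_mem hx) hc
    have h2 : Continuous fun r => ∫ y, Y (d - r) y ∂jumpLaw ν x :=
      h1.comp (continuous_const.sub continuous_id)
    fun_prop
  -- In the reversed time `d - r` the source `b` cancels the derivative of `b * r`; what remains is
  -- the equation `y' = l (y - k)` of the clock lemma.
  rw [integral_clock (y := fun r => Y (d - r) x + (b * r + C)) (exitRate_pos ν x) hd K hk]
  · simp
  · intro r
    have h1 : HasDerivAt (fun r => d - r) (-1) r := by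
      simpa using (hasDerivAt_id r).const_sub d
    have h2 := ((hY (d - r)).comp r h1).add (((hasDerivAt_id r).const_mul b).add_const C)
    refine h2.congr_deriv ?_
    rw [H.generator_eq_exitRate hx]
    ring

/-- The states carry the discrete σ-algebra and may be uncountable, so measurability in the time
alone does not give joint measurability; a finite support does. -/
theorem measurable_of_finite_support {F : Set S} (hF : F.Finite) {f : ℝ × S → ℝ}
    (h1 : ∀ x ∈ F, Measurable fun s => f (s, x)) (h2 : ∀ s, ∀ x ∉ F, f (s, x) = 0) :
    Measurable f := by
  classical
  have h : f = fun q => ∑ x ∈ hF.toFinset, if q.2 = x then f (q.1, x) else 0 := by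
    funext ⟨s, y⟩
    simp only [Finset.sum_ite_eq, Set.Finite.mem_toFinset]
    split_ifs with hy
    · rfl
    · exact h2 s y hy
  rw [h]
  refine Finset.measurable_sum _ fun x hx => ?_
  refine Measurable.ite ?_ ((h1 x (by simpa using hx)).comp measurable_fst) measurable_const
  exact measurable_snd (MeasurableSet.of_discrete (s := {x}))

theorem exists_bound_of_finite {S : Type} {F : Set S} (hF : F.Finite) {Y : ℝ → S → ℝ}
    (hY : ∀ y ∈ F, Continuous fun s => Y s y) (T : ℝ) :
    ∃ C, ∀ s ∈ Set.Icc 0 T, ∀ y ∈ F, |Y s y| ≤ C := by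
  have h : ∀ y ∈ F, ∃ C, ∀ s ∈ Set.Icc 0 T, |Y s y| ≤ C := by
    intro y hy
    obtain ⟨C, hC⟩ := isCompact_Icc.exists_bound_of_continuousOn (hY y hy).continuousOn
    exact ⟨C, hC⟩
  choose! C hC using h
  obtain ⟨R, hR⟩ := (hF.image C).bddAbove
  exact ⟨R, fun s hs y hy => (hC y hy s hs).trans (hR ⟨y, hy, rfl⟩)⟩

end FiniteClock

/-! ## Means of a jump process on a finite set -/

section JumpMean

variable {S : Type} [MeasurableSpace S] [DiscreteMeasurableSpace S] {ν : S → Measure S} {F : Set S}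

theorem integral_nextJumpLaw {S : Type} [MeasurableSpace S] (ν : S → Measure S) (h : ℝ × S)
    {φ : ℝ × S → ℝ} (hφ : Measurable φ) {C : ℝ} (hC : ∀ᵐ e ∂nextJumpLaw ν h, ‖φ e‖ ≤ C) :
    ∫ e, φ e ∂nextJumpLaw ν h =
      ∫ r, ∫ y, φ (h.1 + r, y) ∂jumpLaw ν h.2 ∂expMeasure (exitRate ν h.2) := by
  have hm : Measurable fun w : ℝ × S => (h.1 + w.1, w.2) := by fun_prop
  unfold nextJumpLaw at hC ⊢
  rw [integral_map hm.aemeasurable hφ.aestronglyMeasurable]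
  refine integral_prod _ (Integrable.of_bound (hφ.comp hm).aestronglyMeasurable C ?_)
  exact ae_of_ae_map hm.aemeasurable hC

theorem FiniteClosed.ae_nextJumpLaw (H : FiniteClosed ν F) {h : ℝ × S} (hx : h.2 ∈ F)
    (h0 : 0 ≤ h.1) : ∀ᵐ e ∂nextJumpLaw ν h, 0 ≤ e.1 ∧ e.2 ∈ F := by
  have hm : Measurable fun w : ℝ × S => (h.1 + w.1, w.2) := by fun_prop
  have hset : MeasurableSet {e : ℝ × S | 0 ≤ e.1 ∧ e.2 ∈ F} :=
    (measurableSet_le measurable_const measurable_fst).inter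
      (measurable_snd (MeasurableSet.of_discrete (s := F)))
  refine (ae_map_iff hm.aemeasurable hset).2 ?_
  refine (Measure.ae_prod_iff_ae_ae (hm hset)).2 ?_
  filter_upwards [ae_pos_expMeasure (exitRate ν h.2)] with r hr
  filter_upwards [H.ae_jumpLaw_mem hx] with y hy
  exact ⟨add_nonneg h0 hr.le, hy⟩

/-- The mean of a function of a jump process on a finite set solves the backward equation. -/
theorem FiniteClosed.integral_stateAt (H : FiniteClosed ν F) {φ : S → ℝ} {Y : ℝ → S → ℝ}
    (hY0 : ∀ x ∈ F, Y 0 x = φ x) (hYF : ∀ s, ∀ x ∉ F, Y s x = 0)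
    (hY : ∀ s, ∀ x ∈ F, HasDerivAt (fun r => Y r x) (generator ν (Y s) x) s)
    {x : S} (hx : x ∈ F) {s : ℝ} (hs : 0 ≤ s) :
    Integrable (fun ω => φ (stateAt ω s)) (jumpProcessLaw ν x) ∧
      ∫ ω, φ (stateAt ω s) ∂jumpProcessLaw ν x = Y s x := by
  classical
  have hYc : ∀ x ∈ F, Continuous fun s => Y s x := fun x hx =>
    continuous_iff_continuousAt.2 fun s => (hY s x hx).continuousAt
  -- The chain is stopped at the first jump after `s`. The state at the time `s` is the one before
  -- that jump, so the reward reads the first element of the transition.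
  let p : Set (ℝ × S) := {e | s < e.1}
  let G : ℕ → Set (ℝ × S) := fun _ => {e | 0 ≤ e.1 ∧ e.2 ∈ F}
  have hp : MeasurableSet p := measurableSet_lt measurable_const measurable_fst
  have hstate : Measurable fun e : ℝ × S => e.2 := measurable_snd
  have hlaw : jumpProcessLaw ν x = chainLaw (jumpKernel ν) (0, x) := rfl
  have HC : StoppedChain (jumpKernel ν) ((0 : ℝ), x) p G :=
    { measurable_stopping := hp
      measurable_good := fun _ => (measurableSet_le measurable_const measurable_fst).inter
        (measurable_snd (MeasurableSet.of_discrete (s := F)))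
      start_mem := ⟨le_rfl, hx⟩
      start_notMem := not_lt.2 hs
      step_mem := fun n h hh _ => H.ae_nextJumpLaw hh.2 hh.1 }
  obtain ⟨L, hL0, hL⟩ := exitRate_le_of_finite ν H.finite
  have hreach : ∀ᵐ ω ∂chainLaw (jumpKernel ν) ((0 : ℝ), x), ∃ k, ω k ∈ p := by
    -- No explosion: each jump multiplies the mean of `exp (-time)` by at most `L / (1 + L)`, while
    -- this function is at least `exp (-s)` up to the time `s`. The truncation bounds it by `1` at
    -- negative times as well.
    refine HC.ae_exists_mem (ψ := fun _ e => Real.exp (-max e.1 0)) (C := 1) (δ := Real.exp (-s))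
      (θ := L / (1 + L)) (fun _ => by fun_prop) (fun _ _ => (Real.exp_pos _).le) (Real.exp_pos _)
      (by positivity) (by rw [div_lt_one (by positivity)]; linarith) ?_ ?_ ?_
    · intro n e he
      simp
    · intro n e he hep
      have h1 : e.1 ≤ s := not_lt.1 hep
      have h2 : 0 ≤ e.1 := he.1
      rw [max_eq_left h2, Real.exp_le_exp]
      linarith
    · intro n h hh hhp
      set e := lastOf n h
      have h1 : e.1 ≤ s := not_lt.1 hhp
      have h2 : 0 ≤ e.1 := hh.1
      have hmeas : Measurable fun e' : ℝ × S =>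
          stepValue p (fun _ => 0) (fun _ e => Real.exp (-max e.1 0)) n e e' :=
        Measurable.ite hp measurable_const (by fun_prop)
      change ∫ e', stepValue p (fun _ => 0) (fun _ e => Real.exp (-max e.1 0)) n e e'
        ∂nextJumpLaw ν e ≤ _
      rw [integral_nextJumpLaw ν e hmeas (C := 1)]
      · have h3 := integral_clock_exp_le (K := 0) (exitRate_pos ν e.2) (hL e.2 hh.2)
          (sub_nonneg.2 h1) (by positivity)
        have h4 : ∫ r, ∫ y, stepValue p (fun _ => 0) (fun _ e => Real.exp (-max e.1 0)) n e
              (e.1 + r, y) ∂jumpLaw ν e.2 ∂expMeasure (exitRate ν e.2) =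
            ∫ r, Real.exp (-e.1) * (if r < s - e.1 then Real.exp (-r) else 0)
              ∂expMeasure (exitRate ν e.2) := by
          refine integral_congr_ae ?_
          filter_upwards [ae_pos_expMeasure (exitRate ν e.2),
            ae_ne_expMeasure (exitRate ν e.2) (s - e.1)] with r hr hne
          simp only [stepValue, p, Set.mem_ofPred_eq, integral_const, probReal_univ, one_smul]
          by_cases hlt : r < s - e.1
          · rw [if_neg (by linarith), if_pos hlt, max_eq_left (by linarith), ← Real.exp_add]
            congr 1
            ring
          · rw [if_pos (by
              rcases lt_or_gt_of_ne hne with h | h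
              · exact absurd h hlt
              · linarith), if_neg hlt, mul_zero]
        rw [h4, integral_const_mul, max_eq_left h2, mul_comm]
        exact mul_le_mul_of_nonneg_right h3 (Real.exp_pos _).le
      · refine Eventually.of_forall fun e' => ?_
        simp only [stepValue]
        split_ifs
        · simp
        · simp
  have hG : Measurable fun q : (ℝ × S) × (ℝ × S) => φ q.1.2 :=
    (Measurable.of_discrete (f := φ)).comp (measurable_snd.comp measurable_fst)
  -- The truncation at `0` keeps the first argument in `[0, s]` for the good pairs beyond `s`, where
  -- a bound is required although the value is never collected.
  let w : ℕ → ℝ × S → ℝ := fun _ e => Y (max (s - e.1) 0) e.2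
  have hw : ∀ n, Measurable (w n) := fun n => by
    refine measurable_of_finite_support H.finite (fun y hy => ?_) fun t y hy => hYF _ _ hy
    exact ((hYc y hy).comp (by fun_prop : Continuous fun t : ℝ => max (s - t) 0)).measurable
  obtain ⟨C₁, hC₁⟩ := exists_bound_of_finite H.finite hYc s
  obtain ⟨C₂, hC₂⟩ := (H.finite.image fun y => |φ y|).bddAbove
  let C := max C₁ C₂
  have hwC : ∀ n, ∀ e ∈ G n, |w n e| ≤ C := fun n e he =>
    (hC₁ _ ⟨le_max_right _ _, max_le (by linarith [he.1]) hs⟩ _ he.2).trans (le_max_left _ _)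
  have hGC : ∀ n, ∀ e ∈ G n, ∀ e' ∈ G (n + 1), e ∉ p → e' ∈ p → |φ e.2| ≤ C :=
    fun n e he _ _ _ _ => (hC₂ ⟨_, he.2, rfl⟩).trans (le_max_right _ _)
  have hstep : ∀ n (h : Π _ : Finset.Iic n, ℝ × S), lastOf n h ∈ G n → lastOf n h ∉ p →
      ∫ e, stepValue p (fun q => φ q.1.2) w n (lastOf n h) e ∂jumpKernel ν n h =
        w n (lastOf n h) := by
    intro n h hh hhp
    set e := lastOf n h
    have h1 : e.1 ≤ s := not_lt.1 hhp
    have h2 : 0 ≤ e.1 := hh.1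
    have hmeas : Measurable fun e' : ℝ × S => stepValue p (fun q => φ q.1.2) w n e e' :=
      (measurable_stepValue hp hG hw n).comp measurable_prodMk_left
    change ∫ e', stepValue p (fun q => φ q.1.2) w n e e' ∂nextJumpLaw ν e = _
    rw [integral_nextJumpLaw ν e hmeas (C := C)]
    · have h3 := H.integral_clock_backward hh.2 (b := 0) hYc (fun s => by
        simpa using hY s e.2 hh.2) (sub_nonneg.2 h1) 0 (φ e.2)
      simp only [zero_mul, add_zero, hY0 _ hh.2, sub_self, mul_zero, sub_zero] at h3
      change _ = Y (max (s - e.1) 0) e.2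
      rw [max_eq_left (sub_nonneg.2 h1), ← h3]
      refine integral_congr_ae ?_
      filter_upwards [ae_pos_expMeasure (exitRate ν e.2),
        ae_ne_expMeasure (exitRate ν e.2) (s - e.1)] with r hr hne
      simp only [stepValue, p, Set.mem_ofPred_eq, w]
      by_cases hlt : r < s - e.1
      · simp only [if_neg (show ¬ s < e.1 + r by linarith), if_pos hlt]
        rw [max_eq_left (by linarith), sub_add_eq_sub_sub]
      · have : s < e.1 + r := by
          rcases lt_or_gt_of_ne hne with h | h
          · exact absurd h hlt
          · linarith
        simp only [if_pos this, if_neg hlt, integral_const, probReal_univ, one_smul]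
    · filter_upwards [H.ae_nextJumpLaw hh.2 hh.1] with e' he'
      simp only [stepValue]
      split_ifs with h'
      · exact hGC n e hh e' he' hhp h'
      · exact hwC (n + 1) e' he'
  -- The one-step relation is an equality, so the comparison applies to the value and to its
  -- opposite.
  have hle := HC.integral_hitReward_le hreach hG hw hwC hGC fun n h h1 h2 => (hstep n h h1 h2).le
  have hneg := HC.integral_hitReward_le hreach hG.neg (w := fun n e => -w n e) (fun n => (hw n).neg)
    (fun n e he => by rw [abs_neg]; exact hwC n e he)
    (fun n e he e' he' h1 h2 => by
      rw [Pi.neg_apply, abs_neg]; exact hGC n e he e' he' h1 h2) fun n h h1 h2 => by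
      rw [← hstep n h h1 h2, ← integral_neg]
      refine le_of_eq (integral_congr_ae (Eventually.of_forall fun e => ?_))
      simp only [stepValue]
      split_ifs <;> rfl
  have hrew : ∀ᵐ ω ∂chainLaw (jumpKernel ν) ((0 : ℝ), x),
      hitReward p (fun q => φ q.1.2) ω = φ (stateAt ω s) := by
    filter_upwards [hreach, ae_zero_chainLaw (jumpKernel ν) ((0 : ℝ), x)] with ω hk h0
    have h1 : ω (hitIndex p ω) ∈ p := Nat.sInf_mem (s := {k | ω k ∈ p}) hk
    have h2 : ∀ k < hitIndex p ω, ω k ∉ p := fun k hk => Nat.notMem_of_lt_sInf hk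
    obtain ⟨m, hm⟩ : ∃ m, hitIndex p ω = m + 1 := by
      refine Nat.exists_eq_succ_of_ne_zero fun h3 => ?_
      rw [h3, h0] at h1
      exact HC.start_notMem h1
    rw [hm] at h1 h2
    -- The index in `stateAt` is that of the event before the jump past `s`, one less than the
    -- hitting index.
    have h3 : sInf {n | s < (ω (n + 1)).1} = m := by
      refine le_antisymm (Nat.sInf_le h1) (le_csInf ⟨m, h1⟩ fun k hk => ?_)
      by_contra hlt
      exact h2 (k + 1) (by omega) hk
    rw [hitReward, hm, Nat.add_sub_cancel, stateAt, h3]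
  rw [hlaw]
  refine ⟨(integrable_congr hrew).1 hle.1, ?_⟩
  rw [← integral_congr_ae hrew]
  have hz : w 0 (0, x) = Y s x := by
    simp [w, max_eq_left hs]
  refine le_antisymm (hz ▸ hle.2) ?_
  have h5 := hneg.2
  have h6 : ∀ ω, hitReward p (-fun q => φ q.1.2) ω = -hitReward p (fun q => φ q.1.2) ω :=
    fun ω => rfl
  simp only [h6, integral_neg, hz] at h5
  linarith

end JumpMean

/-! ## The order book without the agent -/

section Atomic

variable {S : Type} [MeasurableSpace S]

theorem ae_sum_smul {r : ℕ → ℝ≥0} {m : ℕ → Measure S} {q : S → Prop}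
    (h : ∀ n, r n ≠ 0 → ∀ᵐ y ∂m n, q y) : ∀ᵐ y ∂Measure.sum fun n => r n • m n, q y := by
  rw [Measure.ae_sum_iff]
  intro n
  by_cases h0 : r n = 0
  · simp [h0]
  · exact Measure.ae_smul_measure (h n h0) _

theorem sum_smul_univ_ne_top {r : ℕ → ℝ≥0} {m : ℕ → Measure S} [∀ n, IsProbabilityMeasure (m n)]
    (h : ∑' n, (r n : ℝ≥0∞) ≠ ∞) : (Measure.sum fun n => r n • m n) Set.univ ≠ ∞ := by
  have h1 : ∀ n, (r n • m n) Set.univ = r n := fun n => by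
    rw [Measure.smul_apply, measure_univ, ENNReal.smul_def, smul_eq_mul, mul_one]
  rw [Measure.sum_apply _ MeasurableSet.univ]
  simpa only [h1] using h

theorem ae_toMeasure_of_support [DiscreteMeasurableSpace S] (d : PMF S) {q : S → Prop}
    (h : ∀ y ∈ d.support, q y) : ∀ᵐ y ∂d.toMeasure, q y := by
  rw [ae_iff, PMF.toMeasure_apply_eq_zero_iff _ MeasurableSet.of_discrete]
  exact Set.disjoint_left.2 fun y hy hq => hq (h y hy)

theorem ae_dirac_of [DiscreteMeasurableSpace S] {x : S} {q : S → Prop} (h : q x) :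
    ∀ᵐ y ∂Measure.dirac x, q y :=
  (ae_dirac_iff MeasurableSet.of_discrete).2 h

end Atomic

theorem Book.sym_sym (b : Book) : b.sym.sym = b := by
  simp [Book.sym]

theorem Book.Positive.sym {b : Book} (h : b.Positive) : b.sym.Positive := ⟨h.2, h.1⟩

/-- The quantity on one side of the book. -/
def Book.qty : Side → Book → ℕ
  | .bid, b => b.bidQty
  | .ask, b => b.askQty

namespace Model

variable {M : Model}

/-- Uniform bounds on the flows and on the regenerated books. -/
structure Bounds (M : Model) (N : ℕ) (Pr : Set ℝ) : Prop where
  finite_prices : Pr.Finite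
  insert_le : ∀ i (u : Book), u.Positive → ∀ n, M.insertRate i u n ≠ 0 → u.qty i + n ≤ N
  insert_sum : ∀ i (u : Book), u.Positive → ∑' n, (M.insertRate i u n : ℝ≥0∞) ≠ ∞
  consume_sum : ∀ i (u : Book), u.Positive → ∑' n, (M.consumeRate i u n : ℝ≥0∞) ≠ ∞
  regen : ∀ i (u : Book), u.Positive → ∀ b ∈ (M.regen i u).support,
    b.Positive ∧ b.bidQty ≤ N ∧ b.askQty ≤ N ∧ b.price ∈ Pr

theorem finite_grid {tick : ℝ} (ht : 0 < tick) (P : ℝ) :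
    {x : ℝ | (∃ z : ℤ, x = z * tick) ∧ |x| ≤ P}.Finite := by
  refine ((Set.finite_Icc (-⌈P / tick⌉) ⌈P / tick⌉).image fun z : ℤ => (z : ℝ) * tick).subset ?_
  rintro x ⟨⟨z, rfl⟩, hx⟩
  refine ⟨z, ?_, rfl⟩
  rw [abs_mul, abs_of_pos ht, ← le_div_iff₀ ht, abs_le] at hx
  have h1 : P / tick ≤ ⌈P / tick⌉ := Int.le_ceil _
  constructor
  · have : -(⌈P / tick⌉ : ℝ) ≤ z := by linarith
    exact_mod_cast this
  · have : (z : ℝ) ≤ ⌈P / tick⌉ := by linarith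
    exact_mod_cast this

/-- The assumptions on the flows concern the bid; the symmetry carries them over to the ask. Bounded
prices on the tick grid are finite in number. -/
theorem Assumptions.exists_bounds (hM : M.Assumptions) : ∃ N Pr, M.Bounds N Pr := by
  obtain ⟨H, hH⟩ := hM.flow_bound
  obtain ⟨N₁, hN₁⟩ := hM.insertion_bound
  obtain ⟨tick, ht, P, N₂, hreg⟩ := hM.regeneration_bound
  have hins : ∀ u : Book, u.Positive → ∀ n, M.insertRate .ask u n = M.insertRate .bid u.sym n := by
    intro u hu n
    rw [hM.sym_insert _ hu.sym, Book.sym_sym]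
  have hcons : ∀ u : Book, u.Positive → ∀ n,
      M.consumeRate .ask u n = M.consumeRate .bid u.sym n := by
    intro u hu n
    rw [hM.sym_consume _ hu.sym, Book.sym_sym]
  have h1 : ∀ u : Book, u.Positive → ∑' n, (M.insertRate .bid u n : ℝ≥0∞) ≠ ∞ := fun u hu =>
    (((ENNReal.tsum_le_tsum fun n => by
      rw [ENNReal.coe_le_coe]; exact le_self_add).trans (hH u hu)).trans_lt
        ENNReal.coe_lt_top).ne
  have h2 : ∀ u : Book, u.Positive → ∑' n, (M.consumeRate .bid u n : ℝ≥0∞) ≠ ∞ := fun u hu =>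
    (((ENNReal.tsum_le_tsum fun n => by
      rw [ENNReal.coe_le_coe]; exact le_add_self).trans (hH u hu)).trans_lt
        ENNReal.coe_lt_top).ne
  refine ⟨max N₁ N₂, _, finite_grid ht P, ?_, ?_, ?_, ?_⟩
  · intro i u hu n hn
    refine le_trans ?_ (le_max_left _ _)
    by_contra hlt
    cases i
    · exact hn ((hN₁ u hu n).1 (not_le.1 hlt))
    · rw [hins u hu] at hn
      exact hn ((hN₁ u.sym hu.sym n).1 (not_le.1 hlt))
  · intro i u hu
    cases i
    · exact h1 u hu
    · simp only [hins u hu]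
      exact h1 _ hu.sym
  · intro i u hu
    cases i
    · exact h2 u hu
    · simp only [hcons u hu]
      exact h2 _ hu.sym
  · intro i u hu b hb
    obtain ⟨hg, hp, hq1, hq2⟩ := hreg i u hu b hb
    exact ⟨hM.regen_positive i u hu b hb, hq1.trans (le_max_right _ _),
      hq2.trans (le_max_right _ _), hg, hp⟩

instance (i : Side) (u : Book) (n : ℕ) : IsProbabilityMeasure (M.bookConsume i u n) := by
  unfold bookConsume
  cases i <;> dsimp only <;> split_ifs <;> infer_instance

/-- The books with bounded quantities and with a price in `Pr`. -/
def bookBox (N : ℕ) (Pr : Set ℝ) : Set Book :=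
  {b | b.Positive ∧ b.bidQty ≤ N ∧ b.askQty ≤ N ∧ b.price ∈ Pr}

theorem finite_bookBox (N : ℕ) {Pr : Set ℝ} (hPr : Pr.Finite) : (bookBox N Pr).Finite := by
  refine (((Set.finite_Iic N).prod ((Set.finite_Iic N).prod hPr)).image
    fun q : ℕ × ℕ × ℝ => (⟨q.1, q.2.1, q.2.2⟩ : Book)).subset ?_
  rintro b ⟨_, h1, h2, h3⟩
  exact ⟨(b.bidQty, b.askQty, b.price), ⟨h1, h2, h3⟩, rfl⟩

/-- The box may be larger than the bounds of the model, in order to contain an arbitrary initial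
book: an insertion of positive rate ends at most at `N`, consumption lowers quantities, and
regenerated books lie in the smaller box. -/
theorem Bounds.finiteClosed_bookBox {N : ℕ} {Pr : Set ℝ} (hB : M.Bounds N Pr) {N' : ℕ}
    {Pr' : Set ℝ} (hN : N ≤ N') (hPr : Pr ⊆ Pr') (hfin : Pr'.Finite) :
    FiniteClosed M.bookRates (bookBox N' Pr') where
  finite := finite_bookBox N' hfin
  rate_ne_top u hu := by
    unfold bookRates
    simp only [Measure.add_apply, ne_eq, ENNReal.add_eq_top, not_or]
    exact ⟨⟨⟨sum_smul_univ_ne_top (hB.insert_sum _ u hu.1),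
      sum_smul_univ_ne_top (hB.insert_sum _ u hu.1)⟩,
      sum_smul_univ_ne_top (hB.consume_sum _ u hu.1)⟩,
      sum_smul_univ_ne_top (hB.consume_sum _ u hu.1)⟩
  ae_mem u hu := by
    obtain ⟨hpos, h1, h2, h3⟩ := hu
    have hreg : ∀ i, ∀ᵐ y ∂(M.regen i u).toMeasure, y ∈ bookBox N' Pr' := fun i =>
      ae_toMeasure_of_support _ fun b hb => by
        obtain ⟨h4, h5, h6, h7⟩ := hB.regen i u hpos b hb
        exact ⟨h4, h5.trans hN, h6.trans hN, hPr h7⟩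
    have hins := fun i n h => (hB.insert_le i u hpos n h).trans hN
    have hp1 := hpos.1
    have hp2 := hpos.2
    unfold bookRates
    simp only [ae_add_measure_iff]
    refine ⟨⟨⟨ae_sum_smul fun n hn => ae_dirac_of ?_, ae_sum_smul fun n hn => ae_dirac_of ?_⟩,
      ae_sum_smul fun n hn => ?_⟩, ae_sum_smul fun n hn => ?_⟩
    · exact ⟨⟨Nat.lt_of_lt_of_le hp1 (Nat.le_add_right _ _), hp2⟩, hins .bid n hn, h2, h3⟩
    · exact ⟨⟨hp1, Nat.lt_of_lt_of_le hp2 (Nat.le_add_right _ _)⟩, h1, hins .ask n hn, h3⟩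
    · unfold bookConsume
      dsimp only
      split_ifs with h
      · exact ae_dirac_of ⟨⟨Nat.sub_pos_of_lt h, hp2⟩, (Nat.sub_le _ _).trans h1, h2, h3⟩
      · exact hreg _
    · unfold bookConsume
      dsimp only
      split_ifs with h
      · exact ae_dirac_of ⟨⟨hp1, Nat.sub_pos_of_lt h⟩, h1, (Nat.sub_le _ _).trans h2, h3⟩
      · exact hreg _

/-- The mean mid price is well defined and converges. -/
theorem Assumptions.tendsto_meanPrice (hM : M.Assumptions) {b : Book} (hb : b.Positive) :
    (∀ s : ℝ, 0 ≤ s → Integrable (fun ω : ℕ → ℝ × Book => (stateAt ω s).price)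
        (jumpProcessLaw M.bookRates b)) ∧
      Tendsto (M.meanPrice b) atTop (𝓝 (M.longTermPrice b)) := by
  obtain ⟨N, Pr, hB⟩ := hM.exists_bounds
  have H := hB.finiteClosed_bookBox (N' := max N (max b.bidQty b.askQty))
    (Pr' := insert b.price Pr) (le_max_left _ _) (Set.subset_insert _ _)
    (hB.finite_prices.insert _)
  have hmem : b ∈ bookBox (max N (max b.bidQty b.askQty)) (insert b.price Pr) :=
    ⟨hb, by simp, by simp, Set.mem_insert _ _⟩
  obtain ⟨Y, hY0, hYF, hY, hlim⟩ := H.exists_backward_tendsto Book.price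
  have key := fun s (hs : 0 ≤ s) => H.integral_stateAt hY0 hYF hY hmem hs
  obtain ⟨l, hl⟩ := hlim b hmem
  have hl' : Tendsto (M.meanPrice b) atTop (𝓝 l) := by
    refine hl.congr' ?_
    filter_upwards [eventually_ge_atTop 0] with s hs
    exact (key s hs).2.symm
  exact ⟨fun s hs => (key s hs).1, tendsto_nhds_limUnder ⟨l, hl'⟩⟩

end Model

/-! ## The states which the controlled process can reach -/

namespace Model

variable {M : Model}

instance (x : State) (n : ℕ) : IsProbabilityMeasure (M.cancelMove x n) := by
  unfold cancelMove
  split_ifs <;> infer_instance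

instance (x : State) (n : ℕ) : IsProbabilityMeasure (M.marketMove x n) := by
  unfold marketMove
  dsimp only
  split_ifs <;> infer_instance

instance (x : State) (n : ℕ) : IsProbabilityMeasure (M.askMove x n) := by
  unfold askMove
  split_ifs <;> infer_instance

/-- The acquisition prices which can be reached from `p₀` by at most `m` increments. -/
def reachablePrices (p₀ : ℝ) (Inc : Set ℝ) : ℕ → Set ℝ
  | 0 => {p₀}
  | m + 1 => reachablePrices p₀ Inc m ∪
      Set.image2 (fun e d => e + d) (reachablePrices p₀ Inc m) Inc

theorem finite_reachablePrices (p₀ : ℝ) {Inc : Set ℝ} (h : Inc.Finite) (m : ℕ) :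
    (reachablePrices p₀ Inc m).Finite := by
  induction m with
  | zero => exact Set.finite_singleton _
  | succ m ih => exact ih.union (ih.image2 _ h)

theorem reachablePrices_mono (p₀ : ℝ) (Inc : Set ℝ) : Monotone (reachablePrices p₀ Inc) :=
  monotone_nat_of_le_succ fun _ => Set.subset_union_left

theorem add_mem_reachablePrices {p₀ : ℝ} {Inc : Set ℝ} {m m' : ℕ} (hm : m < m') {e d : ℝ}
    (he : e ∈ reachablePrices p₀ Inc m) (hd : d ∈ Inc) : e + d ∈ reachablePrices p₀ Inc m' :=
  reachablePrices_mono p₀ Inc hm (Or.inr ⟨e, he, d, hd, rfl⟩)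

/-- The possible payments of the agent, for a limit order or a market order. -/
def payments (M : Model) (N I : ℕ) (Pr : Set ℝ) : Set ℝ :=
  Set.image2 (fun (k : ℕ) p => (k : ℝ) * (p - M.spread / 2)) (Set.Iic I) Pr ∪
    Set.image2 (fun (q : ℕ × ℕ) p =>
      (q.1 : ℝ) * (p + M.spread / 2 + M.impactCoef * max ((q.1 : ℝ) - q.2) 0))
      (Set.Iic I ×ˢ Set.Iic N) Pr

theorem finite_payments (M : Model) (N I : ℕ) {Pr : Set ℝ} (h : Pr.Finite) :
    (payments M N I Pr).Finite :=
  ((Set.finite_Iic I).image2 _ h).union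
    (((Set.finite_Iic I).prod (Set.finite_Iic N)).image2 _ h)

/-- The states with bounded quantities, with prices in `Pr`, and with an acquisition price that is
compatible with the remaining inventory. -/
structure InBox (M : Model) (N I : ℕ) (Pr : Set ℝ) (p₀ : ℝ) (x : State) : Prop where
  valid : x.Valid
  depth_le : x.bef + x.aft ≤ N
  ask_le : x.askQty ≤ N
  inventory_le : x.inventory ≤ I
  price_mem : x.price ∈ Pr
  pExec_mem : x.pExec ∈ reachablePrices p₀ (payments M N I Pr) (I - x.inventory)

theorem finite_inBox (M : Model) (N I : ℕ) {Pr : Set ℝ} (h : Pr.Finite) (p₀ : ℝ) :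
    {x | InBox M N I Pr p₀ x}.Finite := by
  have hN := Set.finite_Iic N
  have hI := Set.finite_Iic I
  have hE := finite_reachablePrices p₀ (finite_payments M N I h) I
  refine ((hN.prod (hI.prod (hN.prod (hN.prod (hI.prod (h.prod hE)))))).image
    fun q : ℕ × ℕ × ℕ × ℕ × ℕ × ℝ × ℝ =>
      (⟨q.1, q.2.1, q.2.2.1, q.2.2.2.1, q.2.2.2.2.1, q.2.2.2.2.2.1, q.2.2.2.2.2.2⟩ : State)).subset
    ?_
  intro x hx
  have h1 := hx.depth_le
  have h2 : x.own ≤ I := by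
    rcases hx.valid.2 with h | h
    · omega
    · exact h ▸ hx.inventory_le
  exact ⟨(x.bef, x.own, x.aft, x.askQty, x.inventory, x.price, x.pExec),
    ⟨show x.bef ≤ N by omega, h2, show x.aft ≤ N by omega, hx.ask_le, hx.inventory_le,
      hx.price_mem, reachablePrices_mono _ _ (Nat.sub_le _ _) hx.pExec_mem⟩, rfl⟩

variable {N I : ℕ} {Pr : Set ℝ} {p₀ : ℝ} {N₀ : ℕ} {Pr₀ : Set ℝ}

/-- Filling at least one unit lowers the inventory and so allows one more increment of the
acquisition price; filling nothing requires none. -/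
theorem InBox.fill_mem {x : State} (hx : InBox M N I Pr p₀ x) {k : ℕ} (hk : k ≤ x.inventory) :
    x.pExec + k * (x.price - M.spread / 2) ∈
      reachablePrices p₀ (payments M N I Pr) (I - (x.inventory - k)) := by
  have h := hx.inventory_le
  rcases Nat.eq_zero_or_pos k with rfl | hk0
  · simpa using hx.pExec_mem
  · exact add_mem_reachablePrices (by omega) hx.pExec_mem
      (Or.inl ⟨k, hk.trans h, x.price, hx.price_mem, rfl⟩)

theorem InBox.market_mem {x : State} (hx : InBox M N I Pr p₀ x) :
    x.pExec + x.inventory *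
      (x.price + M.spread / 2 + M.impactCoef * max ((x.inventory : ℝ) - x.askQty) 0) ∈
      reachablePrices p₀ (payments M N I Pr) (I - 0) := by
  have h := hx.inventory_le
  rcases Nat.eq_zero_or_pos x.inventory with h0 | h0
  · have := hx.pExec_mem
    rw [h0] at this ⊢
    simpa using this
  · exact add_mem_reachablePrices (by omega) hx.pExec_mem
      (Or.inr ⟨(x.inventory, x.askQty), ⟨h, hx.ask_le⟩, x.price, hx.price_mem, rfl⟩)

/-- After a regeneration the state stays in the box. -/
theorem InBox.ae_regenerate (hM : M.Assumptions) (hB : M.Bounds N₀ Pr₀) (hN : N₀ ≤ N)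
    (hPr : Pr₀ ⊆ Pr) {x : State} (hx : InBox M N I Pr p₀ x) (i : Side) {own inventory : ℕ}
    {pExec : ℝ} (ho : own = 0 ∨ own = inventory) (hi : inventory ≤ I)
    (he : pExec ∈ reachablePrices p₀ (payments M N I Pr) (I - inventory)) :
    ∀ᵐ y ∂M.regenerate i x own inventory pExec,
      InBox M N I Pr p₀ y ∧ y.inventory = inventory := by
  unfold regenerate
  refine ae_toMeasure_of_support _ fun y hy => ?_
  obtain ⟨b, hb, hy⟩ := (PMF.mem_support_bind_iff _ _ _).1 hy
  obtain ⟨k, hk, rfl⟩ := (PMF.mem_support_map_iff _ _ _).1 hy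
  obtain ⟨hpos, h1, h2, h3⟩ := hB.regen i x.book hx.valid.1 b hb
  -- Makes the truncated subtraction `b.bidQty - k` an exact splitting of the regenerated bid
  -- quantity.
  have hkb := hM.placement_le i x hx.valid b hb k hk
  refine ⟨⟨⟨⟨?_, hpos.2⟩, ho⟩, ?_, h2.trans hN, hi, hPr h3, he⟩, rfl⟩
  · have := hpos.1
    change 0 < k + own + (b.bidQty - k)
    omega
  · change k + (b.bidQty - k) ≤ N
    omega

theorem InBox.ae_cancelMove (hM : M.Assumptions) (hB : M.Bounds N₀ Pr₀) (hN : N₀ ≤ N)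
    (hPr : Pr₀ ⊆ Pr) {x : State} (hx : InBox M N I Pr p₀ x) (n : ℕ) :
    ∀ᵐ y ∂M.cancelMove x n, InBox M N I Pr p₀ y := by
  obtain ⟨⟨⟨hv1, hv2⟩, hv3⟩, h1, h2, h3, h4, h5⟩ := id hx
  change 0 < x.bef + x.own + x.aft at hv1
  unfold cancelMove
  split_ifs with h h' h''
  · refine ae_dirac_of ⟨⟨⟨?_, hv2⟩, hv3⟩, ?_, h2, h3, h4, h5⟩
    · change 0 < x.bef + x.own + (x.aft - n)
      omega
    · change x.bef + (x.aft - n) ≤ N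
      omega
  · refine ae_dirac_of ⟨⟨⟨?_, hv2⟩, hv3⟩, ?_, h2, h3, h4, h5⟩
    · change 0 < (x.bef + x.aft - n) + x.own + 0
      omega
    · change (x.bef + x.aft - n) + 0 ≤ N
      omega
  · exact (hx.ae_regenerate hM hB hN hPr .bid (Or.inl rfl) h3 h5).mono fun y hy => hy.1
  · refine ae_dirac_of ⟨⟨⟨?_, hv2⟩, hv3⟩, Nat.zero_le _, h2, h3, h4, h5⟩
    change 0 < 0 + x.own + 0
    omega

theorem InBox.ae_marketMove (hM : M.Assumptions) (hB : M.Bounds N₀ Pr₀) (hN : N₀ ≤ N)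
    (hPr : Pr₀ ⊆ Pr) {x : State} (hx : InBox M N I Pr p₀ x) (n : ℕ) :
    ∀ᵐ y ∂M.marketMove x n, InBox M N I Pr p₀ y := by
  obtain ⟨⟨⟨hv1, hv2⟩, hv3⟩, h1, h2, h3, h4, h5⟩ := id hx
  change 0 < x.bef + x.own + x.aft at hv1
  unfold marketMove
  dsimp only
  by_cases h0 : x.own = 0
  · simp only [h0, if_true, Nat.min_zero, Nat.cast_zero, zero_mul, add_zero, Nat.sub_zero]
    split_ifs with h
    · refine ae_dirac_of ⟨⟨⟨?_, hv2⟩, Or.inl rfl⟩, ?_, h2, h3, h4, h5⟩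
      · change 0 < x.bef - n + 0 + (x.aft - (n - x.bef))
        omega
      · change x.bef - n + (x.aft - (n - x.bef)) ≤ N
        omega
    · exact (hx.ae_regenerate hM hB hN hPr .bid (Or.inl rfl) h3 h5).mono fun y hy => hy.1
  · have hoi : x.own = x.inventory := hv3.resolve_left h0
    simp only [h0, if_false]
    split_ifs with h
    · refine ae_dirac_of ⟨⟨⟨?_, hv2⟩, Or.inr rfl⟩, ?_, h2, ?_, h4, ?_⟩
      · change 0 < x.bef - n + (x.own - min (n - x.bef) x.own) + (x.aft - (n - (x.bef + x.own)))
        omega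
      · change x.bef - n + (x.aft - (n - (x.bef + x.own))) ≤ N
        omega
      · change x.own - min (n - x.bef) x.own ≤ I
        omega
      · have := hx.fill_mem (k := min (n - x.bef) x.own) (by omega)
        rw [hoi] at this ⊢
        exact this
    · refine (hx.ae_regenerate hM hB hN hPr .bid (Or.inl rfl) (Nat.zero_le _) ?_).mono
        fun y hy => hy.1
      have := hx.fill_mem (k := x.inventory) le_rfl
      rw [Nat.sub_self] at this
      rw [hoi]
      exact this

theorem InBox.ae_askMove (hM : M.Assumptions) (hB : M.Bounds N₀ Pr₀) (hN : N₀ ≤ N)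
    (hPr : Pr₀ ⊆ Pr) {x : State} (hx : InBox M N I Pr p₀ x) (n : ℕ) :
    ∀ᵐ y ∂M.askMove x n, InBox M N I Pr p₀ y := by
  obtain ⟨⟨⟨hv1, hv2⟩, hv3⟩, h1, h2, h3, h4, h5⟩ := id hx
  unfold askMove
  split_ifs with h
  · exact ae_dirac_of ⟨⟨⟨hv1, Nat.sub_pos_of_lt h⟩, hv3⟩, h1, (Nat.sub_le _ _).trans h2, h3, h4,
      h5⟩
  · exact (hx.ae_regenerate hM hB hN hPr .ask hv3 h3 h5).mono fun y hy => hy.1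

/-- The bounds of the book without agent apply to `x.book`, which includes the agent's order. The
depth in the box leaves that order out, so that inserting it later does not leave the box; the order
itself is bounded by the inventory. -/
theorem Bounds.finiteClosed_inBox (hM : M.Assumptions) (hB : M.Bounds N₀ Pr₀) (hN : N₀ ≤ N)
    (hPr : Pr₀ ⊆ Pr) (hfin : Pr.Finite) :
    FiniteClosed M.rates {x | InBox M N I Pr p₀ x} where
  finite := finite_inBox M N I hfin p₀
  rate_ne_top x hx := by
    have hpos := hx.valid.1
    have hc := hB.consume_sum .bid _ hpos
    have hc1 : ∑' n, (M.cancelRate x.book n : ℝ≥0∞) ≠ ∞ :=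
      ((ENNReal.tsum_le_tsum fun n => by
        rw [ENNReal.coe_le_coe]; exact le_self_add).trans_lt hc.lt_top).ne
    have hc2 : ∑' n, (M.marketRate x.book n : ℝ≥0∞) ≠ ∞ :=
      ((ENNReal.tsum_le_tsum fun n => by
        rw [ENNReal.coe_le_coe]; exact le_add_self).trans_lt hc.lt_top).ne
    unfold rates
    simp only [Measure.add_apply, ne_eq, ENNReal.add_eq_top, not_or]
    exact ⟨⟨⟨⟨sum_smul_univ_ne_top (hB.insert_sum _ _ hpos),
      sum_smul_univ_ne_top (hB.insert_sum _ _ hpos)⟩, sum_smul_univ_ne_top hc1⟩,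
      sum_smul_univ_ne_top hc2⟩, sum_smul_univ_ne_top (hB.consume_sum .ask _ hpos)⟩
  ae_mem x hx := by
    obtain ⟨⟨⟨hv1, hv2⟩, hv3⟩, h1, h2, h3, h4, h5⟩ := id hx
    have hins := fun i n h => (hB.insert_le i x.book hx.valid.1 n h).trans hN
    change 0 < x.bef + x.own + x.aft at hv1
    unfold rates
    simp only [ae_add_measure_iff]
    refine ⟨⟨⟨⟨ae_sum_smul fun n hn => ae_dirac_of ?_, ae_sum_smul fun n hn => ae_dirac_of ?_⟩,
      ae_sum_smul fun n _ => InBox.ae_cancelMove hM hB hN hPr hx n⟩,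
      ae_sum_smul fun n _ => InBox.ae_marketMove hM hB hN hPr hx n⟩,
      ae_sum_smul fun n _ => InBox.ae_askMove hM hB hN hPr hx n⟩
    · have hle : x.bef + x.own + x.aft + n ≤ N := hins .bid n hn
      refine ⟨⟨⟨?_, hv2⟩, hv3⟩, ?_, h2, h3, h4, h5⟩
      · change 0 < x.bef + x.own + (x.aft + n)
        omega
      · change x.bef + (x.aft + n) ≤ N
        omega
    · exact ⟨⟨⟨hv1, Nat.lt_of_lt_of_le hv2 (Nat.le_add_right _ _)⟩, hv3⟩, h1, hins .ask n hn, h3,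
        h4, h5⟩

theorem InBox.limitState {x : State} (hx : InBox M N I Pr p₀ x) :
    InBox M N I Pr p₀ (limitState x) := by
  obtain ⟨⟨⟨hv1, hv2⟩, hv3⟩, h1, h2, h3, h4, h5⟩ := id hx
  change 0 < x.bef + x.own + x.aft at hv1
  unfold Model.limitState
  split_ifs with h
  · refine ⟨⟨⟨?_, hv2⟩, Or.inr rfl⟩, ?_, h2, h3, h4, h5⟩
    · change 0 < x.bef + x.aft + x.inventory + 0
      omega
    · change x.bef + x.aft + 0 ≤ N
      omega
  · exact hx

theorem limitState_inventory (x : State) : (limitState x).inventory = x.inventory := by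
  unfold limitState
  split_ifs <;> rfl

theorem InBox.ae_cancelLaw (hM : M.Assumptions) (hB : M.Bounds N₀ Pr₀) (hN : N₀ ≤ N)
    (hPr : Pr₀ ⊆ Pr) {x : State} (hx : InBox M N I Pr p₀ x) :
    ∀ᵐ y ∂M.cancelLaw x, InBox M N I Pr p₀ y ∧ y.inventory = x.inventory := by
  obtain ⟨⟨⟨hv1, hv2⟩, hv3⟩, h1, h2, h3, h4, h5⟩ := id hx
  unfold cancelLaw
  split_ifs with h h'
  · exact ae_dirac_of ⟨hx, rfl⟩
  · exact hx.ae_regenerate hM hB hN hPr .bid (Or.inl rfl) h3 h5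
  · refine ae_dirac_of ⟨⟨⟨⟨?_, hv2⟩, Or.inl rfl⟩, h1, h2, h3, h4, h5⟩, rfl⟩
    change 0 < x.bef + 0 + x.aft
    omega

theorem InBox.ae_marketLaw (hM : M.Assumptions) (hB : M.Bounds N₀ Pr₀) (hN : N₀ ≤ N)
    (hPr : Pr₀ ⊆ Pr) {x : State} (hx : InBox M N I Pr p₀ x) :
    ∀ᵐ y ∂M.marketLaw x, InBox M N I Pr p₀ y ∧ y.inventory = 0 := by
  obtain ⟨⟨⟨hv1, hv2⟩, hv3⟩, h1, h2, h3, h4, h5⟩ := id hx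
  have he := hx.market_mem
  unfold marketLaw
  dsimp only
  split_ifs with h h'
  · exact hx.ae_regenerate hM hB hN hPr .ask (Or.inl rfl) (Nat.zero_le _) he
  · exact hx.ae_regenerate hM hB hN hPr .bid (Or.inl rfl) (Nat.zero_le _) he
  · refine ae_dirac_of ⟨⟨⟨⟨?_, Nat.sub_pos_of_lt (not_le.1 h)⟩, Or.inl rfl⟩, h1,
      (Nat.sub_le _ _).trans h2, Nat.zero_le _, h4, he⟩, rfl⟩
    change 0 < x.bef + 0 + x.aft
    omega

instance (x : State) : IsProbabilityMeasure (M.cancelLaw x) := by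
  unfold cancelLaw
  split_ifs <;> infer_instance

instance (x : State) : IsProbabilityMeasure (M.marketLaw x) := by
  unfold marketLaw
  dsimp only
  split_ifs <;> infer_instance

/-- When nothing is left to buy, a market order changes nothing. -/
theorem marketLaw_of_inventory_eq_zero {x : State} (hx : x.Valid) (h0 : x.inventory = 0) :
    M.marketLaw x = Measure.dirac x := by
  obtain ⟨⟨hv1, hv2⟩, hv3⟩ := hx
  change 0 < x.bef + x.own + x.aft at hv1
  change 0 < x.askQty at hv2
  have ho : x.own = 0 := by
    rcases hv3 with h | h <;> omega
  unfold marketLaw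
  dsimp only
  rw [if_neg (by omega), if_neg (by omega)]
  congr 1
  cases x
  simp_all

/-- A finite set of states which is stable under the market events and the decisions. -/
structure ControlClosed (M : Model) (F : Set State) : Prop where
  closed : FiniteClosed M.rates F
  valid : ∀ x ∈ F, x.Valid
  limitState : ∀ x ∈ F, Model.limitState x ∈ F
  cancelLaw : ∀ x ∈ F, ∀ᵐ y ∂M.cancelLaw x, y ∈ F ∧ y.inventory = x.inventory
  marketLaw : ∀ x ∈ F, ∀ᵐ y ∂M.marketLaw x, y ∈ F ∧ y.inventory = 0

/-- The box is sized on `u`: with `I` equal to the present inventory, the present acquisition price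
is reached with no increment. -/
theorem Assumptions.exists_controlClosed (hM : M.Assumptions) {u : State} (hu : u.Valid) :
    ∃ F, M.ControlClosed F ∧ u ∈ F := by
  obtain ⟨N₀, Pr₀, hB⟩ := hM.exists_bounds
  let N := max N₀ (max (u.bef + u.aft) u.askQty)
  have hN : N₀ ≤ N := le_max_left _ _
  have hPr : Pr₀ ⊆ insert u.price Pr₀ := Set.subset_insert _ _
  refine ⟨{x | InBox M N u.inventory (insert u.price Pr₀) u.pExec x},
    ⟨hB.finiteClosed_inBox hM hN hPr (hB.finite_prices.insert _), fun x hx => hx.valid,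
      fun x hx => InBox.limitState hx, fun x hx => InBox.ae_cancelLaw hM hB hN hPr hx,
      fun x hx => InBox.ae_marketLaw hM hB hN hPr hx⟩, ?_⟩
  refine ⟨hu, ?_, ?_, le_rfl, Set.mem_insert _ _, ?_⟩
  · exact (le_max_left _ _).trans (le_max_right _ _)
  · exact (le_max_right _ _).trans (le_max_right _ _)
  · rw [Nat.sub_self]
    exact rfl

end Model

/-! ## The value between the decision dates -/

namespace Model

variable {M : Model} {F : Set State}

/-- The date number `j`: a multiple of the period, or the horizon if this comes first. -/
noncomputable def date (M : Model) (j : ℕ) : ℝ := min (j * M.period) M.horizon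

/-- The number of the next date after the event number `n` at the time `s`. -/
noncomputable def dateIndex (M : Model) (n : ℕ) (s : ℝ) : ℕ :=
  if n = 0 then ⌈s / M.period⌉₊ else ⌊s / M.period⌋₊ + 1

/-- The waiting cost per unit of time. -/
noncomputable def cost (M : Model) : ℝ := M.waitCost * M.orderSize

theorem nextDate_eq (hM : M.Assumptions) (n : ℕ) {s : ℝ} (hs : 0 ≤ s) :
    M.nextDate n s = M.date (M.dateIndex n s) := by
  have hq : 0 ≤ s / M.period := div_nonneg hs hM.period_pos.le
  unfold nextDate date dateIndex
  split_ifs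
  · rw [← natCast_ceil_eq_intCast_ceil hq]
  · push_cast
    rw [← natCast_floor_eq_intCast_floor hq]

theorem dateIndex_bounds (n : ℕ) {s : ℝ} (hq : 0 ≤ s / M.period) :
    (M.dateIndex n s : ℝ) - 1 ≤ s / M.period ∧ s / M.period ≤ M.dateIndex n s := by
  unfold dateIndex
  split_ifs
  · exact ⟨by linarith [Nat.ceil_lt_add_one hq], Nat.le_ceil _⟩
  · push_cast
    exact ⟨by linarith [Nat.floor_le hq], (Nat.lt_floor_add_one _).le⟩

theorem le_dateIndex_mul (hM : M.Assumptions) (n : ℕ) {s : ℝ} (hs : 0 ≤ s) :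
    s ≤ M.dateIndex n s * M.period :=
  (div_le_iff₀ hM.period_pos).1 (dateIndex_bounds n (div_nonneg hs hM.period_pos.le)).2

theorem le_date_dateIndex (hM : M.Assumptions) (n : ℕ) {s : ℝ} (hs : 0 ≤ s)
    (hsT : s ≤ M.horizon) : s ≤ M.date (M.dateIndex n s) :=
  le_min (le_dateIndex_mul hM n hs) hsT

theorem date_le (j : ℕ) : M.date j ≤ M.horizon := min_le_right _ _

/-- A market event strictly before the pending date leaves it pending. The change of rounding after
the event number `0` is invisible, since `s'` lies strictly between two consecutive multiples of the
period. -/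
theorem dateIndex_eq_of_lt_date (hM : M.Assumptions) (n : ℕ) {s s' : ℝ} (hs : 0 ≤ s)
    (hlt : s < s') (hs' : s' < M.date (M.dateIndex n s)) :
    M.dateIndex (n + 1) s' = M.dateIndex n s := by
  have hΔ := hM.period_pos
  have hq : 0 ≤ s / M.period := div_nonneg hs hΔ.le
  have h1 := (dateIndex_bounds n hq).1
  have h2 : s' / M.period < M.dateIndex n s :=
    (div_lt_iff₀ hΔ).2 (hs'.trans_le (min_le_left _ _))
  have h3 : s / M.period < s' / M.period := div_lt_div_of_pos_right hlt hΔ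
  obtain ⟨m, hm⟩ : ∃ m, M.dateIndex n s = m + 1 := by
    refine Nat.exists_eq_succ_of_ne_zero fun h0 => ?_
    rw [h0, Nat.cast_zero] at h2
    linarith
  rw [hm] at h1 h2 ⊢
  push_cast at h1 h2
  have h4 : ⌊s' / M.period⌋₊ = m := (Nat.floor_eq_iff (hq.trans h3.le)).2 ⟨by linarith, h2⟩
  rw [dateIndex, if_neg (Nat.succ_ne_zero n), h4]

theorem dateIndex_mul_period (hM : M.Assumptions) (n j : ℕ) :
    M.dateIndex (n + 1) (j * M.period) = j + 1 := by
  rw [dateIndex, if_neg (Nat.succ_ne_zero n), mul_div_cancel_right₀ _ hM.period_pos.ne',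
    Nat.floor_natCast]

theorem dateIndex_le (hM : M.Assumptions) (n : ℕ) {s : ℝ} (hs : s ≤ M.horizon) :
    M.dateIndex n s ≤ ⌊M.horizon / M.period⌋₊ + 1 := by
  have h : s / M.period ≤ M.horizon / M.period := div_le_div_of_nonneg_right hs hM.period_pos.le
  unfold dateIndex
  split_ifs
  · exact (Nat.ceil_le_floor_add_one _).trans (Nat.succ_le_succ (Nat.floor_le_floor h))
  · exact Nat.succ_le_succ (Nat.floor_le_floor h)

theorem measurable_dateIndex (n : ℕ) : Measurable (M.dateIndex n) := by
  unfold dateIndex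
  split_ifs
  · exact Nat.measurable_ceil.comp (measurable_id.div_const _)
  · exact (Measurable.of_discrete (f := fun k : ℕ => k + 1)).comp
      (Nat.measurable_floor.comp (measurable_id.div_const _))

/-- A decision, or the imposed market order at the horizon. -/
noncomputable def decisionValue (M : Model) (v : State → ℝ) (x : State) : Action → ℝ
  | .l => v (limitState x)
  | .c => ∫ y, v y ∂M.cancelLaw x
  | .m => M.marketGain x

/-- The values `B k` at the dates, and the values `Y k s` at the time `s` before the date `k`, from
the dynamic programming equations. -/
structure ValueFamily (M : Model) (F : Set State) (B : ℕ → State → ℝ) (Y : ℕ → ℝ → State → ℝ) :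
    Prop where
  zero : ∀ k, ∀ x ∈ F, Y k 0 x = B k x
  notMem : ∀ k s, ∀ x ∉ F, Y k s x = 0
  deriv : ∀ k s, ∀ x ∈ F, 0 < x.inventory →
    HasDerivAt (fun r => Y k r x) (generator M.rates (Y k s) x + -M.cost) s
  executed : ∀ k s, ∀ x ∈ F, x.inventory = 0 → Y k s x = M.marketGain x
  terminal : ∀ k : ℕ, M.horizon ≤ k * M.period → ∀ x ∈ F, B k x = M.marketGain x
  step : ∀ k : ℕ, k * M.period < M.horizon → ∀ x ∈ F, 0 < x.inventory →
    B k x = max (max (decisionValue M (Y (k + 1) (M.date (k + 1) - k * M.period)) x .l)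
      (decisionValue M (Y (k + 1) (M.date (k + 1) - k * M.period)) x .c)) (M.marketGain x)

theorem ValueFamily.continuous {B : ℕ → State → ℝ} {Y : ℕ → ℝ → State → ℝ}
    (H : ValueFamily M F B Y) (k : ℕ) {x : State} (hx : x ∈ F) : Continuous fun s => Y k s x := by
  rcases Nat.eq_zero_or_pos x.inventory with h | h
  · simp only [H.executed k _ x hx h]
    exact continuous_const
  · exact continuous_iff_continuousAt.2 fun s => (H.deriv k s x hx h).continuousAt

/-- Backward recursion: from the values at a date, the backward equation is solved down to the
previous date, and the best of the three decisions is taken there. -/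
theorem ControlClosed.exists_valueFamily (hM : M.Assumptions) (H : M.ControlClosed F) :
    ∃ B Y, ValueFamily M F B Y := by
  classical
  -- Jumps and waiting cost are switched off at zero inventory, which makes the solution constant in
  -- time there: the gain is fixed at the execution although the book keeps moving.
  let ν : State → Measure State := fun x => if x.inventory = 0 then 0 else M.rates x
  have hν : FiniteClosed ν F :=
    { finite := H.closed.finite
      rate_ne_top := fun x hx => by
        simp only [ν]
        split_ifs
        · simp
        · exact H.closed.rate_ne_top x hx
      ae_mem := fun x hx => by
        simp only [ν]
        split_ifs
        · simp
        · exact H.closed.ae_mem x hx }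
  choose Φ hΦ0 hΦF hΦ using fun φ : State → ℝ => hν.exists_backward
    (fun x => if x.inventory = 0 then 0 else -M.cost) φ
  have hgen : ∀ x, 0 < x.inventory → ∀ φ, generator ν φ x = generator M.rates φ x := by
    intro x hx φ
    simp only [generator, ν, if_neg hx.ne']
  have hexec : ∀ φ s, ∀ x ∈ F, x.inventory = 0 → Φ φ s x = φ x := by
    intro φ s x hx h0
    have hd : ∀ s, HasDerivAt (fun r => Φ φ r x) 0 s := fun s => by
      have h := hΦ φ s x hx
      simpa [generator, ν, h0] using h
    have := is_const_of_deriv_eq_zero (fun s => (hd s).differentiableAt)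
      (fun s => (hd s).deriv) s 0
    rw [this, hΦ0 φ x hx]
  let step : ℕ → (State → ℝ) → State → ℝ := fun k φ x =>
    if x.inventory = 0 then M.marketGain x else
      max (max (decisionValue M (Φ φ (M.date (k + 1) - k * M.period)) x .l)
        (decisionValue M (Φ φ (M.date (k + 1) - k * M.period)) x .c)) (M.marketGain x)
  -- The number of decision dates before the horizon. `R m` is the value `m` dates before the date
  -- `K`; for `k ≥ K` the truncated `K - k` is `0` and gives the terminal gain.
  let K := ⌈M.horizon / M.period⌉₊
  let R : ℕ → State → ℝ := fun m =>
    Nat.rec (motive := fun _ => State → ℝ) M.marketGain (fun m φ => step (K - 1 - m) φ) m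
  have hK : ∀ k : ℕ, k < K ↔ k * M.period < M.horizon := fun k => by
    rw [Nat.lt_ceil, lt_div_iff₀ hM.period_pos]
  have hR : ∀ k, k < K → R (K - k) = step k (R (K - (k + 1))) := by
    intro k hk
    obtain ⟨m, hm⟩ : ∃ m, K - k = m + 1 := Nat.exists_eq_succ_of_ne_zero (by omega)
    have h1 : K - (k + 1) = m := by omega
    have h2 : K - 1 - m = k := by omega
    rw [hm, h1]
    change step (K - 1 - m) (R m) = _
    rw [h2]
  have hR0 : ∀ k, ∀ x, x.inventory = 0 → R (K - k) x = M.marketGain x := by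
    intro k x h0
    by_cases hk : k < K
    · rw [hR k hk]
      simp only [step, if_pos h0]
    · rw [Nat.sub_eq_zero_of_le (not_lt.1 hk)]
      rfl
  refine ⟨fun k => R (K - k), fun k => Φ (R (K - k)), fun k x hx => hΦ0 _ x hx,
    fun k s x hx => hΦF _ s x hx, fun k s x hx h0 => ?_, fun k s x hx h0 => ?_,
    fun k hk x _ => ?_, fun k hk x _ h0 => ?_⟩
  · have h := hΦ (R (K - k)) s x hx
    rwa [hgen x h0, if_neg h0.ne'] at h
  · rw [hexec _ s x hx h0, hR0 k x h0]
  · have : ¬ k < K := fun h => not_lt.2 hk ((hK k).1 h)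
    rw [Nat.sub_eq_zero_of_le (not_lt.1 this)]
    rfl
  · rw [hR k ((hK k).2 hk)]
    simp only [step, if_neg h0.ne']

/-! ## One step of the controlled process -/

open Classical in
/-- The decision which is executed at the next date if the agent decides `a`. -/
noncomputable def nextDecision (M : Model) (n : ℕ) (s : ℝ) (a : Action) : Action :=
  if M.nextDate n s = M.horizon then .m else a

open Classical in
/-- The next event, as a function of the clock, of the market move and of the decision. -/
noncomputable def eventMap (M : Model) (n : ℕ) (s : ℝ) (a : Action) (w : ℝ × State × State) :
    Event :=
  if s + w.1 < M.nextDate n s then (s + w.1, ⟨none, w.2.1⟩)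
  else (M.nextDate n s, ⟨some (M.nextDecision n s a), w.2.2⟩)

theorem measurable_eventMap (n : ℕ) (s : ℝ) (a : Action) : Measurable (M.eventMap n s a) := by
  refine Measurable.ite (measurableSet_lt (by fun_prop) measurable_const) ?_ ?_
  · refine Measurable.prodMk (by fun_prop) ?_
    exact (Measurable.of_discrete (f := fun y : State => Mark.mk none y)).comp (by fun_prop)
  · refine Measurable.prodMk measurable_const ?_
    exact (Measurable.of_discrete (f := fun y : State => Mark.mk (some _) y)).comp (by fun_prop)

theorem eventLaw_eq (n : ℕ) (e : Event) (a : Action) :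
    M.eventLaw n e a = ((expMeasure (exitRate M.rates e.2.state)).prod
      ((jumpLaw M.rates e.2.state).prod
        (M.decisionLaw e.2.state (M.nextDecision n e.1 a)))).map (M.eventMap n e.1 a) := rfl

/-- An event law draws a clock, a market move and the outcome of a decision independently but shows
only one of the last two. Fixing the clock therefore leaves a single law in each case, here and in
the integral formula below. -/
theorem ae_eventLaw (n : ℕ) (e : Event) (a : Action) {A : Set Event} (hA : MeasurableSet A)
    (h1 : ∀ r, 0 < r → e.1 + r < M.nextDate n e.1 →
      ∀ᵐ y ∂jumpLaw M.rates e.2.state, ((e.1 + r, ⟨none, y⟩) : Event) ∈ A)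
    (h2 : ∀ᵐ z ∂M.decisionLaw e.2.state (M.nextDecision n e.1 a),
      ((M.nextDate n e.1, ⟨some (M.nextDecision n e.1 a), z⟩) : Event) ∈ A) :
    ∀ᵐ e' ∂M.eventLaw n e a, e' ∈ A := by
  have hm := M.measurable_eventMap n e.1 a
  rw [eventLaw_eq]
  refine (ae_map_iff hm.aemeasurable hA).2 ((Measure.ae_prod_iff_ae_ae (hm hA)).2 ?_)
  filter_upwards [ae_pos_expMeasure (exitRate M.rates e.2.state)] with r hr
  by_cases hlt : e.1 + r < M.nextDate n e.1
  · have h3 : ∀ q : State × State, M.eventMap n e.1 a (r, q) = (e.1 + r, ⟨none, q.1⟩) :=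
      fun q => by simp only [eventMap, if_pos hlt]
    simp only [h3]
    exact Measure.quasiMeasurePreserving_fst.ae (h1 r hr hlt)
  · have h3 : ∀ q : State × State, M.eventMap n e.1 a (r, q) =
        (M.nextDate n e.1, ⟨some (M.nextDecision n e.1 a), q.2⟩) :=
      fun q => by simp only [eventMap, if_neg hlt]
    simp only [h3]
    exact Measure.quasiMeasurePreserving_snd.ae h2

open Classical in
theorem integral_eventLaw (n : ℕ) (e : Event) (a : Action) {φ : Event → ℝ} (hφ : Measurable φ)
    {C : ℝ} (hC : ∀ᵐ e' ∂M.eventLaw n e a, ‖φ e'‖ ≤ C) :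
    ∫ e', φ e' ∂M.eventLaw n e a =
      ∫ r, (if r < M.nextDate n e.1 - e.1 then
          ∫ y, φ (e.1 + r, ⟨none, y⟩) ∂jumpLaw M.rates e.2.state
        else ∫ z, φ (M.nextDate n e.1, ⟨some (M.nextDecision n e.1 a), z⟩)
          ∂M.decisionLaw e.2.state (M.nextDecision n e.1 a))
        ∂expMeasure (exitRate M.rates e.2.state) := by
  have hm := M.measurable_eventMap n e.1 a
  rw [eventLaw_eq] at hC ⊢
  rw [integral_map hm.aemeasurable hφ.aestronglyMeasurable, integral_prod
    (fun w => φ (M.eventMap n e.1 a w))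
    (Integrable.of_bound (hφ.comp hm).aestronglyMeasurable C (ae_of_ae_map hm.aemeasurable hC))]
  congr 1
  funext r
  by_cases hlt : e.1 + r < M.nextDate n e.1
  · have h3 : ∀ q : State × State, M.eventMap n e.1 a (r, q) = (e.1 + r, ⟨none, q.1⟩) :=
      fun q => by simp only [eventMap, if_pos hlt]
    simp only [h3]
    rw [if_pos (by linarith), integral_fun_fst (fun y => φ (e.1 + r, ⟨none, y⟩)), probReal_univ,
      one_smul]
  · have h3 : ∀ q : State × State, M.eventMap n e.1 a (r, q) =
        (M.nextDate n e.1, ⟨some (M.nextDecision n e.1 a), q.2⟩) :=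
      fun q => by simp only [eventMap, if_neg hlt]
    simp only [h3]
    rw [if_neg (by linarith), integral_fun_snd (fun z =>
      φ (M.nextDate n e.1, ⟨some (M.nextDecision n e.1 a), z⟩)), probReal_univ, one_smul]

end Model

/-! ## Verification of the optimality -/

namespace Model

variable {M : Model} {F : Set State}

/-- The events after which the order is executed. -/
def executedSet : Set Event := {e | e.2.state.inventory = 0}

/-- The events at times in `[t, T]` with a state in `F`. -/
def eventBox (M : Model) (F : Set State) (t : ℝ) : Set Event :=
  {e | e.2.state ∈ F ∧ t ≤ e.1 ∧ e.1 ≤ M.horizon}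

open Classical in
/-- The gain at the execution. -/
noncomputable def executionGain (M : Model) (t : ℝ) (q : Event × Event) : ℝ :=
  (if q.2.2.act = some Action.m then M.marketGain q.1.2.state
    else M.reward (M.priceImpact q.2.2.state)) - M.cost * (min q.2.1 M.horizon - t)

theorem payoff_eq_hitReward (t : ℝ) : M.payoff t = hitReward executedSet (M.executionGain t) :=
  rfl

theorem measurable_state : Measurable fun e : Event => e.2.state :=
  (Measurable.of_discrete (f := Mark.state)).comp measurable_snd

theorem measurableSet_executedSet : MeasurableSet executedSet :=
  measurable_state (MeasurableSet.of_discrete (s := {x : State | x.inventory = 0}))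

theorem measurableSet_eventBox (M : Model) (F : Set State) (t : ℝ) :
    MeasurableSet (M.eventBox F t) :=
  (measurable_state (MeasurableSet.of_discrete (s := F))).inter
    ((measurableSet_le measurable_const measurable_fst).inter
      (measurableSet_le measurable_fst measurable_const))

theorem measurable_executionGain (t : ℝ) : Measurable (M.executionGain t) := by
  have h1 : Measurable fun q : Event × Event => q.1.2.state := measurable_state.comp measurable_fst
  have h2 : Measurable fun q : Event × Event => q.2.2.state := measurable_state.comp measurable_snd
  refine Measurable.sub (Measurable.ite ?_ ?_ ?_) (by fun_prop)
  · exact (measurable_snd.comp measurable_snd)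
      (MeasurableSet.of_discrete (s := {k : Mark | k.act = some Action.m}))
  · exact (Measurable.of_discrete (f := M.marketGain)).comp h1
  · exact (Measurable.of_discrete (f := fun x : State => M.reward (M.priceImpact x))).comp h2

theorem marketGain_of_inventory_eq_zero {x : State} (hx : x.Valid) (h0 : x.inventory = 0) :
    M.marketGain x = M.reward (M.priceImpact x) := by
  rw [marketGain, marketLaw_of_inventory_eq_zero hx h0, integral_dirac]

theorem ControlClosed.ae_decisionLaw (H : M.ControlClosed F) {x : State} (hx : x ∈ F)
    (h0 : 0 < x.inventory) (b : Action) :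
    ∀ᵐ z ∂M.decisionLaw x b, z ∈ F ∧
      (b = .m → z.inventory = 0) ∧ (b ≠ .m → z.inventory = x.inventory) := by
  unfold decisionLaw
  rw [if_neg h0.ne']
  cases b
  · exact ae_dirac_of ⟨H.limitState x hx, fun h => (Action.noConfusion h),
      fun _ => limitState_inventory x⟩
  · exact (H.cancelLaw x hx).mono fun z hz => ⟨hz.1, fun h => (Action.noConfusion h), fun _ => hz.2⟩
  · exact (H.marketLaw x hx).mono fun z hz => ⟨hz.1, fun _ => hz.2, fun h => absurd rfl h⟩

/-- The value of the states at the event number `n`, net of the waiting cost since the time `t`. -/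
noncomputable def eventValue (M : Model) (Y : ℕ → ℝ → State → ℝ) (t : ℝ) (n : ℕ) (e : Event) : ℝ :=
  Y (M.dateIndex n e.1) (M.date (M.dateIndex n e.1) - e.1) e.2.state - M.cost * (e.1 - t)

section

variable {B : ℕ → State → ℝ} {Y : ℕ → ℝ → State → ℝ}

theorem ValueFamily.measurable_eventValue (HF : M.ControlClosed F) (H : ValueFamily M F B Y)
    (t : ℝ) (n : ℕ) : Measurable (M.eventValue Y t n) := by
  have h1 : Measurable fun q : ℝ × State =>
      Y (M.dateIndex n q.1) (M.date (M.dateIndex n q.1) - q.1) q.2 := by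
    refine measurable_of_finite_support HF.closed.finite (fun x hx => ?_) fun s x hx =>
      H.notMem _ _ x hx
    have h2 : Measurable fun q : ℕ × ℝ => Y q.1 (M.date q.1 - q.2) x :=
      measurable_from_prod_countable_right fun j =>
        ((H.continuous j hx).comp (by fun_prop : Continuous fun s : ℝ => M.date j - s)).measurable
    exact h2.comp ((measurable_dateIndex n).prodMk measurable_id)
  exact (h1.comp (measurable_fst.prodMk measurable_state)).sub (by fun_prop)

/-- Up to the horizon only finitely many date numbers occur, and each gives finitely many continuous
functions on a compact interval. -/
theorem ValueFamily.exists_bound (hM : M.Assumptions) (HF : M.ControlClosed F)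
    (H : ValueFamily M F B Y) {t : ℝ} (ht : 0 ≤ t) :
    ∃ C, (∀ n, ∀ e ∈ M.eventBox F t, |M.eventValue Y t n e| ≤ C) ∧
      ∀ e ∈ M.eventBox F t, ∀ e' ∈ M.eventBox F t, |M.executionGain t (e, e')| ≤ C := by
  have hfin := HF.closed.finite
  choose C₁ hC₁ using fun j => exists_bound_of_finite hfin (fun x hx => H.continuous j hx) M.horizon
  obtain ⟨C₂, hC₂⟩ := ((Set.finite_Iic (⌊M.horizon / M.period⌋₊ + 1)).image C₁).bddAbove
  obtain ⟨C₃, hC₃⟩ := (hfin.image fun x => |M.marketGain x|).bddAbove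
  obtain ⟨C₄, hC₄⟩ := (hfin.image fun x => |M.reward (M.priceImpact x)|).bddAbove
  have hcost : ∀ s, t ≤ s → s ≤ M.horizon → |M.cost * (s - t)| ≤ |M.cost| * M.horizon := by
    intro s h1 h2
    rw [abs_mul, abs_of_nonneg (sub_nonneg.2 h1)]
    exact mul_le_mul_of_nonneg_left (by linarith) (abs_nonneg _)
  refine ⟨max C₂ (max C₃ C₄) + |M.cost| * M.horizon, fun n e he => ?_, fun e he e' he' => ?_⟩
  · have h0 : 0 ≤ e.1 := ht.trans he.2.1
    refine (abs_sub _ _).trans (add_le_add ?_ (hcost _ he.2.1 he.2.2))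
    refine ((hC₁ _ _ ⟨?_, ?_⟩ _ he.1).trans (hC₂ ⟨_, dateIndex_le hM n he.2.2, rfl⟩)).trans
      (le_max_left _ _)
    · exact sub_nonneg.2 (le_date_dateIndex hM n h0 he.2.2)
    · linarith [M.date_le (M.dateIndex n e.1)]
  · refine (abs_sub _ _).trans (add_le_add ?_ ?_)
    · refine le_trans ?_ (le_max_right _ _)
      dsimp only
      split_ifs
      · exact (hC₃ ⟨_, he.1, rfl⟩).trans (le_max_left _ _)
      · exact (hC₄ ⟨_, he'.1, rfl⟩).trans (le_max_right _ _)
    · dsimp only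
      rw [min_eq_left he'.2.2]
      exact hcost _ he'.2.1 he'.2.2

theorem ControlClosed.ae_eventLaw_mem (hM : M.Assumptions) (HF : M.ControlClosed F) {t : ℝ}
    (ht : 0 ≤ t) {e : Event} (he : e ∈ M.eventBox F t) (hp : e ∉ executedSet) (n : ℕ) (a : Action) :
    ∀ᵐ e' ∂M.eventLaw n e a, e' ∈ M.eventBox F t := by
  have h0 : 0 ≤ e.1 := ht.trans he.2.1
  have hD := nextDate_eq hM n h0
  have hle := le_date_dateIndex hM n h0 he.2.2
  refine M.ae_eventLaw n e a (measurableSet_eventBox M F t) (fun r hr hlt => ?_) ?_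
  · filter_upwards [HF.closed.ae_jumpLaw_mem he.1] with y hy
    refine ⟨hy, ?_, ?_⟩
    · change t ≤ e.1 + r
      linarith [he.2.1]
    · change e.1 + r ≤ M.horizon
      rw [hD] at hlt
      linarith [M.date_le (M.dateIndex n e.1)]
  · filter_upwards [HF.ae_decisionLaw he.1 (Nat.pos_of_ne_zero hp) (M.nextDecision n e.1 a)]
      with z hz
    refine ⟨hz.1, ?_, ?_⟩
    · change t ≤ M.nextDate n e.1
      rw [hD]
      exact he.2.1.trans hle
    · change M.nextDate n e.1 ≤ M.horizon
      rw [hD]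
      exact M.date_le _

theorem ControlClosed.stoppedChain (hM : M.Assumptions) (HF : M.ControlClosed F) {t : ℝ}
    (ht : 0 ≤ t) (htT : t ≤ M.horizon) {u : State} (hu : u ∈ F) (h0 : 0 < u.inventory)
    (μ : Policy) :
    StoppedChain (M.eventKernel μ) ((t, ⟨none, u⟩) : Event) executedSet
      (fun _ => M.eventBox F t) where
  measurable_stopping := measurableSet_executedSet
  measurable_good _ := measurableSet_eventBox M F t
  start_mem := ⟨hu, le_rfl, htT⟩
  start_notMem := h0.ne'
  step_mem n h hh hp := HF.ae_eventLaw_mem hM ht hh hp n (μ.act n h)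

/-- Time alone does not contract, since a date may be reached immediately. The function `ψ` adds a
factor `θ` per date number: a market jump contracts by the discount of the clock, a decision before
`T` by the passage to the next date, and the order imposed at `T` stops the chain. -/
theorem ControlClosed.ae_executed (hM : M.Assumptions) (HF : M.ControlClosed F) {t : ℝ}
    (ht : 0 ≤ t) (htT : t ≤ M.horizon) {u : State} (hu : u ∈ F) (h0 : 0 < u.inventory)
    (μ : Policy) :
    ∀ᵐ ω ∂M.controlledLaw μ t u, ∃ k, ω k ∈ executedSet := by
  classical
  have HC := HF.stoppedChain hM ht htT hu h0 μ
  obtain ⟨L, hL0, hL⟩ := exitRate_le_of_finite M.rates HF.closed.finite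
  set θ := L / (1 + L) with hθ
  have hθ0 : 0 < θ := by positivity
  have hθ1 : θ < 1 := by rw [hθ, div_lt_one (by positivity)]; linarith
  let ψ : ℕ → Event → ℝ := fun n e => Real.exp (-max e.1 0) * θ ^ M.dateIndex n e.1
  have hψ : ∀ n, Measurable (ψ n) := fun n =>
    Measurable.mul (by fun_prop) ((Measurable.of_discrete (f := fun j : ℕ => θ ^ j)).comp
      ((measurable_dateIndex n).comp measurable_fst))
  have hψ0 : ∀ n e, 0 ≤ ψ n e := fun n e => by positivity
  have hψ1 : ∀ n e, ψ n e ≤ 1 := fun n e =>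
    mul_le_one₀ (by simp) (by positivity) (pow_le_one₀ hθ0.le hθ1.le)
  refine HC.ae_exists_mem hψ hψ0 (C := 1)
    (δ := Real.exp (-M.horizon) * θ ^ (⌊M.horizon / M.period⌋₊ + 1)) (by positivity) hθ0 hθ1
    (fun n e _ => hψ1 n e) ?_ ?_
  · intro n e he _
    refine mul_le_mul ?_ (pow_le_pow_of_le_one hθ0.le hθ1.le (dateIndex_le hM n he.2.2))
      (by positivity) (by positivity)
    rw [Real.exp_le_exp, neg_le_neg_iff]
    exact max_le he.2.2 hM.horizon_nonneg
  · intro n h hh hp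
    set e := lastOf n h
    set a := μ.act n h
    have he0 : 0 ≤ e.1 := ht.trans hh.2.1
    have hD := nextDate_eq hM n he0
    have hle := le_date_dateIndex hM n he0 hh.2.2
    have hxpos : 0 < e.2.state.inventory := Nat.pos_of_ne_zero hp
    set j := M.dateIndex n e.1 with hj
    have hφm : Measurable fun e' : Event => stepValue executedSet (fun _ => 0) ψ n e e' :=
      (measurable_stepValue measurableSet_executedSet measurable_const hψ n).comp
        (measurable_prodMk_left (x := e))
    have hφ0 : ∀ e', 0 ≤ stepValue executedSet (fun _ => 0) ψ n e e' := fun e' => by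
      rw [stepValue]
      split_ifs
      · exact le_rfl
      · exact hψ0 _ _
    have hφ1 : ∀ e', stepValue executedSet (fun _ => 0) ψ n e e' ≤ ψ (n + 1) e' := fun e' => by
      rw [stepValue]
      split_ifs
      · exact hψ0 _ _
      · exact le_rfl
    change ∫ e', stepValue executedSet (fun _ => 0) ψ n e e' ∂M.eventLaw n e a ≤ _
    rw [M.integral_eventLaw n e a hφm (C := 1) (Eventually.of_forall fun e' => by
      rw [Real.norm_eq_abs, abs_of_nonneg (hφ0 e')]
      exact (hφ1 e').trans (hψ1 _ _)), hD]
    set d := M.date j - e.1 with hd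
    have hd0 : 0 ≤ d := sub_nonneg.2 hle
    -- Reaching the date without a jump is charged exactly the limiting value `θ * exp (-d)` that
    -- the clock estimate admits.
    have hclock := integral_clock_exp_le (K := θ * Real.exp (-d)) (exitRate_pos M.rates e.2.state)
      (hL _ hh.1) hd0 (le_of_eq (by rw [hθ]))
    have hψe : ψ n e = Real.exp (-e.1) * θ ^ j := by
      simp only [ψ, max_eq_left he0, hj]
    have hK : ∫ z, stepValue executedSet (fun _ => 0) ψ n e
        (M.date j, ⟨some (M.nextDecision n e.1 a), z⟩)
          ∂M.decisionLaw e.2.state (M.nextDecision n e.1 a) ≤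
        ψ n e * (θ * Real.exp (-d)) := by
      have hae : ∀ᵐ z ∂M.decisionLaw e.2.state (M.nextDecision n e.1 a),
          stepValue executedSet (fun _ => 0) ψ n e
            (M.date j, ⟨some (M.nextDecision n e.1 a), z⟩) ≤ ψ n e * (θ * Real.exp (-d)) := by
        filter_upwards [HF.ae_decisionLaw hh.1 hxpos (M.nextDecision n e.1 a)] with z hz
        -- A market order stops the chain; any other decision is taken at a date before the horizon,
        -- and the next date number is `j + 1`.
        by_cases hb : M.nextDecision n e.1 a = .m
        · have : ((M.date j, ⟨some (M.nextDecision n e.1 a), z⟩) : Event) ∈ executedSet :=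
            hz.2.1 hb
          rw [stepValue, if_pos this, hψe]
          positivity
        · refine (hφ1 _).trans (le_of_eq ?_)
          have hne : M.date j ≠ M.horizon := fun h => hb (by
            rw [nextDecision, hD, if_pos h])
          have hdate : M.date j = j * M.period := by
            rcases min_choice (j * M.period) M.horizon with h | h
            · exact h
            · exact absurd h hne
          have hidx : M.dateIndex (n + 1) (M.date j) = j + 1 := by
            rw [hdate]
            exact dateIndex_mul_period hM n j
          rw [hψe]
          simp only [ψ, hidx, max_eq_left (he0.trans hle)]
          have : Real.exp (-M.date j) = Real.exp (-e.1) * Real.exp (-d) := by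
            rw [← Real.exp_add, hd]
            congr 1
            ring
          rw [this, pow_succ]
          ring
      refine (integral_mono_of_nonneg (Eventually.of_forall fun z => hφ0 _) (integrable_const _)
        hae).trans_eq (by simp)
    have hmono : ∫ r, (if r < d then ∫ y, stepValue executedSet (fun _ => 0) ψ n e
            (e.1 + r, ⟨none, y⟩) ∂jumpLaw M.rates e.2.state
          else ∫ z, stepValue executedSet (fun _ => 0) ψ n e
            (M.date j, ⟨some (M.nextDecision n e.1 a), z⟩)
            ∂M.decisionLaw e.2.state (M.nextDecision n e.1 a))
          ∂expMeasure (exitRate M.rates e.2.state) ≤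
        ∫ r, ψ n e * (if r < d then Real.exp (-r) else θ * Real.exp (-d))
          ∂expMeasure (exitRate M.rates e.2.state) := by
      refine integral_mono_of_nonneg ?_ ?_ ?_
      · refine Eventually.of_forall fun r => ?_
        dsimp only
        split_ifs
        · exact integral_nonneg fun y => hφ0 _
        · exact integral_nonneg fun z => hφ0 _
      · refine Integrable.const_mul (Integrable.of_bound (C := 1 + θ * Real.exp (-d)) ?_ ?_) _
        · exact (Measurable.ite (measurableSet_lt measurable_id measurable_const) (by fun_prop)
            measurable_const).aestronglyMeasurable
        · filter_upwards [ae_pos_expMeasure (exitRate M.rates e.2.state)] with r hr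
          have h1 : Real.exp (-r) ≤ 1 := Real.exp_le_one_iff.2 (by linarith)
          have h2 : 0 < θ * Real.exp (-d) := by positivity
          rw [Real.norm_eq_abs]
          split_ifs
          · rw [abs_of_pos (Real.exp_pos _)]
            linarith
          · rw [abs_of_pos h2]
            linarith
      · filter_upwards [ae_pos_expMeasure (exitRate M.rates e.2.state)] with r hr
        split_ifs with hlt
        · have hidx : M.dateIndex (n + 1) (e.1 + r) = j :=
            dateIndex_eq_of_lt_date hM n he0 (by linarith) (by rw [← hj]; linarith)
          have hval : ∀ y, ψ (n + 1) (e.1 + r, ⟨none, y⟩) = ψ n e * Real.exp (-r) := fun y => by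
            rw [hψe]
            simp only [ψ, hidx, max_eq_left (show 0 ≤ e.1 + r by linarith)]
            have : Real.exp (-(e.1 + r)) = Real.exp (-e.1) * Real.exp (-r) := by
              rw [← Real.exp_add]
              congr 1
              ring
            rw [this]
            ring
          refine (integral_mono_of_nonneg (g := fun _ => ψ n e * Real.exp (-r))
            (Eventually.of_forall fun y => hφ0 _) (integrable_const _)
            (Eventually.of_forall fun y => (hφ1 _).trans_eq (hval y))).trans_eq (by simp)
        · exact hK
    refine hmono.trans ?_
    rw [integral_const_mul, mul_comm]
    exact mul_le_mul_of_nonneg_right hclock (hψ0 _ _)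

/-- One step of the controlled process: the loss of value comes from the decision only. -/
theorem ValueFamily.integral_step (hM : M.Assumptions) (HF : M.ControlClosed F)
    (H : ValueFamily M F B Y) {t : ℝ} (ht : 0 ≤ t) {e : Event} (he : e ∈ M.eventBox F t)
    (hp : e ∉ executedSet) (n : ℕ) (a : Action) {j : ℕ} (hj : M.dateIndex n e.1 = j) :
    ∫ e', stepValue executedSet (M.executionGain t) (M.eventValue Y t) n e e' ∂M.eventLaw n e a =
      M.eventValue Y t n e -
        Real.exp (-(exitRate M.rates e.2.state * (M.date j - e.1))) * (B j e.2.state -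
          M.decisionValue (Y (j + 1) (M.date (j + 1) - j * M.period)) e.2.state
            (M.nextDecision n e.1 a)) := by
  classical
  have he0 : 0 ≤ e.1 := ht.trans he.2.1
  have hD : M.nextDate n e.1 = M.date j := by rw [nextDate_eq hM n he0, hj]
  have hle : e.1 ≤ M.date j := hj ▸ le_date_dateIndex hM n he0 he.2.2
  have hx := he.1
  have hxpos : 0 < e.2.state.inventory := Nat.pos_of_ne_zero hp
  set x := e.2.state with hxdef
  set b := M.nextDecision n e.1 a with hb
  have hφm : Measurable fun e' : Event =>
      stepValue executedSet (M.executionGain t) (M.eventValue Y t) n e e' :=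
    (measurable_stepValue measurableSet_executedSet (measurable_executionGain t)
      (H.measurable_eventValue HF t) n).comp (measurable_prodMk_left (x := e))
  obtain ⟨C, hC1, hC2⟩ := H.exists_bound hM HF ht
  rw [M.integral_eventLaw n e a hφm (C := C) (by
    filter_upwards [HF.ae_eventLaw_mem hM ht he hp n a] with e' he'
    rw [stepValue]
    split_ifs
    · exact hC2 e he e' he'
    · exact hC1 _ e' he'), hD, ← hxdef, ← hb]
  set d := M.date j - e.1 with hd
  have hd0 : 0 ≤ d := sub_nonneg.2 hle
  -- At the date, a market order collects the gain of the state in which it is sent, whatever state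
  -- follows; any other decision keeps the inventory positive and the chain continues toward the
  -- date `j + 1`.
  have hK : ∫ z, stepValue executedSet (M.executionGain t) (M.eventValue Y t) n e
      (M.date j, ⟨some b, z⟩) ∂M.decisionLaw x b =
      M.decisionValue (Y (j + 1) (M.date (j + 1) - j * M.period)) x b -
        M.cost * (M.date j - t) := by
    have hdec := HF.ae_decisionLaw hx hxpos b
    by_cases hbm : b = .m
    · rw [hbm] at hdec ⊢
      have : (fun z => stepValue executedSet (M.executionGain t) (M.eventValue Y t) n e
          (M.date j, ⟨some .m, z⟩)) =ᵐ[M.decisionLaw x .m]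
          fun _ => M.marketGain x - M.cost * (M.date j - t) := by
        filter_upwards [hdec] with z hz
        have hz' : ((M.date j, ⟨some .m, z⟩) : Event) ∈ executedSet := hz.2.1 rfl
        rw [stepValue, if_pos hz']
        simp only [executionGain, if_true]
        rw [min_eq_left (M.date_le j)]
      rw [integral_congr_ae this, integral_const, probReal_univ, one_smul]
      rfl
    · have hne : M.date j ≠ M.horizon := fun h => hbm (by
        rw [hb, nextDecision, hD, if_pos h])
      have hdate : M.date j = j * M.period := by
        rcases min_choice (j * M.period) M.horizon with h | h
        · exact h
        · exact absurd h hne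
      have hidx : M.dateIndex (n + 1) (M.date j) = j + 1 := by
        rw [hdate]
        exact dateIndex_mul_period hM n j
      have : (fun z => stepValue executedSet (M.executionGain t) (M.eventValue Y t) n e
          (M.date j, ⟨some b, z⟩)) =ᵐ[M.decisionLaw x b]
          fun z => Y (j + 1) (M.date (j + 1) - j * M.period) z - M.cost * (M.date j - t) := by
        filter_upwards [hdec] with z hz
        have hz' : ((M.date j, ⟨some b, z⟩) : Event) ∉ executedSet := by
          change z.inventory ≠ 0
          rw [hz.2.2 hbm]
          exact hxpos.ne'
        rw [stepValue, if_neg hz']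
        simp only [eventValue, hidx]
        rw [hdate]
      have hint : Integrable (fun z => Y (j + 1) (M.date (j + 1) - j * M.period) z)
          (M.decisionLaw x b) :=
        integrable_of_ae_mem_finite HF.closed.finite (hdec.mono fun z hz => hz.1) _
      rw [integral_congr_ae this, integral_sub hint (integrable_const _), integral_const,
        probReal_univ, one_smul]
      congr 1
      unfold decisionLaw
      rw [if_neg hxpos.ne']
      cases hb' : b
      · exact integral_dirac _ _
      · rfl
      · exact absurd hb' hbm
  rw [hK]
  -- The running cost is the source of the backward equation, and the additive constant is the cost
  -- paid from `t` to `e.1`.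
  have hclock := HF.closed.integral_clock_backward hx (Y := Y j) (b := -M.cost)
    (fun y hy => H.continuous j hy) (fun s => H.deriv j s x hx hxpos) hd0 (-(M.cost * (e.1 - t)))
    (M.decisionValue (Y (j + 1) (M.date (j + 1) - j * M.period)) x b - M.cost * (M.date j - t))
  have hcongr : ∫ r, (if r < d then ∫ y, stepValue executedSet (M.executionGain t)
        (M.eventValue Y t) n e (e.1 + r, ⟨none, y⟩) ∂jumpLaw M.rates x
      else M.decisionValue (Y (j + 1) (M.date (j + 1) - j * M.period)) x b -
        M.cost * (M.date j - t)) ∂expMeasure (exitRate M.rates x) =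
      ∫ r, (if r < d then ∫ y, Y j (d - r) y ∂jumpLaw M.rates x +
          (-M.cost * r + -(M.cost * (e.1 - t)))
      else M.decisionValue (Y (j + 1) (M.date (j + 1) - j * M.period)) x b -
        M.cost * (M.date j - t)) ∂expMeasure (exitRate M.rates x) := by
    refine integral_congr_ae ?_
    filter_upwards [ae_pos_expMeasure (exitRate M.rates x)] with r hr
    split_ifs with hlt
    · have hidx : M.dateIndex (n + 1) (e.1 + r) = j := by
        rw [← hj]
        exact dateIndex_eq_of_lt_date hM n he0 (by linarith) (by rw [hj]; linarith)
      have hae := HF.closed.ae_jumpLaw_mem hx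
      have hval : (fun y => stepValue executedSet (M.executionGain t) (M.eventValue Y t) n e
          (e.1 + r, ⟨none, y⟩)) =ᵐ[jumpLaw M.rates x]
          fun y => Y j (d - r) y + (-M.cost * r + -(M.cost * (e.1 - t))) := by
        filter_upwards [hae] with y hy
        rw [stepValue]
        -- If the jump completes a limit order, the gain collected is `Y j` at the executed state,
        -- because a market order for nothing changes nothing.
        split_ifs with h0
        · have h0' : y.inventory = 0 := h0
          rw [H.executed j _ y hy h0', marketGain_of_inventory_eq_zero (HF.valid y hy) h0']
          have hmin : min (e.1 + r) M.horizon = e.1 + r :=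
            min_eq_left (by linarith [M.date_le j])
          simp only [executionGain, hmin]
          rw [if_neg (by simp)]
          ring
        · simp only [eventValue, hidx]
          rw [show M.date j - (e.1 + r) = d - r by rw [hd]; ring]
          ring
      rw [integral_congr_ae hval, integral_add
        (integrable_of_ae_mem_finite HF.closed.finite hae _) (integrable_const _), integral_const,
        probReal_univ, one_smul]
    · rfl
  rw [hcongr, hclock, H.zero j x hx, eventValue, hj, ← hd, ← hxdef]
  have : B j x + (-M.cost * d + -(M.cost * (e.1 - t))) -
      (M.decisionValue (Y (j + 1) (M.date (j + 1) - j * M.period)) x b -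
        M.cost * (M.date j - t)) =
      B j x - M.decisionValue (Y (j + 1) (M.date (j + 1) - j * M.period)) x b := by
    rw [hd]
    ring
  rw [this]
  ring

theorem date_eq_horizon_iff (j : ℕ) : M.date j = M.horizon ↔ M.horizon ≤ j * M.period :=
  min_eq_right_iff

/-- The sign of the defect in `ValueFamily.integral_step`. The hypothesis on `b` reflects the market
order imposed at the horizon, where no other decision has to be compared. -/
theorem ValueFamily.decisionValue_le (H : ValueFamily M F B Y) {x : State} (hx : x ∈ F)
    (h0 : 0 < x.inventory) (j : ℕ) {b : Action} (hb : M.date j = M.horizon → b = .m) :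
    M.decisionValue (Y (j + 1) (M.date (j + 1) - j * M.period)) x b ≤ B j x := by
  by_cases h : M.date j = M.horizon
  · rw [hb h, H.terminal j ((date_eq_horizon_iff j).1 h) x hx]
    exact le_rfl
  · rw [H.step j (not_le.1 fun h' => h ((date_eq_horizon_iff j).2 h')) x hx h0]
    cases b
    · exact (le_max_left _ _).trans (le_max_left _ _)
    · exact (le_max_right _ _).trans (le_max_left _ _)
    · exact le_max_right _ _

open Classical in
/-- An optimal decision at the date number `j`. -/
noncomputable def bestAction (M : Model) (B : ℕ → State → ℝ) (Y : ℕ → ℝ → State → ℝ) (j : ℕ)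
    (x : State) : Action :=
  if B j x = M.decisionValue (Y (j + 1) (M.date (j + 1) - j * M.period)) x .l then .l
  else if B j x = M.decisionValue (Y (j + 1) (M.date (j + 1) - j * M.period)) x .c then .c
  else .m

/-- Among three decisions the maximum is attained, so the defect vanishes and an optimal control
exists. -/
theorem ValueFamily.decisionValue_bestAction (H : ValueFamily M F B Y) {x : State} (hx : x ∈ F)
    (h0 : 0 < x.inventory) (j : ℕ) {b : Action} (hb : M.date j = M.horizon → b = .m)
    (hb' : M.date j ≠ M.horizon → b = M.bestAction B Y j x) :
    M.decisionValue (Y (j + 1) (M.date (j + 1) - j * M.period)) x b = B j x := by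
  by_cases h : M.date j = M.horizon
  · rw [hb h, H.terminal j ((date_eq_horizon_iff j).1 h) x hx]
    rfl
  · have hs := H.step j (not_le.1 fun h' => h ((date_eq_horizon_iff j).2 h')) x hx h0
    rw [hb' h, bestAction]
    split_ifs with h1 h2
    · exact h1.symm
    · exact h2.symm
    · rcases max_choice (max (decisionValue M (Y (j + 1) (M.date (j + 1) - j * M.period)) x .l)
        (decisionValue M (Y (j + 1) (M.date (j + 1) - j * M.period)) x .c)) (M.marketGain x) with
        h3 | h3
      · rcases max_choice (decisionValue M (Y (j + 1) (M.date (j + 1) - j * M.period)) x .l)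
          (decisionValue M (Y (j + 1) (M.date (j + 1) - j * M.period)) x .c) with h4 | h4
        · exact absurd (hs.trans (h3.trans h4)) h1
        · exact absurd (hs.trans (h3.trans h4)) h2
      · exact (hs.trans h3).symm

/-- The control which takes an optimal decision at each date. -/
noncomputable def bestPolicy (M : Model) (B : ℕ → State → ℝ) (Y : ℕ → ℝ → State → ℝ) : Policy where
  act n h := M.bestAction B Y (M.dateIndex n (lastOf n h).1) (lastOf n h).2.state
  measurable_act n := by
    have h1 : Measurable fun q : ℕ × State => M.bestAction B Y q.1 q.2 :=
      measurable_from_prod_countable_right fun _ => Measurable.of_discrete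
    have h2 : Measurable fun h : (Π _ : Finset.Iic n, Event) => lastOf n h :=
      measurable_pi_apply _
    exact h1.comp (((measurable_dateIndex n).comp (measurable_fst.comp h2)).prodMk
      (measurable_state.comp h2))

theorem nextDecision_of_eq (hM : M.Assumptions) {n : ℕ} {s : ℝ} (hs : 0 ≤ s) {a : Action} {j : ℕ}
    (hj : M.dateIndex n s = j) :
    (M.date j = M.horizon → M.nextDecision n s a = .m) ∧
      (M.date j ≠ M.horizon → M.nextDecision n s a = a) := by
  rw [nextDecision, nextDate_eq hM n hs, hj]
  exact ⟨fun h => if_pos h, fun h => if_neg h⟩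

/-- Under any control the candidate net of waiting costs is a supermartingale until the execution,
and the payoff is its reward there. -/
theorem ValueFamily.integral_payoff_le (hM : M.Assumptions) (HF : M.ControlClosed F)
    (H : ValueFamily M F B Y) {t : ℝ} (ht : 0 ≤ t) (htT : t ≤ M.horizon) {u : State}
    (hu : u ∈ F) (h0 : 0 < u.inventory) (μ : Policy) :
    Integrable (M.payoff t) (M.controlledLaw μ t u) ∧
      ∫ ω, M.payoff t ω ∂M.controlledLaw μ t u ≤
        Y (M.dateIndex 0 t) (M.date (M.dateIndex 0 t) - t) u := by
  obtain ⟨C, hC1, hC2⟩ := H.exists_bound hM HF ht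
  have key := (HF.stoppedChain hM ht htT hu h0 μ).integral_hitReward_le
    (HF.ae_executed hM ht htT hu h0 μ) (measurable_executionGain t)
    (H.measurable_eventValue HF t) hC1 (fun n e he e' he' _ _ => hC2 e he e' he') (by
      intro n h hh hp
      change ∫ e', stepValue executedSet (M.executionGain t) (M.eventValue Y t) n (lastOf n h) e'
        ∂M.eventLaw n (lastOf n h) (μ.act n h) ≤ _
      rw [H.integral_step hM HF ht hh hp n (μ.act n h) rfl]
      have h1 := H.decisionValue_le hh.1 (Nat.pos_of_ne_zero hp) (M.dateIndex n (lastOf n h).1)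
        (nextDecision_of_eq hM (ht.trans hh.2.1) (a := μ.act n h) rfl).1
      have h2 := mul_nonneg (Real.exp_pos (-(exitRate M.rates (lastOf n h).2.state *
        (M.date (M.dateIndex n (lastOf n h).1) - (lastOf n h).1)))).le (sub_nonneg.2 h1)
      linarith)
  have hz : M.eventValue Y t 0 (t, ⟨none, u⟩) =
      Y (M.dateIndex 0 t) (M.date (M.dateIndex 0 t) - t) u := by
    simp [eventValue]
  rw [hz] at key
  exact key

/-- Under the maximising control each step is an equality, so the comparison applies to the opposite
of the candidate. -/
theorem ValueFamily.le_integral_payoff (hM : M.Assumptions) (HF : M.ControlClosed F)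
    (H : ValueFamily M F B Y) {t : ℝ} (ht : 0 ≤ t) (htT : t ≤ M.horizon) {u : State}
    (hu : u ∈ F) (h0 : 0 < u.inventory) :
    Y (M.dateIndex 0 t) (M.date (M.dateIndex 0 t) - t) u ≤
      ∫ ω, M.payoff t ω ∂M.controlledLaw (M.bestPolicy B Y) t u := by
  obtain ⟨C, hC1, hC2⟩ := H.exists_bound hM HF ht
  have key := (HF.stoppedChain hM ht htT hu h0 (M.bestPolicy B Y)).integral_hitReward_le
    (HF.ae_executed hM ht htT hu h0 _) (measurable_executionGain t).neg
    (w := fun n e => -M.eventValue Y t n e)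
    (fun n => (H.measurable_eventValue HF t n).neg)
    (fun n e he => by rw [abs_neg]; exact hC1 n e he)
    (fun n e he e' he' _ _ => by rw [Pi.neg_apply, abs_neg]; exact hC2 e he e' he') (by
      intro n h hh hp
      have hneg : ∀ e', stepValue executedSet (-M.executionGain t)
          (fun n e => -M.eventValue Y t n e) n (lastOf n h) e' =
          -stepValue executedSet (M.executionGain t) (M.eventValue Y t) n (lastOf n h) e' := by
        intro e'
        simp only [stepValue]
        split_ifs <;> rfl
      simp only [hneg, integral_neg]
      change -∫ e', stepValue executedSet (M.executionGain t) (M.eventValue Y t) n (lastOf n h) e'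
        ∂M.eventLaw n (lastOf n h) ((M.bestPolicy B Y).act n h) ≤ _
      rw [H.integral_step hM HF ht hh hp n _ rfl]
      have h1 := nextDecision_of_eq hM (ht.trans hh.2.1) (a := (M.bestPolicy B Y).act n h)
        (n := n) rfl
      rw [H.decisionValue_bestAction hh.1 (Nat.pos_of_ne_zero hp)
        (M.dateIndex n (lastOf n h).1) h1.1 h1.2, sub_self, mul_zero, sub_zero])
  have hz : M.eventValue Y t 0 (t, ⟨none, u⟩) =
      Y (M.dateIndex 0 t) (M.date (M.dateIndex 0 t) - t) u := by
    simp [eventValue]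
  have h5 := key.2
  have h6 : ∀ ω, hitReward executedSet (-M.executionGain t) ω = -M.payoff t ω := fun ω => rfl
  simp only [h6, integral_neg, hz] at h5
  exact neg_le_neg_iff.1 h5

/-- The payoff is the gain of the present state if the order is already executed. -/
theorem payoff_ae_eq_of_inventory_eq_zero {t : ℝ} (htT : t ≤ M.horizon) {u : State}
    (hu : u.Valid) (h0 : u.inventory = 0) (μ : Policy) :
    M.payoff t =ᵐ[M.controlledLaw μ t u] fun _ => M.marketGain u := by
  have h := ae_zero_chainLaw (M.eventKernel μ) ((t, ⟨none, u⟩) : Event)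
  change M.payoff t =ᵐ[chainLaw (M.eventKernel μ) ((t, ⟨none, u⟩) : Event)] _
  filter_upwards [h] with ω hω
  have h1 : hitIndex executedSet ω = 0 :=
    hitIndex_eq (by rw [hω]; exact h0) fun k hk => absurd hk (Nat.not_lt_zero k)
  rw [payoff_eq_hitReward, hitReward, h1, hω]
  simp only [executionGain]
  -- The initial event carries no decision, so an execution at the index `0` is never read as a
  -- market order.
  rw [if_neg (by simp), min_eq_left htT, sub_self, mul_zero, sub_zero,
    marketGain_of_inventory_eq_zero hu h0]

/-- The value function is the solution of the dynamic programming equations. -/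
theorem ValueFamily.value_eq (hM : M.Assumptions) (HF : M.ControlClosed F)
    (H : ValueFamily M F B Y) {t : ℝ} (ht : 0 ≤ t) (htT : t ≤ M.horizon) {u : State}
    (hu : u ∈ F) :
    (∀ μ : Policy, Integrable (M.payoff t) (M.controlledLaw μ t u)) ∧
      BddAbove (Set.range fun μ : Policy => ∫ ω, M.payoff t ω ∂M.controlledLaw μ t u) ∧
      M.value t u = Y (M.dateIndex 0 t) (M.date (M.dateIndex 0 t) - t) u := by
  have hne : Nonempty Policy := ⟨M.bestPolicy B Y⟩
  rcases Nat.eq_zero_or_pos u.inventory with h0 | h0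
  · have hint : ∀ μ, ∫ ω, M.payoff t ω ∂M.controlledLaw μ t u = M.marketGain u := fun μ => by
      have : IsProbabilityMeasure (M.controlledLaw μ t u) := by
        unfold controlledLaw
        infer_instance
      rw [integral_congr_ae (payoff_ae_eq_of_inventory_eq_zero htT (HF.valid u hu) h0 μ)]
      simp
    refine ⟨fun μ => ?_, ⟨M.marketGain u, ?_⟩, ?_⟩
    · have : IsProbabilityMeasure (M.controlledLaw μ t u) := by
        unfold controlledLaw
        infer_instance
      exact (integrable_congr
        (payoff_ae_eq_of_inventory_eq_zero htT (HF.valid u hu) h0 μ)).2 (integrable_const _)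
    · rintro _ ⟨μ, rfl⟩
      exact (hint μ).le
    · rw [value]
      simp only [hint, ciSup_const]
      exact (H.executed _ _ u hu h0).symm
  · have hle := fun μ => H.integral_payoff_le hM HF ht htT hu h0 μ
    have hbdd : BddAbove
        (Set.range fun μ : Policy => ∫ ω, M.payoff t ω ∂M.controlledLaw μ t u) := by
      refine ⟨Y (M.dateIndex 0 t) (M.date (M.dateIndex 0 t) - t) u, ?_⟩
      rintro _ ⟨μ, rfl⟩
      exact (hle μ).2
    refine ⟨fun μ => (hle μ).1, hbdd, le_antisymm (ciSup_le fun μ => (hle μ).2) ?_⟩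
    exact (H.le_integral_payoff hM HF ht htT hu h0).trans (le_ciSup hbdd _)

end

end Model

/-! ## The value function -/

namespace Model

variable {M : Model} {F : Set State} {B : ℕ → State → ℝ} {Y : ℕ → ℝ → State → ℝ}

theorem dateIndex_zero_eq (hM : M.Assumptions) {j : ℕ} {s : ℝ}
    (h1 : ((j : ℝ) - 1) * M.period < s) (h2 : s ≤ j * M.period) : M.dateIndex 0 s = j := by
  have hΔ := hM.period_pos
  rw [dateIndex, if_pos rfl]
  refine le_antisymm (Nat.ceil_le.2 ((div_le_iff₀ hΔ).2 h2)) ?_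
  rcases j with _ | m
  · exact Nat.zero_le _
  · refine Nat.succ_le_of_lt (Nat.lt_ceil.2 ((lt_div_iff₀ hΔ).2 ?_))
    push_cast at h1
    linarith

/-- A date belongs to the interval that it closes, because a decision at the initial time is still
pending. Hence left continuity, and a possible jump to the right of a date. -/
theorem ValueFamily.value_eq_of_mem_Ioc (hM : M.Assumptions) (HF : M.ControlClosed F)
    (H : ValueFamily M F B Y) {j : ℕ} {s : ℝ} (hs : 0 ≤ s)
    (h : s ∈ Set.Ioc (((j : ℝ) - 1) * M.period) (M.date j)) {x : State} (hx : x ∈ F) :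
    M.value s x = Y j (M.date j - s) x := by
  rw [(H.value_eq hM HF hs (h.2.trans (date_le j)) hx).2.2,
    dateIndex_zero_eq hM h.1 (h.2.trans (min_le_left _ _))]

theorem exists_mem_Ioc_date (hM : M.Assumptions) {s : ℝ} (hs : 0 ≤ s) (hsT : s ≤ M.horizon) :
    ∃ j : ℕ, s ∈ Set.Ioc (((j : ℝ) - 1) * M.period) (M.date j) := by
  have hΔ := hM.period_pos
  refine ⟨⌈s / M.period⌉₊, ?_, le_min ((div_le_iff₀ hΔ).1 (Nat.le_ceil _)) hsT⟩
  rw [← lt_div_iff₀ hΔ]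
  linarith [Nat.ceil_lt_add_one (div_nonneg hs hΔ.le)]

/-- The value at a decision date is the best of the values of the three decisions. -/
theorem ValueFamily.exists_value_eq_max (hM : M.Assumptions) (HF : M.ControlClosed F)
    (H : ValueFamily M F B Y) {k : ℕ} (hk : k * M.period < M.horizon) {u : State} (hu : u ∈ F)
    (h0 : 0 < u.inventory) :
    ∃ Vl Vc : ℝ,
      Tendsto (fun s => M.value s (limitState u)) (𝓝[>] (k * M.period)) (𝓝 Vl) ∧
      Tendsto (fun s => ∫ y, M.value s y ∂(M.cancelLaw u)) (𝓝[>] (k * M.period)) (𝓝 Vc) ∧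
      M.value (k * M.period) u = max (max Vl Vc) (M.marketGain u) := by
  have hΔ := hM.period_pos
  have hkΔ : 0 ≤ k * M.period := by positivity
  have hlt : k * M.period < M.date (k + 1) := by
    refine lt_min ?_ hk
    push_cast
    linarith
  -- Just after `k * M.period` the pending date is number `k + 1`. The identity holds for all states
  -- of `F` at once, as required under the integral over the cancellation law.
  have hev : ∀ᶠ s in 𝓝[>] (k * M.period), ∀ x ∈ F,
      M.value s x = Y (k + 1) (M.date (k + 1) - s) x := by
    filter_upwards [Ioo_mem_nhdsGT hlt] with s hs x hx
    refine H.value_eq_of_mem_Ioc hM HF (hkΔ.trans hs.1.le) ⟨?_, hs.2.le⟩ hx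
    push_cast
    simpa using hs.1
  have hca : ∀ᵐ y ∂M.cancelLaw u, y ∈ F := (HF.cancelLaw u hu).mono fun y hy => hy.1
  have hc : Continuous fun s => M.date (k + 1) - s := continuous_const.sub continuous_id
  refine ⟨Y (k + 1) (M.date (k + 1) - k * M.period) (limitState u),
    ∫ y, Y (k + 1) (M.date (k + 1) - k * M.period) y ∂M.cancelLaw u, ?_, ?_, ?_⟩
  · refine Tendsto.congr' (hev.mono fun s hs => (hs _ (HF.limitState u hu)).symm) ?_
    exact (((H.continuous (k + 1) (HF.limitState u hu)).comp hc).tendsto _).mono_left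
      nhdsWithin_le_nhds
  · refine Tendsto.congr' (hev.mono fun s hs =>
      (integral_congr_ae (hca.mono fun y hy => hs y hy)).symm) ?_
    exact (((continuous_integral_of_finite HF.closed.finite hca
      fun y hy => H.continuous (k + 1) hy).comp hc).tendsto _).mono_left nhdsWithin_le_nhds
  · have hd : M.date k = k * M.period := min_eq_left hk.le
    rw [H.value_eq_of_mem_Ioc hM HF hkΔ (j := k) ⟨by nlinarith, hd.ge⟩ hu, hd, sub_self,
      H.zero k u hu, H.step k hk u hu h0]
    rfl

/-- The backward equation between the decision dates. -/
theorem ValueFamily.exists_hasDerivAt_value (hM : M.Assumptions) (HF : M.ControlClosed F)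
    (H : ValueFamily M F B Y) {t : ℝ} (ht : 0 < t) (htT : t < M.horizon)
    (htk : ∀ k : ℕ, t ≠ k * M.period) {u : State} (hu : u ∈ F) (h0 : 0 < u.inventory) :
    ∃ V' : ℝ, HasDerivAt (fun s => M.value s u) V' t ∧
      V' + generator M.rates (M.value t) u = M.waitCost * M.orderSize := by
  obtain ⟨j, hj⟩ := exists_mem_Ioc_date hM ht.le htT.le
  have hlt : t < M.date j := by
    refine lt_min (lt_of_le_of_ne (hj.2.trans (min_le_left _ _)) (htk j)) htT
  have hev : (fun s => M.value s u) =ᶠ[𝓝 t] fun s => Y j (M.date j - s) u := by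
    filter_upwards [Ioo_mem_nhds hj.1 hlt, lt_mem_nhds ht] with s hs hs0
    exact H.value_eq_of_mem_Ioc hM HF hs0.le ⟨hs.1, hs.2.le⟩ hu
  -- The jumps from `u` stay in `F`, where all the values at the time `t` are given by the same
  -- index `j`.
  have hg : generator M.rates (M.value t) u = generator M.rates (Y j (M.date j - t)) u := by
    refine integral_congr_ae ((HF.closed.ae_mem u hu).mono fun y hy => ?_)
    simp only
    rw [H.value_eq_of_mem_Ioc hM HF ht.le hj hy, H.value_eq_of_mem_Ioc hM HF ht.le hj hu]
  have hsub : HasDerivAt (fun s => M.date j - s) (-1) t := by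
    simpa using (hasDerivAt_id t).const_sub (M.date j)
  refine ⟨_, ((H.deriv j (M.date j - t) u hu h0).comp t hsub).congr_of_eventuallyEq hev, ?_⟩
  rw [hg, cost]
  ring

theorem ValueFamily.continuousWithinAt_value (hM : M.Assumptions) (HF : M.ControlClosed F)
    (H : ValueFamily M F B Y) {t : ℝ} (ht : 0 < t) (htT : t ≤ M.horizon) {u : State}
    (hu : u ∈ F) : ContinuousWithinAt (fun s => M.value s u) (Set.Iic t) t := by
  obtain ⟨j, hj⟩ := exists_mem_Ioc_date hM ht.le htT
  have hc : Continuous fun s => Y j (M.date j - s) u :=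
    (H.continuous j hu).comp (continuous_const.sub continuous_id)
  refine hc.continuousWithinAt.congr_of_eventuallyEq ?_ (H.value_eq_of_mem_Ioc hM HF ht.le hj hu)
  filter_upwards [nhdsWithin_le_nhds (lt_mem_nhds hj.1), nhdsWithin_le_nhds (lt_mem_nhds ht),
    self_mem_nhdsWithin] with s h1 h2 h3
  exact H.value_eq_of_mem_Ioc hM HF h2.le ⟨h1, (Set.mem_Iic.1 h3).trans hj.2⟩ hu

theorem ValueFamily.value_horizon (hM : M.Assumptions) (HF : M.ControlClosed F)
    (H : ValueFamily M F B Y) {u : State} (hu : u ∈ F) :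
    M.value M.horizon u = M.marketGain u := by
  obtain ⟨j, hj⟩ := exists_mem_Ioc_date hM hM.horizon_nonneg le_rfl
  rw [H.value_eq_of_mem_Ioc hM HF hM.horizon_nonneg hj hu, le_antisymm (date_le j) hj.2, sub_self,
    H.zero j u hu, H.terminal j (hj.2.trans (min_le_left _ _)) u hu]

end Model

end OptimalExecution

open OptimalExecution in
theorem mainTheorem1 (M : Model) (hM : M.Assumptions) :
    -- all the quantities are well defined
    (∀ b : Book, b.Positive →
      (∀ s : ℝ, 0 ≤ s → Integrable (fun ω : ℕ → ℝ × Book => (stateAt ω s).price)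
        (jumpProcessLaw M.bookRates b)) ∧
      Tendsto (M.meanPrice b) atTop (𝓝 (M.longTermPrice b))) ∧
    (∀ u : State, u.Valid → Integrable M.priceImpact (M.marketLaw u)) ∧
    (∀ t ∈ Set.Icc 0 M.horizon, ∀ u : State, u.Valid →
      (∀ μ : Model.Policy, Integrable (M.payoff t) (M.controlledLaw μ t u)) ∧
      BddAbove (Set.range fun μ : Model.Policy => ∫ ω, M.payoff t ω ∂(M.controlledLaw μ t u)) ∧
      Integrable (M.value t) (M.rates u) ∧
      Integrable (M.value t) (M.cancelLaw u)) ∧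
    -- at a decision date
    (∀ k : ℕ, k * M.period < M.horizon → ∀ u : State, u.Valid → 0 < u.inventory →
      ∃ Vl Vc : ℝ,
        Tendsto (fun s => M.value s (Model.limitState u)) (𝓝[>] (k * M.period)) (𝓝 Vl) ∧
        Tendsto (fun s => ∫ y, M.value s y ∂(M.cancelLaw u)) (𝓝[>] (k * M.period)) (𝓝 Vc) ∧
        M.value (k * M.period) u = max (max Vl Vc) (M.marketGain u)) ∧
    -- between the decision dates
    (∀ t : ℝ, 0 < t → t < M.horizon → (∀ k : ℕ, t ≠ k * M.period) →
      ∀ u : State, u.Valid → 0 < u.inventory →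
        ∃ V' : ℝ, HasDerivAt (fun s => M.value s u) V' t ∧
          V' + generator M.rates (M.value t) u = M.waitCost * M.orderSize) ∧
    -- the values at a date are reached continuously from the left
    (∀ t : ℝ, 0 < t → t ≤ M.horizon → ∀ u : State, u.Valid →
      ContinuousWithinAt (fun s => M.value s u) (Set.Iic t) t) ∧
    -- execution
    (∀ t : ℝ, 0 ≤ t → t < M.horizon → ∀ u : State, u.Valid → u.inventory = 0 →
      M.value t u = M.marketGain u) ∧
    -- terminal condition
    (∀ u : State, u.Valid → M.value M.horizon u = M.marketGain u) := by
  -- The set and the family depend on `u`, the value function does not. Each assertion on the value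
  -- involves one `u` and states reachable from it, so one family is enough.
  have key : ∀ u : State, u.Valid → ∃ F B Y, M.ControlClosed F ∧ M.ValueFamily F B Y ∧ u ∈ F := by
    intro u hu
    obtain ⟨F, HF, huF⟩ := hM.exists_controlClosed hu
    obtain ⟨B, Y, H⟩ := HF.exists_valueFamily hM
    exact ⟨F, B, Y, HF, H, huF⟩
  refine ⟨fun b hb => hM.tendsto_meanPrice hb, fun u hu => ?_, fun t ht u hu => ?_,
    fun k hk u hu h0 => ?_, fun t ht htT htk u hu h0 => ?_, fun t ht htT u hu => ?_,
    fun t ht htT u hu h0 => ?_, fun u hu => ?_⟩ <;> obtain ⟨F, B, Y, HF, H, huF⟩ := key u hu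
  · exact integrable_of_ae_mem_finite HF.closed.finite
      ((HF.marketLaw u huF).mono fun y hy => hy.1) _
  · obtain ⟨h1, h2, -⟩ := H.value_eq hM HF ht.1 ht.2 huF
    exact ⟨h1, h2, HF.closed.integrable huF _, integrable_of_ae_mem_finite HF.closed.finite
      ((HF.cancelLaw u huF).mono fun y hy => hy.1) _⟩
  · exact H.exists_value_eq_max hM HF hk huF h0
  · exact H.exists_hasDerivAt_value hM HF ht htT htk huF h0
  · exact H.continuousWithinAt_value hM HF ht htT huF
  · rw [(H.value_eq hM HF ht htT.le huF).2.2, H.executed _ _ u huF h0]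
  · exact H.value_horizon hM HF huF
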